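/- **Theorem 2.** Let $\lambda_{C,U}\ge 0$, $\lambda_{C,D}>0$, $\lambda_C=\lambda_{C,U}+\lambda_{C,D}$, let $P_B,P_M,\beta_D,\mu>0$, $\sigma^2\ge 0$ and $\alpha>2$. In the plane, let the base stations (BSs) and the mobile stations (MSs) form two independent homogeneous Poisson point processes of intensity $\lambda_C$. Each BS and each MS is, independently of everything else, an uplink node with probability $\lambda_{C,U}/\lambda_C$ and a downlink node with probability $\lambda_{C,D}/\lambda_C$, so that the downlink BSs and the uplink MSs are thinned Poisson processes of intensities $\lambda_{C,D}$ and $\lambda_{C,U}$. A receiver at the origin is served by the BS in whose Voronoi cell it lies, i.e. by the nearest BS, at distance $R$; the receiver is a (typical) downlink MS if this BS is a downlink BS. The power gains $g$ of the channels from all BSs and MSs to the receiver are i.i.d. $\mathrm{Exp}(\mu)$ (rate $\mu$; $\mu=1$ is unit-mean Rayleigh fading) and independent of the locations and directions, the path loss is $\ell(x)=x^{-\alpha}$, and the downlink SINR is $$\gamma_D=\frac{g_0R^{-\alpha}P_B}{I^\psi+I^\varphi+\sigma^2},\qquad I^\psi=\sum_{u\in\psi}g_u\|u\|^{-\alpha}P_B,\qquad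 I^\varphi=\sum_{v\in\varphi}g_v\|v\|^{-\alpha}P_M,$$ where $g_0$ is the gain of the serving BS, $\psi$ is the set of downlink BSs other than the serving one, and $\varphi$ is the set of uplink MSs. Then, conditionally on the receiver being a downlink MS, the interferences $I^\psi,I^\varphi$ are almost surely finite and the downlink success probability of CoMPflex, $P_D^C=\Pr\{\gamma_D\ge\beta_D\}$, is $$P_D^{C}=2\pi\lambda_C\int_0^\infty r\exp\left(-\pi\lambda_C r^2-s\sigma^2\right)\mathcal L_\psi(s)\,\mathcal L_\varphi(s)\,\mathrm dr,\qquad s=\frac{\mu\beta_D r^\alpha}{P_B},$$ where $\mathcal L_\psi(s)=\mathbb E[e^{-sI^\psi}\mid R=r]$ and $\mathcal L_\varphi(s)=\mathbb E[e^{-sI^\varphi}\mid R=r]$, the Laplace transforms of the interference from BSs and MSs given that the serving distance is $r$, are, for almost every $r>0$, $$\mathcal L_\psi(s)=\exp\left(-2\pi\lambda_{C,D}\int_r^\infty\frac{\beta_D\left(\frac rx\right)^\alpha}{1+\beta_D\left(\frac rx\right)^\alpha}\,x\,\mathrm dx\right),$$ $$\mathcal L_\varphi(s)=\exp\left(-2\pi\lambda_{C,U}\int_0^\infty\frac{\beta_D\frac{P_M}{P_B}\left(\frac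 ry\right)^\alpha}{1+\beta_D\frac{P_M}{P_B}\left(\frac ry\right)^\alpha}\,y\,\mathrm dy\right).$$ All the integrals converge. -/

import Mathlib

open MeasureTheory ProbabilityTheory Real Set
open scoped ENNReal NNReal

noncomputable section

namespace CoMPflex

/-- The plane `ℝ²` with the Euclidean norm and Lebesgue (area) measure. -/
abbrev Plane : Type := EuclideanSpace ℝ (Fin 2)

/-- Traffic direction of a node: uplink or downlink. -/
inductive Direction : Type
  | uplink : Direction
  | downlink : Direction

instance : MeasurableSpace Direction := ⊤

/-- Number of points of the (enumerated) point process `X` that lie in `A`. -/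
def pointCount {Ω : Type*} (X : ℕ → Ω → Plane) (A : Set Plane) (ω : Ω) : ℕ∞ :=
  {i : ℕ | X i ω ∈ A}.encard

/-- The random points `X 0, X 1, …` form a homogeneous Poisson point process on the plane with
intensity `lam`: the number of points in a bounded Borel set `A` is Poisson distributed with mean
`lam * |A|`, and the numbers of points in disjoint bounded Borel sets are independent. -/
structure IsPoissonProcess {Ω : Type*} [MeasurableSpace Ω] (P : Measure Ω)
    (X : ℕ → Ω → Plane) (lam : ℝ) : Prop where
  measurable : ∀ i, Measurable (X i)
  count_law : ∀ A : Set Plane, MeasurableSet A → Bornology.IsBounded A → ∀ n : ℕ,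
    P {ω | pointCount X A ω = n}
      = poissonMeasure (Real.toNNReal (lam * (volume A).toReal)) {n}
  count_indep : ∀ (k : ℕ) (A : Fin k → Set Plane), (∀ j, MeasurableSet (A j)) →
    (∀ j, Bornology.IsBounded (A j)) → Pairwise (fun j l => Disjoint (A j) (A l)) →
    iIndepFun (fun j => pointCount X (A j)) P

/-- Poisson process `X` of intensity `lam` with independent marks `m`: the marks are i.i.d. with
law `ν` and independent of the locations. -/
structure IsMarkedPoissonProcess {Ω M : Type*} [MeasurableSpace Ω] [MeasurableSpace M]
    (P : Measure Ω) (X : ℕ → Ω → Plane) (m : ℕ → Ω → M) (lam : ℝ) (ν : Measure M) : Prop where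
  poisson : IsPoissonProcess P X lam
  mark_law : ∀ i, HasLaw (m i) ν P
  mark_indep : iIndepFun m P
  mark_indep_location : IndepFun (fun ω i => X i ω) (fun ω i => m i ω) P

/-- Law of the traffic direction when it is chosen at random, with probabilities proportional to
the uplink density `lamU` and the downlink density `lamD`. -/
def directionLaw (lamU lamD : ℝ) : Measure Direction :=
  ENNReal.ofReal (lamU / (lamU + lamD)) • Measure.dirac Direction.uplink
    + ENNReal.ofReal (lamD / (lamU + lamD)) • Measure.dirac Direction.downlink

/-- A random network as seen by a receiver (mobile station) at the origin: location of every base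
station and of every other mobile station, together with the mark of each of these nodes, which
consists of its traffic direction and the fading power of the channel from it to the receiver. -/
structure Network (Ω : Type*) where
  bsPos : ℕ → Ω → Plane
  bsMark : ℕ → Ω → Direction × ℝ
  msPos : ℕ → Ω → Plane
  msMark : ℕ → Ω → Direction × ℝ

namespace Network

variable {Ω : Type*} (N : Network Ω)

/-- Traffic direction of base station `i`. -/
def bsDir (i : ℕ) (ω : Ω) : Direction := (N.bsMark i ω).1

/-- Fading power of the channel from base station `i` to the receiver. -/
def bsGain (i : ℕ) (ω : Ω) : ℝ := (N.bsMark i ω).2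

/-- Traffic direction of mobile station `j`. -/
def msDir (j : ℕ) (ω : Ω) : Direction := (N.msMark j ω).1

/-- Fading power of the channel from mobile station `j` to the receiver. -/
def msGain (j : ℕ) (ω : Ω) : ℝ := (N.msMark j ω).2

/-- Independent PPP deployment: base stations and mobile stations form two independent Poisson
processes of density `lamU + lamD`, each node independently is uplink or downlink (so that the
uplink and downlink nodes are thinned Poisson processes of densities `lamU` and `lamD`), and all
channels fade independently, with `Exp(μ)` distributed power. -/
structure IsIndependentPPP [MeasurableSpace Ω] (P : Measure Ω) (lamU lamD μ : ℝ) : Prop where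
  bs : IsMarkedPoissonProcess P N.bsPos N.bsMark (lamU + lamD)
    ((directionLaw lamU lamD).prod (expMeasure μ))
  ms : IsMarkedPoissonProcess P N.msPos N.msMark (lamU + lamD)
    ((directionLaw lamU lamD).prod (expMeasure μ))
  bs_indep_ms : IndepFun (fun ω i => (N.bsPos i ω, N.bsMark i ω))
    (fun ω j => (N.msPos j ω, N.msMark j ω)) P

/-- Voronoi region of base station `i`. -/
def voronoi (i : ℕ) (ω : Ω) : Set Plane :=
  {x | ∀ j, j ≠ i → ‖x - N.bsPos i ω‖ ≤ ‖x - N.bsPos j ω‖}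

/-- Index of the base station serving the receiver at the origin, that is, the one whose Voronoi
region contains the origin (the first one in the null event of a tie). -/
def serving (ω : Ω) : ℕ := sInf {i | (0 : Plane) ∈ N.voronoi i ω}

/-- Distance between the receiver and its serving base station. -/
def servingDist (ω : Ω) : ℝ := ‖N.bsPos (N.serving ω) ω‖

/-- The event that the receiver is a downlink mobile station, i.e. that the base station of the
Voronoi region in which it lies is a downlink base station. -/
def isDownlink : Set Ω := {ω | N.bsDir (N.serving ω) ω = Direction.downlink}

open Classical in
/-- Interference from the downlink base stations other than the serving one, which transmit with
power `PB`; the path loss is `x ↦ x ^ (-α)`. -/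
def interferenceBS (α PB : ℝ) (ω : Ω) : ℝ≥0∞ :=
  ∑' i, if i ≠ N.serving ω ∧ N.bsDir i ω = Direction.downlink then
    ENNReal.ofReal (N.bsGain i ω * ‖N.bsPos i ω‖ ^ (-α) * PB) else 0

open Classical in
/-- Interference from the uplink mobile stations, which transmit with power `PM`. -/
def interferenceMS (α PM : ℝ) (ω : Ω) : ℝ≥0∞ :=
  ∑' j, if N.msDir j ω = Direction.uplink then
    ENNReal.ofReal (N.msGain j ω * ‖N.msPos j ω‖ ^ (-α) * PM) else 0

/-- Downlink signal to interference plus noise ratio at the receiver; the noise power is `σ²`. -/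
def sinr (α PB PM σ : ℝ) (ω : Ω) : ℝ≥0∞ :=
  ENNReal.ofReal (N.bsGain (N.serving ω) ω * N.servingDist ω ^ (-α) * PB)
    / (N.interferenceBS α PB ω + N.interferenceMS α PM ω + ENNReal.ofReal (σ ^ 2))

/-- Law of the network seen by a typical downlink mobile station: the conditional law, given that
the receiver is a downlink mobile station. -/
def downlinkLaw [MeasurableSpace Ω] (P : Measure Ω) : Measure Ω := cond P N.isDownlink

/-- Downlink success probability: the probability that the SINR of a typical downlink mobile
station is not lower than the threshold `β`. -/
def successProb [MeasurableSpace Ω] (P : Measure Ω) (α PB PM σ β : ℝ) : ℝ :=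
  (N.downlinkLaw P).real {ω | ENNReal.ofReal β ≤ N.sinr α PB PM σ ω}

end Network

/-- The argument `s = μ β r^α / PB` of the Laplace transforms. -/
def laplaceArg (μ β α PB r : ℝ) : ℝ := μ * β * r ^ α / PB

/-- Integrand of the exponent of the Laplace transform of the base station interference. -/
def integrandBS (β α r x : ℝ) : ℝ := β * (r / x) ^ α / (1 + β * (r / x) ^ α) * x

/-- Integrand of the exponent of the Laplace transform of the mobile station interference. -/
def integrandMS (β α PB PM r y : ℝ) : ℝ :=
  β * (PM / PB) * (r / y) ^ α / (1 + β * (PM / PB) * (r / y) ^ α) * y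

/-- Closed form of the Laplace transform of the base station interference. -/
def laplaceBS (lamD β α r : ℝ) : ℝ :=
  Real.exp (-(2 * π * lamD) * ∫ x in Ioi r, integrandBS β α r x)

/-- Closed form of the Laplace transform of the mobile station interference. -/
def laplaceMS (lamU β α PB PM r : ℝ) : ℝ :=
  Real.exp (-(2 * π * lamU) * ∫ y in Ioi (0 : ℝ), integrandMS β α PB PM r y)

/-- Integrand of the success probability. -/
def successIntegrand (lamC lamU lamD μ α PB PM σ β r : ℝ) : ℝ :=
  r * Real.exp (-(π * lamC * r ^ 2) - laplaceArg μ β α PB r * σ ^ 2)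
    * laplaceBS lamD β α r * laplaceMS lamU β α PB PM r

end CoMPflex

end

/-!
The law of a Poisson process enters through its Laplace functional
`E exp (-∑ u (X i)) = exp (-lam ∫ (1 - exp (-u)))`
(`IsPoissonProcess.lintegral_expNeg_tsum`), which is proved for measurable `u` with
values in `[0, ∞]`, by approximation with simple functions of bounded support. The value `∞` is
useful: a function that is infinite on a ball encodes the event that the ball has no points. Hence
the Laplace functional contains at once the Rayleigh law of the distance `R` to the nearest point
(`IsPoissonProcess.lintegral_nearestDist`) and the independence of the event `a ≤ R` and the points
beyond any `b ≥ a`.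

From the latter follows the fact on which the formulas rest: given `R`, the points other than the
nearest one form a Poisson process outside the ball of radius `R`
(`IsPoissonProcess.lintegral_mul_expNeg_otherSum`). For `R` rounded up to multiples of `1 / (n + 1)`
this is an elementary conditioning on countably many events. In the limit of large `n`, the points
beyond the rounded distance become all points but the nearest one, because almost surely no two
points have the same distance to the origin; domination comes from the convergence of
`∑ ‖X i‖ ^ (-α)`, which is Campbell's formula for `α > 2`.

The marks are independent of the locations and can be integrated out first, with the locations
fixed. A node at distance `x` that interferes with probability `p` then contributes the factor
`1 - p * (w / (1 + w))` to the Laplace transform of the interference at `s = μ β r ^ α / PB`, where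
`w = β (r / x) ^ α` for a base station, and `w = β (PM / PB) (r / x) ^ α` for a mobile station. This
factor is written as `exp (-logLoss p w)`, so that the Laplace functional applies to `logLoss`, and
polar coordinates turn its exponent into the integrals of the theorem. The direction of the serving
base station is independent of all of this, so conditioning on it only cancels a factor.

The success probability reduces to Laplace transforms because the gain of the serving base station
is exponential: the probability that it exceeds `s * (I + σ ^ 2) / μ` is `exp (-s * (I + σ ^ 2))`
(`measure_success_of_locations`). The conditional Laplace transforms given `R` are identified by
integrating them over the events `R ∈ B` (`condExp_exp_neg_mul_eq`).
-/

namespace CoMPflex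

open Filter Topology

/-! ### The function `exp (-x)` on `[0, ∞]` -/

/-- The function `x ↦ exp (-x)` from `[0, ∞]` to `[0, ∞]`, with `exp (-∞) = 0`. -/
noncomputable def expNeg (x : ℝ≥0∞) : ℝ≥0∞ := EReal.exp (-(x : EReal))

@[simp] lemma expNeg_zero : expNeg 0 = 1 := by simp [expNeg]

@[simp] lemma expNeg_top : expNeg ⊤ = 0 := by simp [expNeg]

lemma expNeg_antitone : Antitone expNeg := fun _ _ h =>
  EReal.exp_monotone (EReal.neg_le_neg_iff.2 (EReal.coe_ennreal_le_coe_ennreal_iff.2 h))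

lemma expNeg_le_one (x : ℝ≥0∞) : expNeg x ≤ 1 := by
  simpa using expNeg_antitone (bot_le (a := x))

lemma expNeg_ne_top (x : ℝ≥0∞) : expNeg x ≠ ⊤ := ((expNeg_le_one x).trans_lt ENNReal.one_lt_top).ne

lemma continuous_expNeg : Continuous expNeg :=
  ENNReal.continuous_exp.comp (continuous_neg.comp continuous_coe_ennreal_ereal)

lemma measurable_expNeg : Measurable expNeg := continuous_expNeg.measurable

lemma expNeg_add (x y : ℝ≥0∞) : expNeg (x + y) = expNeg x * expNeg y := by
  unfold expNeg
  rw [EReal.coe_ennreal_add, EReal.neg_add, sub_eq_add_neg, EReal.exp_add] <;> simp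

lemma expNeg_sum {ι : Type*} (s : Finset ι) (u : ι → ℝ≥0∞) :
    expNeg (∑ i ∈ s, u i) = ∏ i ∈ s, expNeg (u i) := by
  classical
  induction s using Finset.induction_on with
  | empty => simp
  | insert a s ha ih => rw [Finset.sum_insert ha, Finset.prod_insert ha, expNeg_add, ih]

lemma expNeg_ofReal {a : ℝ} (ha : 0 ≤ a) :
    expNeg (ENNReal.ofReal a) = ENNReal.ofReal (Real.exp (-a)) := by
  unfold expNeg
  rw [EReal.coe_ennreal_ofReal, max_eq_left ha, ← EReal.coe_neg, EReal.exp_coe]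

lemma expNeg_of_ne_top {x : ℝ≥0∞} (hx : x ≠ ⊤) :
    expNeg x = ENNReal.ofReal (Real.exp (-x.toReal)) := by
  rw [← expNeg_ofReal ENNReal.toReal_nonneg, ENNReal.ofReal_toReal hx]

lemma tendsto_prod_expNeg (u : ℕ → ℝ≥0∞) :
    Tendsto (fun n => ∏ i ∈ Finset.range n, expNeg (u i)) atTop (𝓝 (expNeg (∑' i, u i))) := by
  simp_rw [← expNeg_sum]
  exact (continuous_expNeg.tendsto _).comp (ENNReal.tendsto_nat_tsum u)

/-! ### Counting variables of a Poisson process -/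

section Poisson

lemma tsum_poissonMeasure (r : ℝ≥0) : ∑' n : ℕ, poissonMeasure r {n} = 1 := by
  have h := lintegral_countable' (μ := poissonMeasure r) fun _ => 1
  simpa using h.symm

variable {Ω : Type*} {X : ℕ → Ω → Plane}

lemma tsum_indicator_const (X : ℕ → Ω → Plane) (A : Set Plane) (c : ℝ≥0∞) (ω : Ω) :
    ∑' i, A.indicator (fun _ => c) (X i ω) = c * (pointCount X A ω : ℝ≥0∞) := by
  have h : ∀ i, A.indicator (fun _ => c) (X i ω)
      = c * {i : ℕ | X i ω ∈ A}.indicator (fun _ => (1 : ℝ≥0∞)) i := by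
    intro i
    by_cases hi : X i ω ∈ A <;> simp [hi]
  simp_rw [h]
  rw [ENNReal.tsum_mul_left, ← tsum_subtype, ENNReal.tsum_set_one, pointCount]

lemma iUnion_pointCount_eq (A : Set Plane) :
    ⋃ n : ℕ, {ω | pointCount X A ω = n} = {ω | pointCount X A ω ≠ ⊤} := by
  ext ω
  simp [ENat.ne_top_iff_exists, eq_comm]

variable [MeasurableSpace Ω] {P : Measure Ω} {lam : ℝ}

lemma IsPoissonProcess.measurable_pointCount (hX : IsPoissonProcess P X lam) {A : Set Plane}
    (hA : MeasurableSet A) : Measurable (pointCount X A) := by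
  have h1 : Measurable fun ω => (pointCount X A ω : ℝ≥0∞) := by
    have h : (fun ω => (pointCount X A ω : ℝ≥0∞))
        = fun ω => ∑' i, A.indicator (fun _ => (1 : ℝ≥0∞)) (X i ω) := by
      funext ω
      rw [tsum_indicator_const, one_mul]
    rw [h]
    exact Measurable.tsum fun i => (measurable_const.indicator hA).comp (hX.measurable i)
  refine measurable_to_countable' fun n => ?_
  have : pointCount X A ⁻¹' {n} = (fun ω => (pointCount X A ω : ℝ≥0∞)) ⁻¹' {(n : ℝ≥0∞)} := by
    ext ω; simp
  rw [this]
  exact h1 (measurableSet_singleton _)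

/-- A counting variable of a bounded set is almost surely finite, because its Poisson
probabilities add up to one. -/
lemma IsPoissonProcess.ae_pointCount_ne_top [IsProbabilityMeasure P]
    (hX : IsPoissonProcess P X lam) {A : Set Plane}
    (hA : MeasurableSet A) (hb : Bornology.IsBounded A) : ∀ᵐ ω ∂P, pointCount X A ω ≠ ⊤ := by
  have hmeas : ∀ n : ℕ, MeasurableSet {ω | pointCount X A ω = n} := fun n =>
    hX.measurable_pointCount hA (measurableSet_singleton (n : ℕ∞))
  have hdisj : Pairwise (Function.onFun Disjoint fun n : ℕ => {ω | pointCount X A ω = n}) := by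
    intro n m hnm
    refine Set.disjoint_left.2 fun ω h1 h2 => hnm ?_
    simp only [mem_ofPred_eq] at h1 h2
    exact_mod_cast h1.symm.trans h2
  have h1 : P (⋃ n : ℕ, {ω | pointCount X A ω = n}) = 1 := by
    rw [measure_iUnion hdisj hmeas]
    simp_rw [hX.count_law A hA hb]
    exact tsum_poissonMeasure _
  rw [iUnion_pointCount_eq] at h1
  exact (mem_ae_iff_prob_eq_one (by
    rw [← iUnion_pointCount_eq]; exact MeasurableSet.iUnion hmeas)).2 h1

lemma IsPoissonProcess.lintegral_pointCount [IsProbabilityMeasure P]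
    (hX : IsPoissonProcess P X lam) {A : Set Plane}
    (hA : MeasurableSet A) (hb : Bornology.IsBounded A) (f : ℕ∞ → ℝ≥0∞) :
    ∫⁻ ω, f (pointCount X A ω) ∂P
      = ∑' n : ℕ, f n * poissonMeasure (Real.toNNReal (lam * (volume A).toReal)) {n} := by
  have hmeas : ∀ n : ℕ, MeasurableSet {ω | pointCount X A ω = n} := fun n =>
    hX.measurable_pointCount hA (measurableSet_singleton (n : ℕ∞))
  have hdisj : Pairwise (Function.onFun Disjoint fun n : ℕ => {ω | pointCount X A ω = n}) := by
    intro n m hnm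
    refine Set.disjoint_left.2 fun ω h1 h2 => hnm ?_
    simp only [mem_ofPred_eq] at h1 h2
    exact_mod_cast h1.symm.trans h2
  have hU : P.restrict (⋃ n : ℕ, {ω | pointCount X A ω = n}) = P := by
    rw [iUnion_pointCount_eq]
    exact Measure.restrict_eq_self_of_ae_mem (hX.ae_pointCount_ne_top hA hb)
  rw [← hU, lintegral_iUnion hmeas hdisj]
  refine tsum_congr fun n => ?_
  rw [setLIntegral_congr_fun (hmeas n) (g := fun _ => f n)
    (fun ω (hω : pointCount X A ω = n) => by simp only [hω]), setLIntegral_const,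
    ← hX.count_law A hA hb n]

/-- The generating function of the Poisson distribution at `exp (-c)`. -/
lemma tsum_expNeg_mul_poissonMeasure (r : ℝ≥0) {c : ℝ≥0∞} (hc : c ≠ ⊤) :
    ∑' n : ℕ, expNeg (c * n) * poissonMeasure r {n} = expNeg (r * (1 - expNeg c)) := by
  lift c to ℝ≥0 using hc
  set z : ℝ := Real.exp (-c) with hz
  have hz1 : z ≤ 1 := by rw [hz]; exact Real.exp_le_one_iff.2 (by simp)
  have hzc : expNeg c = ENNReal.ofReal z := by
    rw [expNeg_of_ne_top ENNReal.coe_ne_top]; simp [hz]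
  have hterm : ∀ n : ℕ, expNeg (c * n) * poissonMeasure r {n}
      = ENNReal.ofReal (Real.exp (-r) * ((z * r) ^ n / n.factorial)) := by
    intro n
    have h1 : expNeg (c * n) = ENNReal.ofReal (z ^ n) := by
      rw [expNeg_of_ne_top (ENNReal.mul_ne_top ENNReal.coe_ne_top (by simp)), hz,
        ← Real.exp_nat_mul]
      simp [mul_comm]
    rw [h1, poissonMeasure_singleton, ← ENNReal.ofReal_mul (by positivity)]
    congr 1
    ring
  have hs : HasSum (fun n : ℕ => Real.exp (-r) * ((z * r) ^ n / n.factorial))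
      (Real.exp (-r) * Real.exp (z * r)) := by
    refine HasSum.mul_left _ ?_
    rw [Real.exp_eq_exp_ℝ]
    exact NormedSpace.expSeries_div_hasSum_exp (z * r : ℝ)
  simp_rw [hterm]
  rw [← ENNReal.ofReal_tsum_of_nonneg (fun n => by positivity) hs.summable, hs.tsum_eq, hzc,
    ← ENNReal.ofReal_one, ← ENNReal.ofReal_sub _ (by positivity), ← ENNReal.ofReal_coe_nnreal,
    ← ENNReal.ofReal_mul (by positivity),
    expNeg_ofReal (mul_nonneg r.2 (by linarith) : (0 : ℝ) ≤ r * (1 - z)), ← Real.exp_add]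
  congr 2
  simp only [hz]
  ring

lemma IsPoissonProcess.lintegral_expNeg_pointCount [IsProbabilityMeasure P]
    (hX : IsPoissonProcess P X lam) (hlam : 0 ≤ lam) {A : Set Plane}
    (hA : MeasurableSet A) (hb : Bornology.IsBounded A) {c : ℝ≥0∞} (hc : c ≠ ⊤) :
    ∫⁻ ω, expNeg (c * (pointCount X A ω : ℝ≥0∞)) ∂P
      = expNeg (ENNReal.ofReal lam * (volume A * (1 - expNeg c))) := by
  rw [hX.lintegral_pointCount hA hb fun n => expNeg (c * (n : ℝ≥0∞))]
  simp only [ENat.toENNReal_coe]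
  rw [tsum_expNeg_mul_poissonMeasure _ hc, ← mul_assoc]
  congr 2
  change ENNReal.ofReal (lam * (volume A).toReal) = _
  rw [ENNReal.ofReal_mul hlam, ENNReal.ofReal_toReal hb.measure_lt_top.ne]

/-! ### The Laplace functional -/

lemma IsPoissonProcess.iIndepFun_pointCount (hX : IsPoissonProcess P X lam) {ι : Type*} [Finite ι]
    (A : ι → Set Plane) (hA : ∀ j, MeasurableSet (A j)) (hb : ∀ j, Bornology.IsBounded (A j))
    (hd : Pairwise fun j l => Disjoint (A j) (A l)) :
    iIndepFun (fun j => pointCount X (A j)) P := by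
  obtain ⟨k, ⟨e⟩⟩ := Finite.exists_equiv_fin ι
  have h := (hX.count_indep k (A ∘ e.symm) (fun j => hA _) (fun j => hb _)
    fun j l hjl => hd (e.symm.injective.ne hjl)).precomp e.injective
  simpa [Function.comp_def] using h

/-- The Laplace functional at a simple function of bounded support: the counting variables of its
level sets are independent, so that the integral is a product of Poisson generating functions. -/
lemma IsPoissonProcess.lintegral_expNeg_tsum_simpleFunc [IsProbabilityMeasure P]
    (hX : IsPoissonProcess P X lam) (hlam : 0 ≤ lam) (u : SimpleFunc Plane ℝ≥0∞)
    (hu : ∀ x, u x ≠ ⊤) (hb : Bornology.IsBounded (Function.support u)) :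
    ∫⁻ ω, expNeg (∑' i, u (X i ω)) ∂P
      = expNeg (ENNReal.ofReal lam * ∫⁻ x, (1 - expNeg (u x))) := by
  classical
  set s : Finset ℝ≥0∞ := u.range.filter (· ≠ 0) with hs
  have hsum : ∀ x, u x = ∑ y : s, (u ⁻¹' {(y : ℝ≥0∞)}).indicator (fun _ => (y : ℝ≥0∞)) x := by
    intro x
    rw [Finset.sum_coe_sort s fun y => (u ⁻¹' {y}).indicator (fun _ => y) x]
    by_cases hx : u x = 0
    · rw [hx, Finset.sum_eq_zero]
      intro y hy
      simp only [hs, Finset.mem_filter] at hy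
      simp [hx, hy.2.symm]
    · rw [Finset.sum_eq_single (u x)]
      · simp
      · intro y _ hy
        simp [hy.symm]
      · intro h
        exact absurd (by simp [hs, hx]) h
  have hfib : ∀ y : s, Bornology.IsBounded (u ⁻¹' {(y : ℝ≥0∞)}) := by
    intro y
    refine hb.subset fun x hx => ?_
    have hy := y.2
    simp only [hs, Finset.mem_filter] at hy
    simp only [mem_preimage, mem_singleton_iff] at hx
    simpa [hx] using hy.2
  have hmf : ∀ y : s, MeasurableSet (u ⁻¹' {(y : ℝ≥0∞)}) := fun y => u.measurableSet_fiber _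
  have hyt : ∀ y : s, (y : ℝ≥0∞) ≠ ⊤ := by
    intro y
    have hy := y.2
    simp only [hs, Finset.mem_filter, SimpleFunc.mem_range] at hy
    obtain ⟨⟨x, hx⟩, -⟩ := hy
    rw [← hx]
    exact hu x
  have hind : iIndepFun (fun (y : s) ω =>
      expNeg ((y : ℝ≥0∞) * (pointCount X (u ⁻¹' {(y : ℝ≥0∞)}) ω : ℝ≥0∞))) P := by
    refine (hX.iIndepFun_pointCount (fun y : s => u ⁻¹' {(y : ℝ≥0∞)}) hmf hfib ?_).comp
      (fun (y : s) (n : ℕ∞) => expNeg ((y : ℝ≥0∞) * (n : ℝ≥0∞))) fun y => measurable_of_countable _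
    intro y z hyz
    refine Set.disjoint_left.2 fun x h1 h2 => hyz (Subtype.ext ?_)
    simp only [mem_preimage, mem_singleton_iff] at h1 h2
    exact h1.symm.trans h2
  have hL : ∀ ω, expNeg (∑' i, u (X i ω)) = ∏ y : s,
      expNeg ((y : ℝ≥0∞) * (pointCount X (u ⁻¹' {(y : ℝ≥0∞)}) ω : ℝ≥0∞)) := by
    intro ω
    rw [← expNeg_sum]
    congr 1
    simp_rw [← tsum_indicator_const]
    rw [← Summable.tsum_finsetSum fun y _ => ENNReal.summable]
    exact tsum_congr fun i => hsum _
  simp_rw [hL]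
  rw [lintegral_prod_eq_prod_lintegral_of_indepFun _ _ hind]
  · simp_rw [fun y : s => hX.lintegral_expNeg_pointCount hlam (hmf y) (hfib y) (hyt y)]
    rw [← expNeg_sum, ← Finset.mul_sum]
    congr 2
    have h1 := (u.map fun y => 1 - expNeg y).lintegral_eq_lintegral volume
    rw [SimpleFunc.map_lintegral] at h1
    simp only [SimpleFunc.coe_map, Function.comp_apply] at h1
    rw [h1, Finset.sum_coe_sort s fun y => volume (u ⁻¹' {y}) * (1 - expNeg y), hs,
      Finset.sum_filter]
    refine Finset.sum_congr rfl fun y _ => ?_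
    by_cases hy : y = 0 <;> simp [hy, mul_comm]
  · intro y
    exact (measurable_of_countable fun n : ℕ∞ => expNeg ((y : ℝ≥0∞) * (n : ℝ≥0∞))).comp
      (hX.measurable_pointCount (hmf y))

/-- The Laplace functional of a Poisson process. The values `∞` of `u` are allowed: they encode the
event that the process has no point in `u ⁻¹' {∞}`. -/
theorem IsPoissonProcess.lintegral_expNeg_tsum [IsProbabilityMeasure P]
    (hX : IsPoissonProcess P X lam) (hlam : 0 ≤ lam) {u : Plane → ℝ≥0∞} (hu : Measurable u) :
    ∫⁻ ω, expNeg (∑' i, u (X i ω)) ∂P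
      = expNeg (ENNReal.ofReal lam * ∫⁻ x, (1 - expNeg (u x))) := by
  have hball : ∀ n : ℕ, MeasurableSet (Metric.ball (0 : Plane) n) := fun n =>
    Metric.isOpen_ball.measurableSet
  set v : ℕ → SimpleFunc Plane ℝ≥0∞ := fun n =>
    (SimpleFunc.eapprox u n).restrict (Metric.ball (0 : Plane) n) with hv
  have hv_apply : ∀ n x, v n x = (Metric.ball (0 : Plane) n).indicator
      (SimpleFunc.eapprox u n) x := fun n x => SimpleFunc.restrict_apply _ (hball n) x
  have hmono : ∀ x, Monotone fun n => v n x := by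
    intro x n m hnm
    simp only [hv_apply]
    by_cases hx : x ∈ Metric.ball (0 : Plane) n
    · have hx' : x ∈ Metric.ball (0 : Plane) m :=
        Metric.ball_subset_ball (by exact_mod_cast hnm) hx
      rw [indicator_of_mem hx, indicator_of_mem hx']
      exact SimpleFunc.monotone_eapprox u hnm x
    · rw [indicator_of_notMem hx]
      exact bot_le
  have hlim : ∀ x, Tendsto (fun n => v n x) atTop (𝓝 (u x)) := by
    intro x
    have h1 : Tendsto (fun n => SimpleFunc.eapprox u n x) atTop (𝓝 (u x)) := by
      have := tendsto_atTop_iSup (f := fun n => SimpleFunc.eapprox u n x)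
        fun n m h => SimpleFunc.monotone_eapprox u h x
      rwa [SimpleFunc.iSup_eapprox_apply hu] at this
    refine h1.congr' ?_
    obtain ⟨n₀, hn₀⟩ := exists_nat_gt ‖x‖
    filter_upwards [eventually_ge_atTop n₀] with n hn
    rw [hv_apply, indicator_of_mem]
    rw [mem_ball_zero_iff]
    exact hn₀.trans_le (by exact_mod_cast hn)
  have hle : ∀ n x, v n x ≤ u x := fun n x => (hmono x).ge_of_tendsto (hlim x) n
  have hvt : ∀ n x, v n x ≠ ⊤ := by
    intro n x
    rw [hv_apply]
    by_cases hx : x ∈ Metric.ball (0 : Plane) n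
    · rw [indicator_of_mem hx]
      exact (SimpleFunc.eapprox_lt_top u n x).ne
    · simp [hx]
  have hsupp : ∀ n, Bornology.IsBounded (Function.support (v n)) := by
    intro n
    refine (Metric.isBounded_ball (x := (0 : Plane)) (r := n)).subset fun x hx => ?_
    by_contra h
    exact hx (by rw [hv_apply, indicator_of_notMem h])
  have hsum : ∀ ω, Tendsto (fun n => ∑' i, v n (X i ω)) atTop (𝓝 (∑' i, u (X i ω))) := by
    intro ω
    simp_rw [← lintegral_count]
    exact lintegral_tendsto_of_tendsto_of_monotone
      (fun n => measurable_of_countable _ |>.aemeasurable)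
      (ae_of_all _ fun i => hmono _) (ae_of_all _ fun i => hlim _)
  have hL : Tendsto (fun n => ∫⁻ ω, expNeg (∑' i, v n (X i ω)) ∂P) atTop
      (𝓝 (∫⁻ ω, expNeg (∑' i, u (X i ω)) ∂P)) := by
    refine tendsto_lintegral_of_dominated_convergence (fun _ => 1) (fun n => ?_)
      (fun n => ae_of_all _ fun ω => expNeg_le_one _) (by simp)
      (ae_of_all _ fun ω => (continuous_expNeg.tendsto _).comp (hsum ω))
    exact measurable_expNeg.comp (Measurable.tsum fun i => (v n).measurable.comp (hX.measurable i))
  have hR : Tendsto (fun n => expNeg (ENNReal.ofReal lam * ∫⁻ x, (1 - expNeg (v n x)))) atTop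
      (𝓝 (expNeg (ENNReal.ofReal lam * ∫⁻ x, (1 - expNeg (u x))))) := by
    refine (continuous_expNeg.tendsto _).comp
      (ENNReal.Tendsto.const_mul ?_ (Or.inr ENNReal.ofReal_ne_top))
    refine lintegral_tendsto_of_tendsto_of_monotone
      (fun n => (measurable_const.sub (measurable_expNeg.comp (v n).measurable)).aemeasurable)
      (ae_of_all _ fun x n m hnm => tsub_le_tsub_left (expNeg_antitone (hmono x hnm)) _)
      (ae_of_all _ fun x => ?_)
    exact ENNReal.Tendsto.sub tendsto_const_nhds ((continuous_expNeg.tendsto _).comp (hlim x))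
      (Or.inl ENNReal.one_ne_top)
  refine tendsto_nhds_unique hL (hR.congr fun n => ?_)
  exact (hX.lintegral_expNeg_tsum_simpleFunc hlam (v n) (hvt n) (hsupp n)).symm

/-! ### The intensity measure -/

lemma tsum_mul_poissonMeasure (r : ℝ≥0) : ∑' n : ℕ, (n : ℝ≥0∞) * poissonMeasure r {n} = r := by
  have hstep : ∀ n : ℕ, ((n + 1 : ℕ) : ℝ≥0∞) * poissonMeasure r {n + 1}
      = r * poissonMeasure r {n} := by
    intro n
    rw [poissonMeasure_singleton, poissonMeasure_singleton, ← ENNReal.ofReal_coe_nnreal,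
      ← ENNReal.ofReal_natCast, ← ENNReal.ofReal_mul (by positivity),
      ← ENNReal.ofReal_mul (by positivity)]
    congr 1
    rw [Nat.factorial_succ]
    push_cast
    field_simp
    ring
  rw [tsum_eq_zero_add' ENNReal.summable]
  simp_rw [hstep]
  rw [ENNReal.tsum_mul_left, tsum_poissonMeasure]
  simp

/-- The intensity measure is `lam` times the area. It is compared with the area on bounded sets
first, because the laws of the counting variables are only given there. -/
lemma IsPoissonProcess.sum_map_eq [IsProbabilityMeasure P]
    (hX : IsPoissonProcess P X lam) (hlam : 0 ≤ lam) :
    Measure.sum (fun i => P.map (X i)) = ENNReal.ofReal lam • (volume : Measure Plane) := by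
  have hbdd : ∀ A : Set Plane, MeasurableSet A → Bornology.IsBounded A →
      Measure.sum (fun i => P.map (X i)) A = (ENNReal.ofReal lam • (volume : Measure Plane)) A := by
    intro A hA hb
    rw [Measure.sum_apply _ hA, Measure.smul_apply, smul_eq_mul]
    have h1 : ∀ i, P.map (X i) A = ∫⁻ ω, A.indicator (fun _ => (1 : ℝ≥0∞)) (X i ω) ∂P := by
      intro i
      rw [← lintegral_map (measurable_const.indicator hA) (hX.measurable i),
        lintegral_indicator_const hA, one_mul]
    simp_rw [h1]
    have hm : ∀ i, Measurable fun ω => A.indicator (fun _ => (1 : ℝ≥0∞)) (X i ω) := fun i =>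
      (measurable_const.indicator hA).comp (hX.measurable i)
    rw [← lintegral_tsum fun i => (hm i).aemeasurable]
    simp_rw [tsum_indicator_const, one_mul]
    rw [hX.lintegral_pointCount hA hb fun n => (n : ℝ≥0∞)]
    simp only [ENat.toENNReal_coe]
    rw [tsum_mul_poissonMeasure]
    change ENNReal.ofReal (lam * (volume A).toReal) = _
    rw [ENNReal.ofReal_mul hlam, ENNReal.ofReal_toReal hb.measure_lt_top.ne]
  refine Measure.ext fun A hA => ?_
  have hU : A = ⋃ n : ℕ, A ∩ Metric.ball (0 : Plane) n := by
    rw [← inter_iUnion, Metric.iUnion_ball_nat, inter_univ]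
  have hmono : Monotone fun n : ℕ => A ∩ Metric.ball (0 : Plane) n := fun n m hnm =>
    inter_subset_inter_right _ (Metric.ball_subset_ball (by exact_mod_cast hnm))
  rw [hU, hmono.measure_iUnion, hmono.measure_iUnion]
  exact iSup_congr fun n => hbdd _ (hA.inter Metric.isOpen_ball.measurableSet)
    (Metric.isBounded_ball.subset inter_subset_right)

/-- Campbell's formula. -/
theorem IsPoissonProcess.tsum_lintegral [IsProbabilityMeasure P]
    (hX : IsPoissonProcess P X lam) (hlam : 0 ≤ lam) {f : Plane → ℝ≥0∞} (hf : Measurable f) :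
    ∑' i, ∫⁻ ω, f (X i ω) ∂P = ENNReal.ofReal lam * ∫⁻ x, f x := by
  have h : ∀ i, ∫⁻ ω, f (X i ω) ∂P = ∫⁻ x, f x ∂(P.map (X i)) := fun i =>
    (lintegral_map hf (hX.measurable i)).symm
  simp_rw [h]
  rw [← lintegral_sum_measure, hX.sum_map_eq hlam, lintegral_smul_measure, smul_eq_mul]

end Poisson

/-! ### The point nearest to the origin -/

/-- Index of a point of the configuration `x` nearest to the origin (the least such index). -/
noncomputable def nearestIdx (x : ℕ → Plane) : ℕ := sInf {i | ∀ j, j ≠ i → ‖x i‖ ≤ ‖x j‖}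

/-- Distance from the origin to the nearest point of the configuration `x`. -/
noncomputable def nearestDist (x : ℕ → Plane) : ℝ := ‖x (nearestIdx x)‖

/-- The almost sure properties of a Poisson configuration: the points tend to infinity, are
different from the origin, and have pairwise different distances to the origin. -/
structure IsGoodConfig (x : ℕ → Plane) : Prop where
  finite_ball : ∀ n : ℕ, {i | ‖x i‖ < n}.Finite
  ne_zero : ∀ i, x i ≠ 0
  norm_injective : Function.Injective fun i => ‖x i‖

lemma IsGoodConfig.nearestDist_le {x : ℕ → Plane} (hx : IsGoodConfig x) (j : ℕ) :
    nearestDist x ≤ ‖x j‖ := by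
  obtain ⟨n, hn⟩ := exists_nat_gt ‖x 0‖
  obtain ⟨i, hin, hi⟩ := (hx.finite_ball n).exists_minimalFor (fun i => ‖x i‖) _ ⟨0, hn⟩
  have hmin : ∀ j, ‖x i‖ ≤ ‖x j‖ := by
    intro j
    by_contra! hj
    exact absurd (hi (hj.trans hin) hj.le) (not_le.2 hj)
  have hmem : nearestIdx x ∈ {i | ∀ j, j ≠ i → ‖x i‖ ≤ ‖x j‖} :=
    Nat.sInf_mem ⟨i, fun j _ => hmin j⟩
  by_cases h : j = nearestIdx x
  · rw [h]; exact le_rfl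
  · exact hmem j h

lemma IsGoodConfig.nearestDist_pos {x : ℕ → Plane} (hx : IsGoodConfig x) : 0 < nearestDist x :=
  norm_pos_iff.2 (hx.ne_zero _)

lemma IsGoodConfig.nearestDist_lt_iff {x : ℕ → Plane} (hx : IsGoodConfig x) (j : ℕ) :
    nearestDist x < ‖x j‖ ↔ j ≠ nearestIdx x := by
  constructor
  · rintro h rfl
    exact lt_irrefl _ h
  · intro h
    exact lt_of_le_of_ne (hx.nearestDist_le j) fun h' => h (hx.norm_injective h').symm

lemma measurable_nearestIdx : Measurable nearestIdx := by
  have hS : ∀ i : ℕ, MeasurableSet {x : ℕ → Plane | ∀ j, j ≠ i → ‖x i‖ ≤ ‖x j‖} := by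
    intro i
    simp only [Set.ofPred_forall]
    exact MeasurableSet.iInter fun j => MeasurableSet.iInter fun _ =>
      measurableSet_le (measurable_pi_apply i).norm (measurable_pi_apply j).norm
  refine measurable_to_countable' fun n => ?_
  have : nearestIdx ⁻¹' {n}
      = ({x : ℕ → Plane | ∀ j, j ≠ n → ‖x n‖ ≤ ‖x j‖} ∩
          ⋂ m : ℕ, ⋂ _ : m < n, {x : ℕ → Plane | ∀ j, j ≠ m → ‖x m‖ ≤ ‖x j‖}ᶜ)
        ∪ ({_x : ℕ → Plane | n = 0} ∩
          ⋂ m : ℕ, {x : ℕ → Plane | ∀ j, j ≠ m → ‖x m‖ ≤ ‖x j‖}ᶜ) := by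
    ext x
    simp only [mem_preimage, mem_singleton_iff, mem_union, mem_inter_iff, mem_iInter,
      mem_compl_iff]
    constructor
    · rintro rfl
      by_cases hne : {i | ∀ j, j ≠ i → ‖x i‖ ≤ ‖x j‖}.Nonempty
      · exact Or.inl ⟨Nat.sInf_mem hne, fun m hm => Nat.notMem_of_lt_sInf hm⟩
      · rw [Set.not_nonempty_iff_eq_empty] at hne
        refine Or.inr ⟨?_, fun m hm => ?_⟩
        · change nearestIdx x = 0
          rw [nearestIdx, hne, Nat.sInf_empty]
        · exact (hne ▸ hm : m ∈ (∅ : Set ℕ))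
    · rintro (⟨h1, h2⟩ | ⟨h1, h2⟩)
      · refine le_antisymm (Nat.sInf_le h1) ?_
        by_contra hlt
        exact h2 _ (not_le.1 hlt) (Nat.sInf_mem (s := {i | ∀ j, j ≠ i → ‖x i‖ ≤ ‖x j‖}) ⟨n, h1⟩)
      · have hne : {i | ∀ j, j ≠ i → ‖x i‖ ≤ ‖x j‖} = ∅ := Set.eq_empty_of_forall_notMem h2
        change n = 0 at h1
        rw [nearestIdx, hne, Nat.sInf_empty, h1]
  rw [this]
  exact ((hS n).inter (MeasurableSet.iInter fun m => MeasurableSet.iInter fun _ =>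
    (hS m).compl)).union ((MeasurableSet.const _).inter (MeasurableSet.iInter fun m => (hS m).compl))

lemma measurable_eval_nearestIdx {M : Type*} [MeasurableSpace M] :
    Measurable fun z : (ℕ → Plane) × (ℕ → M) => z.2 (nearestIdx z.1) := by
  have h : Measurable fun q : (ℕ → M) × ℕ => q.1 q.2 :=
    measurable_from_prod_countable_left fun i => measurable_pi_apply i
  exact h.comp (measurable_snd.prodMk (measurable_nearestIdx.comp measurable_fst))

lemma measurable_nearestDist : Measurable nearestDist :=
  (measurable_eval_nearestIdx.comp (measurable_id.prodMk measurable_id)).norm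

section Poisson

variable {Ω : Type*} [MeasurableSpace Ω] {P : Measure Ω} [IsProbabilityMeasure P]
  {X : ℕ → Ω → Plane} {lam : ℝ}

lemma IsPoissonProcess.ae_ne_zero (hX : IsPoissonProcess P X lam) (hlam : 0 ≤ lam) :
    ∀ᵐ ω ∂P, ∀ i, X i ω ≠ 0 := by
  refine ae_all_iff.2 fun i => ?_
  have h0 : P.map (X i) {0} = 0 := by
    have h1 := (Measure.le_sum (fun i => P.map (X i)) i) {0}
    rw [hX.sum_map_eq hlam] at h1
    simpa using h1
  rw [Measure.map_apply (hX.measurable i) (measurableSet_singleton _)] at h0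
  rw [ae_iff]
  simp only [Ne, not_not]
  exact h0

lemma IsPoissonProcess.measure_two_le_pointCount (hX : IsPoissonProcess P X lam) {A : Set Plane}
    (hA : MeasurableSet A) (hb : Bornology.IsBounded A) :
    P {ω | 2 ≤ pointCount X A ω} ≤ ENNReal.ofReal (lam * (volume A).toReal) ^ 2 := by
  have h1 : P {ω | 2 ≤ pointCount X A ω}
      = ∫⁻ ω, (if 2 ≤ pointCount X A ω then 1 else 0) ∂P := by
    have hm : MeasurableSet {ω | 2 ≤ pointCount X A ω} :=
      hX.measurable_pointCount hA (MeasurableSet.of_discrete (s := {n : ℕ∞ | 2 ≤ n}))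
    rw [← lintegral_indicator_one hm]
    refine lintegral_congr fun ω => ?_
    by_cases h : 2 ≤ pointCount X A ω <;> simp [h]
  rw [h1, hX.lintegral_pointCount hA hb fun n => if 2 ≤ n then 1 else 0]
  set r := Real.toNNReal (lam * (volume A).toReal)
  rw [tsum_eq_zero_add' ENNReal.summable, tsum_eq_zero_add' ENNReal.summable]
  have hstep : ∀ n : ℕ, poissonMeasure r {n + 1 + 1} ≤ (r : ℝ≥0∞) ^ 2 * poissonMeasure r {n} := by
    intro n
    rw [poissonMeasure_singleton, poissonMeasure_singleton, ← ENNReal.ofReal_coe_nnreal,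
      ← ENNReal.ofReal_pow (by positivity), ← ENNReal.ofReal_mul (by positivity)]
    refine ENNReal.ofReal_le_ofReal ?_
    rw [← mul_div_assoc]
    have h2 : (r : ℝ) ^ 2 * (Real.exp (-r) * r ^ n) = Real.exp (-r) * r ^ (n + 1 + 1) := by ring
    rw [h2]
    gcongr
    omega
  have hz : ∑' n : ℕ, (r : ℝ≥0∞) ^ 2 * poissonMeasure r {n} = (r : ℝ≥0∞) ^ 2 := by
    rw [ENNReal.tsum_mul_left, tsum_poissonMeasure, mul_one]
  change _ ≤ (r : ℝ≥0∞) ^ 2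
  rw [← hz]
  have h01 : ¬ ((2 : ℕ∞) ≤ 0) ∧ ¬ ((2 : ℕ∞) ≤ 1) := by decide
  simp only [Nat.cast_zero, h01.1, if_false, zero_mul, zero_add, Nat.cast_one, h01.2]
  refine ENNReal.tsum_le_tsum fun n => ?_
  refine le_trans ?_ (hstep n)
  split_ifs <;> simp

lemma volume_annulus {a b : ℝ} (ha : 0 ≤ a) (hab : a ≤ b) :
    volume {x : Plane | a ≤ ‖x‖ ∧ ‖x‖ < b} = ENNReal.ofReal (π * (b ^ 2 - a ^ 2)) := by
  have h : {x : Plane | a ≤ ‖x‖ ∧ ‖x‖ < b} = Metric.ball 0 b \ Metric.ball 0 a := by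
    ext x
    simp [and_comm]
  rw [h, measure_sdiff (Metric.ball_subset_ball hab)
    Metric.isOpen_ball.measurableSet.nullMeasurableSet
    Metric.isBounded_ball.measure_lt_top.ne, EuclideanSpace.volume_ball_fin_two,
    EuclideanSpace.volume_ball_fin_two, ← ENNReal.ofReal_pow ha,
    ← ENNReal.ofReal_pow (ha.trans hab), ← ENNReal.ofReal_mul (by positivity),
    ← ENNReal.ofReal_mul (by positivity), ← ENNReal.ofReal_sub _ (by positivity)]
  congr 1
  ring

/-- Almost surely no two points have the same distance to the origin. Points with
`‖x‖ ^ 2 < M` fall into `M (n + 1)` annuli of area `π / (n + 1)`, each of which holds two points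
with probability `O(n⁻²)`. -/
lemma IsPoissonProcess.ae_norm_injective (hX : IsPoissonProcess P X lam) (hlam : 0 ≤ lam) :
    ∀ᵐ ω ∂P, Function.Injective fun i => ‖X i ω‖ := by
  have key : ∀ M : ℕ, ∀ᵐ ω ∂P, ∀ i j, ‖X i ω‖ ^ 2 < M → ‖X i ω‖ = ‖X j ω‖ → i = j := by
    intro M
    set A : ℕ → ℕ → Set Plane := fun n k =>
      {x | √(k / (n + 1)) ≤ ‖x‖ ∧ ‖x‖ < √((k + 1) / (n + 1))} with hA
    have hAm : ∀ n k, MeasurableSet (A n k) := fun n k =>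
      (measurableSet_le measurable_const measurable_norm).inter
        (measurableSet_lt measurable_norm measurable_const)
    have hAb : ∀ n k, Bornology.IsBounded (A n k) := fun n k =>
      Metric.isBounded_ball.subset fun x hx => mem_ball_zero_iff.2 hx.2
    have hvol : ∀ n k, (volume (A n k)).toReal = π / (n + 1) := by
      intro n k
      rw [hA, volume_annulus (Real.sqrt_nonneg _) (Real.sqrt_le_sqrt (by gcongr; simp)),
        Real.sq_sqrt (by positivity), Real.sq_sqrt (by positivity), ← sub_div,
        ENNReal.toReal_ofReal (by simp; positivity)]
      ring
    have hsub : ∀ n : ℕ, {ω | ¬ ∀ i j, ‖X i ω‖ ^ 2 < M → ‖X i ω‖ = ‖X j ω‖ → i = j}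
        ⊆ ⋃ k ∈ Finset.range (M * (n + 1)), {ω | 2 ≤ pointCount X (A n k) ω} := by
      intro n ω hω
      simp only [mem_ofPred_eq, not_forall] at hω
      obtain ⟨i, j, hi, hij, hne⟩ := hω
      have hn : (0 : ℝ) < n + 1 := by positivity
      set k := ⌊‖X i ω‖ ^ 2 * (n + 1)⌋₊ with hk
      have hk1 : (k : ℝ) ≤ ‖X i ω‖ ^ 2 * (n + 1) := Nat.floor_le (by positivity)
      have hk2 : ‖X i ω‖ ^ 2 * (n + 1) < k + 1 := Nat.lt_floor_add_one _
      have hmem : X i ω ∈ A n k := by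
        refine ⟨Real.sqrt_le_left (norm_nonneg _) |>.mpr ?_, ?_⟩
        · rwa [div_le_iff₀ hn]
        · rw [Real.lt_sqrt (norm_nonneg _), lt_div_iff₀ hn]
          exact hk2
      have hmem' : X j ω ∈ A n k := by
        simp only [hA, mem_ofPred_eq] at hmem ⊢
        rwa [← hij]
      simp only [mem_iUnion, Finset.mem_range]
      refine ⟨k, ?_, ?_⟩
      · have : (k : ℝ) < (M * (n + 1) : ℕ) := by
          push_cast
          exact hk1.trans_lt (by gcongr)
        exact_mod_cast this
      · have hsub2 : ({i, j} : Set ℕ) ⊆ {l | X l ω ∈ A n k} := by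
          rintro l (rfl | rfl)
          · exact hmem
          · exact hmem'
        have := Set.encard_le_encard hsub2
        rwa [Set.encard_pair hne] at this
    have hbound : ∀ n : ℕ, P {ω | ¬ ∀ i j, ‖X i ω‖ ^ 2 < M → ‖X i ω‖ = ‖X j ω‖ → i = j}
        ≤ ENNReal.ofReal (M * (lam * π) ^ 2 / (n + 1)) := by
      intro n
      refine (measure_mono (hsub n)).trans ((measure_biUnion_finset_le _ _).trans ?_)
      refine (Finset.sum_le_sum fun k _ => hX.measure_two_le_pointCount (hAm n k) (hAb n k)).trans ?_
      simp_rw [hvol]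
      rw [Finset.sum_const, Finset.card_range, nsmul_eq_mul, ← ENNReal.ofReal_pow (by positivity),
        ← ENNReal.ofReal_natCast, ← ENNReal.ofReal_mul (by positivity)]
      refine ENNReal.ofReal_le_ofReal (le_of_eq ?_)
      push_cast
      field_simp
    rw [ae_iff]
    have hlim : Tendsto (fun n : ℕ => ENNReal.ofReal (M * (lam * π) ^ 2 / ((n : ℝ) + 1)))
        atTop (𝓝 0) := by
      have := tendsto_const_div_atTop_nhds_zero_nat (M * (lam * π) ^ 2)
      have h2 := (tendsto_add_atTop_iff_nat 1).2 this
      have h3 := ENNReal.tendsto_ofReal h2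
      simpa using h3
    exact le_antisymm (ge_of_tendsto' hlim hbound) bot_le
  filter_upwards [ae_all_iff.2 key] with ω hω i j hij
  obtain ⟨M, hM⟩ := exists_nat_gt (‖X i ω‖ ^ 2)
  exact hω M i j hM hij

lemma IsPoissonProcess.ae_isGoodConfig (hX : IsPoissonProcess P X lam) (hlam : 0 ≤ lam) :
    ∀ᵐ ω ∂P, IsGoodConfig fun i => X i ω := by
  have h1 : ∀ᵐ ω ∂P, ∀ n : ℕ, pointCount X (Metric.ball 0 n) ω ≠ ⊤ := ae_all_iff.2 fun n =>
    hX.ae_pointCount_ne_top Metric.isOpen_ball.measurableSet Metric.isBounded_ball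
  filter_upwards [h1, hX.ae_ne_zero hlam, hX.ae_norm_injective hlam] with ω h1 h2 h3
  refine ⟨fun n => ?_, h2, h3⟩
  have := h1 n
  rw [pointCount, Ne, Set.encard_eq_top_iff, Set.not_infinite] at this
  simpa using this

end Poisson

/-! ### The configuration beyond the nearest point -/

section Poisson

variable {Ω : Type*} [MeasurableSpace Ω] {P : Measure Ω} {X : ℕ → Ω → Plane} {lam : ℝ}

/-- The total of `v b ‖x i‖` over the points at distance at least `b` from the origin. -/
noncomputable def farSum (v : ℝ → ℝ → ℝ≥0∞) (b : ℝ) (x : ℕ → Plane) : ℝ≥0∞ :=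
  ∑' i, if b ≤ ‖x i‖ then v b ‖x i‖ else 0

/-- The Laplace functional of the points at distance at least `b` from the origin, in closed form.
-/
noncomputable def farLaplace (lam : ℝ) (v : ℝ → ℝ → ℝ≥0∞) (b : ℝ) : ℝ≥0∞ :=
  expNeg (ENNReal.ofReal lam * ∫⁻ x : Plane, if b ≤ ‖x‖ then 1 - expNeg (v b ‖x‖) else 0)

/-- The total of `v R ‖x i‖` over all points but the nearest one, whose distance to the origin
is `R`. -/
noncomputable def otherSum (v : ℝ → ℝ → ℝ≥0∞) (x : ℕ → Plane) : ℝ≥0∞ :=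
  ∑' i, if i ≠ nearestIdx x then v (nearestDist x) ‖x i‖ else 0

lemma IsPoissonProcess.measurable_pi (hX : IsPoissonProcess P X lam) :
    Measurable fun ω i => X i ω := measurable_pi_lambda _ hX.measurable

lemma IsPoissonProcess.measurable_nearestDist (hX : IsPoissonProcess P X lam) :
    Measurable fun ω => nearestDist fun i => X i ω :=
  CoMPflex.measurable_nearestDist.comp hX.measurable_pi

variable [IsProbabilityMeasure P]

/-- No point in the ball of radius `a`, and the Laplace functional of the points beyond `b`: this is
the Laplace functional of the whole process for a function that is infinite on the ball. -/
lemma IsPoissonProcess.lintegral_le_nearestDist_mul (hX : IsPoissonProcess P X lam)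
    (hlam : 0 ≤ lam) {v : ℝ → ℝ → ℝ≥0∞} {a b : ℝ} (hab : a ≤ b) (hv : Measurable (v b)) :
    ∫⁻ ω, (if a ≤ nearestDist (fun i => X i ω) then 1 else 0) *
        expNeg (farSum v b fun i => X i ω) ∂P
      = expNeg (ENNReal.ofReal lam * volume (Metric.ball (0 : Plane) a)) * farLaplace lam v b := by
  have hmb : MeasurableSet {x : Plane | b ≤ ‖x‖} := measurableSet_le measurable_const measurable_norm
  have hma : MeasurableSet {x : Plane | ‖x‖ < a} := measurableSet_lt measurable_norm measurable_const
  have hfar : Measurable fun x : Plane => if b ≤ ‖x‖ then v b ‖x‖ else 0 :=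
    Measurable.ite hmb (hv.comp measurable_norm) measurable_const
  have hnear : Measurable fun x : Plane => if ‖x‖ < a then (⊤ : ℝ≥0∞) else 0 :=
    Measurable.ite hma measurable_const measurable_const
  have h1 : ∫⁻ ω, (if a ≤ nearestDist (fun i => X i ω) then 1 else 0) *
        expNeg (farSum v b fun i => X i ω) ∂P
      = ∫⁻ ω, expNeg (∑' i, ((if ‖X i ω‖ < a then (⊤ : ℝ≥0∞) else 0)
          + if b ≤ ‖X i ω‖ then v b ‖X i ω‖ else 0)) ∂P := by
    refine lintegral_congr_ae ?_
    filter_upwards [hX.ae_isGoodConfig hlam] with ω hω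
    rw [ENNReal.tsum_add, expNeg_add]
    congr 1
    split_ifs with h
    · rw [ENNReal.tsum_eq_zero.2, expNeg_zero]
      intro i
      rw [if_neg (not_lt.2 (h.trans (hω.nearestDist_le i)))]
    · rw [ENNReal.tsum_eq_top_of_eq_top, expNeg_top]
      exact ⟨nearestIdx fun i => X i ω, if_pos (not_le.1 h)⟩
  have h3 := hX.lintegral_expNeg_tsum hlam (hnear.add hfar)
  simp only [Pi.add_apply] at h3
  rw [h1, h3, farLaplace, ← expNeg_add, ← mul_add]
  congr 2
  have h2 : volume (Metric.ball (0 : Plane) a) = ∫⁻ x : Plane, if ‖x‖ < a then 1 else 0 := by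
    have : Metric.ball (0 : Plane) a = {x : Plane | ‖x‖ < a} := by ext; simp
    rw [this, ← lintegral_indicator_one hma]
    refine lintegral_congr fun x => ?_
    simp [indicator_apply]
  rw [h2, ← lintegral_add_left (Measurable.ite hma measurable_const measurable_const)]
  refine lintegral_congr fun x => ?_
  by_cases hxa : ‖x‖ < a
  · have hxb : ¬ b ≤ ‖x‖ := not_le.2 (hxa.trans_le hab)
    simp [hxa, hxb]
  · by_cases hxb : b ≤ ‖x‖ <;> simp [hxa, hxb]

/-- The nearest distance is at least `a` if and only if the ball of radius `a` has no points. -/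
lemma IsPoissonProcess.measure_le_nearestDist (hX : IsPoissonProcess P X lam) (hlam : 0 ≤ lam)
    (a : ℝ) : P {ω | a ≤ nearestDist fun i => X i ω}
      = expNeg (ENNReal.ofReal lam * volume (Metric.ball (0 : Plane) a)) := by
  have h := hX.lintegral_le_nearestDist_mul hlam (v := fun _ _ => 0) (le_refl a) measurable_const
  have hm : MeasurableSet {ω | a ≤ nearestDist fun i => X i ω} :=
    measurableSet_le measurable_const (hX.measurable_nearestDist)
  simp only [farSum, farLaplace, ite_self, tsum_zero, expNeg_zero, mul_one, tsub_self,
    lintegral_zero, mul_zero] at h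
  rw [← h, ← lintegral_indicator_one hm]
  refine lintegral_congr fun ω => ?_
  simp [indicator_apply]

lemma measurable_farSum {v : ℝ → ℝ → ℝ≥0∞} (hv : Measurable (Function.uncurry v)) (b : ℝ) :
    Measurable (farSum v b) := by
  refine Measurable.tsum fun i => Measurable.ite ?_ ?_ measurable_const
  · exact measurableSet_le measurable_const (measurable_pi_apply i).norm
  · exact hv.comp (measurable_const.prodMk (measurable_pi_apply i).norm)

lemma measurable_otherSum {v : ℝ → ℝ → ℝ≥0∞} (hv : Measurable (Function.uncurry v)) :
    Measurable (otherSum v) := by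
  refine Measurable.tsum fun i => Measurable.ite ?_ ?_ measurable_const
  · exact (measurable_nearestIdx (measurableSet_singleton i).compl).congr (by ext; simp [eq_comm])
  · exact hv.comp (measurable_nearestDist.prodMk (measurable_pi_apply i).norm)

lemma measurable_farLaplace {v : ℝ → ℝ → ℝ≥0∞} (hv : Measurable (Function.uncurry v)) :
    Measurable (farLaplace lam v) := by
  have h : Measurable fun q : ℝ × Plane =>
      if q.1 ≤ ‖q.2‖ then 1 - expNeg (v q.1 ‖q.2‖) else 0 := by
    refine Measurable.ite (measurableSet_le measurable_fst measurable_snd.norm)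
      (measurable_const.sub (measurable_expNeg.comp ?_)) measurable_const
    exact hv.comp (measurable_fst.prodMk measurable_snd.norm)
  exact measurable_expNeg.comp (h.lintegral_prod_right'.const_mul _)

/-- Given that the nearest distance is in `[a, b)`, the points beyond `b` are distributed as they
are unconditionally. -/
lemma IsPoissonProcess.lintegral_nearestDist_mem_Ico_mul (hX : IsPoissonProcess P X lam)
    (hlam : 0 ≤ lam) {v : ℝ → ℝ → ℝ≥0∞} {a b : ℝ} (hab : a ≤ b)
    (hv : Measurable (Function.uncurry v)) :
    ∫⁻ ω in {ω | nearestDist (fun i => X i ω) ∈ Ico a b}, expNeg (farSum v b fun i => X i ω) ∂P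
      = P {ω | nearestDist (fun i => X i ω) ∈ Ico a b} * farLaplace lam v b := by
  have hR := hX.measurable_nearestDist
  have hF := measurable_expNeg.comp ((measurable_farSum hv b).comp hX.measurable_pi)
  have hmI : MeasurableSet {ω | nearestDist (fun i => X i ω) ∈ Ico a b} := hR measurableSet_Ico
  have hm : ∀ c, MeasurableSet {ω | c ≤ nearestDist (fun i => X i ω)} :=
    fun c => hR measurableSet_Ici
  have hset : ∀ c, c ≤ b → ∫⁻ ω in {ω | c ≤ nearestDist (fun i => X i ω)},
      expNeg (farSum v b fun i => X i ω) ∂P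
      = P {ω | c ≤ nearestDist (fun i => X i ω)} * farLaplace lam v b := by
    intro c hc
    rw [hX.measure_le_nearestDist hlam, ← hX.lintegral_le_nearestDist_mul hlam hc
      (hv.comp measurable_prodMk_left), ← lintegral_indicator (hm c)]
    refine lintegral_congr fun ω => ?_
    simp [indicator_apply]
  have hU : {ω | a ≤ nearestDist (fun i => X i ω)}
      = {ω | nearestDist (fun i => X i ω) ∈ Ico a b} ∪ {ω | b ≤ nearestDist (fun i => X i ω)} := by
    ext ω
    simp only [mem_ofPred_eq, mem_union, mem_Ico]
    constructor
    · intro h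
      exact (lt_or_ge _ b).imp (fun h' => ⟨h, h'⟩) id
    · rintro (h | h)
      exacts [h.1, hab.trans h]
  have hd : Disjoint {ω | nearestDist (fun i => X i ω) ∈ Ico a b}
      {ω | b ≤ nearestDist (fun i => X i ω)} :=
    Set.disjoint_left.2 fun ω h1 h2 => not_lt.2 h2 h1.2
  have h1 := hset a hab
  rw [hU, lintegral_union (hm b) hd, measure_union hd (hm b), add_mul, hset b le_rfl] at h1
  exact (ENNReal.add_left_inj (ENNReal.mul_ne_top (measure_ne_top _ _) (expNeg_ne_top _))).1 h1

/-- The least multiple of `1 / (n + 1)` exceeding `r`, for `0 ≤ r`. -/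
noncomputable def roundUp (n : ℕ) (r : ℝ) : ℝ := (⌊(n + 1) * r⌋₊ + 1) / (n + 1)

lemma lt_roundUp (n : ℕ) (r : ℝ) : r < roundUp n r := by
  rw [roundUp, lt_div_iff₀ (by positivity), mul_comm]
  exact Nat.lt_floor_add_one _

lemma roundUp_le (n : ℕ) {r : ℝ} (hr : 0 ≤ r) : roundUp n r ≤ r + 1 / (n + 1) := by
  have hn : (0 : ℝ) < n + 1 := by positivity
  have h := Nat.floor_le (mul_nonneg hn.le hr)
  rw [roundUp, div_le_iff₀ hn, add_mul r, div_mul_cancel₀ _ hn.ne', mul_comm r]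
  gcongr

lemma tendsto_roundUp {r : ℝ} (hr : 0 ≤ r) : Tendsto (fun n => roundUp n r) atTop (𝓝[>] r) := by
  refine tendsto_nhdsWithin_iff.2 ⟨?_, Eventually.of_forall fun n => lt_roundUp n r⟩
  have h : Tendsto (fun n : ℕ => r + 1 / ((n : ℝ) + 1)) atTop (𝓝 (r + 0)) :=
    tendsto_const_nhds.add tendsto_one_div_add_atTop_nhds_zero_nat
  rw [add_zero] at h
  exact tendsto_of_tendsto_of_tendsto_of_le_of_le tendsto_const_nhds h
    (fun n => (lt_roundUp n r).le) fun n => roundUp_le n hr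

lemma measurable_roundUp (n : ℕ) : Measurable (roundUp n) := by
  unfold roundUp
  have : Measurable fun r : ℝ => (⌊((n : ℝ) + 1) * r⌋₊ : ℝ) :=
    (measurable_of_countable (fun k : ℕ => (k : ℝ))).comp
      (Nat.measurable_floor.comp (measurable_const_mul _))
  fun_prop

lemma roundUp_of_mem_Ico {n k : ℕ} {r : ℝ}
    (h : r ∈ Ico ((k : ℝ) / (n + 1)) ((k + 1) / (n + 1))) : roundUp n r = (k + 1) / (n + 1) := by
  have hn : (0 : ℝ) < n + 1 := by positivity
  have : ⌊((n : ℝ) + 1) * r⌋₊ = k := by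
    rw [Nat.floor_eq_iff (by
      have : 0 ≤ r := le_trans (by positivity) h.1
      positivity)]
    constructor
    · have := h.1; rw [div_le_iff₀ hn] at this; linarith
    · have := h.2; rw [lt_div_iff₀ hn] at this; linarith
  rw [roundUp, this]

/-- For the nearest distance rounded up to a multiple of `1 / (n + 1)`, conditioning on it is
elementary: the intervals on which the rounded distance is constant are treated one by one. -/
lemma IsPoissonProcess.lintegral_roundUp (hX : IsPoissonProcess P X lam)
    (hlam : 0 ≤ lam) {v : ℝ → ℝ → ℝ≥0∞} (hv : Measurable (Function.uncurry v))
    (h : ℝ → ℝ≥0∞) (n : ℕ) :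
    ∫⁻ ω, h (roundUp n (nearestDist fun i => X i ω)) *
        expNeg (farSum v (roundUp n (nearestDist fun i => X i ω)) fun i => X i ω) ∂P
      = ∫⁻ ω, h (roundUp n (nearestDist fun i => X i ω)) *
        farLaplace lam v (roundUp n (nearestDist fun i => X i ω)) ∂P := by
  have hR := hX.measurable_nearestDist
  set A : ℕ → Set Ω := fun k =>
    {ω | nearestDist (fun i => X i ω) ∈ Ico ((k : ℝ) / (n + 1)) ((k + 1) / (n + 1))} with hA
  have hAm : ∀ k, MeasurableSet (A k) := fun k => hR measurableSet_Ico
  have hn : (0 : ℝ) < n + 1 := by positivity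
  have hd : Pairwise (Function.onFun Disjoint A) := by
    intro k l hkl
    refine Set.disjoint_left.2 fun ω h1 h2 => hkl ?_
    have h3 := (roundUp_of_mem_Ico h1).symm.trans (roundUp_of_mem_Ico h2)
    rw [div_left_inj' hn.ne'] at h3
    exact_mod_cast add_right_cancel h3
  have hU : ⋃ k, A k = univ := by
    refine Set.eq_univ_of_forall fun ω => ?_
    have hnn : 0 ≤ ((n : ℝ) + 1) * nearestDist (fun i => X i ω) :=
      mul_nonneg hn.le (norm_nonneg _)
    refine mem_iUnion.2 ⟨⌊((n : ℝ) + 1) * nearestDist (fun i => X i ω)⌋₊, ?_, ?_⟩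
    · rw [div_le_iff₀ hn]
      exact (Nat.floor_le hnn).trans_eq (mul_comm _ _)
    · rw [lt_div_iff₀ hn]
      exact (mul_comm _ _).trans_lt (Nat.lt_floor_add_one _)
  rw [← setLIntegral_univ, ← hU, lintegral_iUnion hAm hd, ← setLIntegral_univ (μ := P) (f := fun ω =>
    h (roundUp n (nearestDist fun i => X i ω)) *
        farLaplace lam v (roundUp n (nearestDist fun i => X i ω))), ← hU, lintegral_iUnion hAm hd]
  refine tsum_congr fun k => ?_
  have hFm : Measurable fun ω => expNeg (farSum v ((k + 1) / (n + 1)) fun i => X i ω) :=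
    measurable_expNeg.comp ((measurable_farSum hv _).comp hX.measurable_pi)
  have e1 : ∀ ω ∈ A k, h (roundUp n (nearestDist fun i => X i ω)) *
        expNeg (farSum v (roundUp n (nearestDist fun i => X i ω)) fun i => X i ω)
      = h ((k + 1) / (n + 1)) * expNeg (farSum v ((k + 1) / (n + 1)) fun i => X i ω) :=
    fun ω hω => by rw [roundUp_of_mem_Ico hω]
  have e2 : ∀ ω ∈ A k, h (roundUp n (nearestDist fun i => X i ω)) *
        farLaplace lam v (roundUp n (nearestDist fun i => X i ω))
      = h ((k + 1) / (n + 1)) * farLaplace lam v ((k + 1) / (n + 1)) :=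
    fun ω hω => by rw [roundUp_of_mem_Ico hω]
  rw [setLIntegral_congr_fun (hAm k) e1, setLIntegral_congr_fun (hAm k) e2, setLIntegral_const,
    lintegral_const_mul _ hFm,
    hX.lintegral_nearestDist_mem_Ico_mul hlam (by gcongr; simp) hv]
  ring

/-- By Campbell's formula the sum of `(1 + ‖X i‖) ^ (-α)` is integrable; as the points stay away
from the origin, it is comparable to the sum of `‖X i‖ ^ (-α)`. -/
lemma IsPoissonProcess.ae_tsum_rpow_ne_top (hX : IsPoissonProcess P X lam) (hlam : 0 ≤ lam)
    {α : ℝ} (hα : 2 < α) : ∀ᵐ ω ∂P, ∑' i, ENNReal.ofReal (‖X i ω‖ ^ (-α)) ≠ ⊤ := by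
  have hf : Measurable fun x : Plane => ENNReal.ofReal ((1 + ‖x‖) ^ (-α)) := by fun_prop
  have h1 : ∫⁻ ω, ∑' i, ENNReal.ofReal ((1 + ‖X i ω‖) ^ (-α)) ∂P ≠ ⊤ := by
    have hfi : ∀ i, Measurable fun ω => ENNReal.ofReal ((1 + ‖X i ω‖) ^ (-α)) := fun i =>
      hf.comp (hX.measurable i)
    rw [lintegral_tsum fun i => (hfi i).aemeasurable, hX.tsum_lintegral hlam hf]
    refine ENNReal.mul_ne_top ENNReal.ofReal_ne_top ?_
    exact (integrable_one_add_norm (by simpa using hα)).lintegral_lt_top.ne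
  have hm : Measurable fun ω => ∑' i, ENNReal.ofReal ((1 + ‖X i ω‖) ^ (-α)) :=
    Measurable.tsum fun i => hf.comp (hX.measurable i)
  filter_upwards [ae_lt_top hm h1, hX.ae_isGoodConfig hlam] with ω hω hg
  set R := nearestDist fun i => X i ω
  have hR : 0 < R := hg.nearestDist_pos
  have hle : ∀ i, ENNReal.ofReal (‖X i ω‖ ^ (-α))
      ≤ ENNReal.ofReal ((1 + 1 / R) ^ α) * ENNReal.ofReal ((1 + ‖X i ω‖) ^ (-α)) := by
    intro i
    have hi : R ≤ ‖X i ω‖ := hg.nearestDist_le i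
    have hp : 0 < ‖X i ω‖ := hR.trans_le hi
    rw [← ENNReal.ofReal_mul (by positivity)]
    refine ENNReal.ofReal_le_ofReal ?_
    have h2 : 1 + ‖X i ω‖ ≤ (1 + 1 / R) * ‖X i ω‖ := by
      have : 1 ≤ 1 / R * ‖X i ω‖ := by
        rw [one_div, inv_mul_eq_div, one_le_div hR]; exact hi
      linarith
    rw [Real.rpow_neg hp.le, Real.rpow_neg (by positivity), ← div_eq_mul_inv,
      inv_eq_one_div, div_le_div_iff₀ (by positivity) (by positivity), one_mul,
      ← Real.mul_rpow (by positivity) hp.le]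
    exact Real.rpow_le_rpow (by positivity) h2 (by linarith)
  refine ne_top_of_le_ne_top ?_ (ENNReal.tsum_le_tsum hle)
  rw [ENNReal.tsum_mul_left]
  exact ENNReal.mul_ne_top ENNReal.ofReal_ne_top hω.ne

/-- As the threshold decreases to the nearest distance, the total over the points beyond the
threshold tends to the total over all points but the nearest one. -/
lemma tendsto_farSum_roundUp {x : ℕ → Plane} (hx : IsGoodConfig x) {α β : ℝ} (hβ : 0 ≤ β)
    (hα : 0 < α) (hsum : ∑' i, ENNReal.ofReal (‖x i‖ ^ (-α)) ≠ ⊤) {v : ℝ → ℝ → ℝ≥0∞}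
    (hvc : ∀ r ρ, 0 < r → 0 < ρ → Tendsto (fun b => v b ρ) (𝓝[>] r) (𝓝 (v r ρ)))
    (hvle : ∀ r ρ, 0 < r → 0 < ρ → v r ρ ≤ ENNReal.ofReal (β * (r / ρ) ^ α)) :
    Tendsto (fun n => farSum v (roundUp n (nearestDist x)) x) atTop (𝓝 (otherSum v x)) := by
  set R := nearestDist x with hRdef
  have hR : 0 < R := hx.nearestDist_pos
  simp only [farSum, otherSum, ← lintegral_count]
  refine tendsto_lintegral_of_dominated_convergence
    (fun i => ENNReal.ofReal (β * (R + 1) ^ α) * ENNReal.ofReal (‖x i‖ ^ (-α)))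
    (fun n => measurable_of_countable _) (fun n => ae_of_all _ fun i => ?_) ?_
    (ae_of_all _ fun i => ?_)
  · have hp : 0 < ‖x i‖ := norm_pos_iff.2 (hx.ne_zero i)
    have hT : 0 < roundUp n R := hR.trans (lt_roundUp n R)
    have hT1 : roundUp n R ≤ R + 1 := by
      refine (roundUp_le n hR.le).trans ?_
      gcongr
      rw [div_le_one (by positivity)]
      simp
    beta_reduce
    split_ifs
    · refine (hvle _ _ hT hp).trans ?_
      rw [← ENNReal.ofReal_mul (by positivity)]
      refine ENNReal.ofReal_le_ofReal ?_
      rw [Real.div_rpow hT.le hp.le, Real.rpow_neg hp.le, ← div_eq_mul_inv, ← mul_div_assoc]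
      gcongr
    · exact bot_le
  · rw [lintegral_count, ENNReal.tsum_mul_left]
    exact ENNReal.mul_ne_top ENNReal.ofReal_ne_top hsum
  · by_cases hi : i = nearestIdx x
    · have h0 : ∀ n, ¬ roundUp n R ≤ ‖x i‖ := fun n => by
        rw [hi]; exact not_le.2 (lt_roundUp n R)
      rw [if_neg (not_not.2 hi)]
      simp only [h0, if_false]
      exact tendsto_const_nhds
    · have hlt : R < ‖x i‖ := (hx.nearestDist_lt_iff i).2 hi
      have hev : ∀ᶠ n in atTop, roundUp n R ≤ ‖x i‖ :=
        (tendsto_nhdsWithin_iff.1 (tendsto_roundUp hR.le)).1.eventually_le_const hlt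
      rw [if_pos hi]
      refine ((hvc R ‖x i‖ hR (hR.trans hlt)).comp (tendsto_roundUp hR.le)).congr' ?_
      filter_upwards [hev] with n hn
      rw [if_pos hn, Function.comp_apply]

/-- Given the nearest distance `R`, the points other than the nearest one are distributed as the
Poisson process outside the ball of radius `R`. Rounding `R` up to multiples of `1 / (n + 1)` and
letting `n` tend to infinity proves this for bounded continuous `h`, and these determine a finite
measure. -/
theorem IsPoissonProcess.lintegral_mul_expNeg_otherSum (hX : IsPoissonProcess P X lam)
    (hlam : 0 ≤ lam) {α β : ℝ} (hβ : 0 ≤ β) (hα : 2 < α) {v : ℝ → ℝ → ℝ≥0∞}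
    (hv : Measurable (Function.uncurry v))
    (hvc : ∀ r ρ, 0 < r → 0 < ρ → Tendsto (fun b => v b ρ) (𝓝[>] r) (𝓝 (v r ρ)))
    (hvle : ∀ r ρ, 0 < r → 0 < ρ → v r ρ ≤ ENNReal.ofReal (β * (r / ρ) ^ α))
    (hφc : ∀ r, 0 < r → Tendsto (farLaplace lam v) (𝓝[>] r) (𝓝 (farLaplace lam v r)))
    {h : ℝ → ℝ≥0∞} (hh : Measurable h) :
    ∫⁻ ω, h (nearestDist fun i => X i ω) * expNeg (otherSum v fun i => X i ω) ∂P
      = ∫⁻ ω, h (nearestDist fun i => X i ω) * farLaplace lam v (nearestDist fun i => X i ω) ∂P := by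
  have hR := hX.measurable_nearestDist
  have hF : Measurable fun ω => expNeg (otherSum v fun i => X i ω) :=
    measurable_expNeg.comp ((measurable_otherSum hv).comp hX.measurable_pi)
  have hφm := measurable_farLaplace (lam := lam) hv
  have hφ : Measurable fun ω => farLaplace lam v (nearestDist fun i => X i ω) := hφm.comp hR
  have hcont : ∀ f : BoundedContinuousFunction ℝ ℝ≥0,
      ∫⁻ ω, f (nearestDist fun i => X i ω) * expNeg (otherSum v fun i => X i ω) ∂P
      = ∫⁻ ω, f (nearestDist fun i => X i ω) * farLaplace lam v (nearestDist fun i => X i ω) ∂P := by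
    intro f
    have hfm : Measurable fun r => (f r : ℝ≥0∞) := f.continuous.measurable.coe_nnreal_ennreal
    obtain ⟨C, hC⟩ : ∃ C : ℝ≥0, ∀ r, f r ≤ C := ⟨_, f.apply_le_nndist_zero⟩
    have hftend : ∀ ω, Tendsto (fun n => (f (roundUp n (nearestDist fun i => X i ω)) : ℝ≥0∞))
        atTop (𝓝 (f (nearestDist fun i => X i ω))) := by
      intro ω
      refine ENNReal.tendsto_coe.2 ((f.continuous.tendsto _).comp ?_)
      exact (tendsto_nhdsWithin_iff.1 (tendsto_roundUp (norm_nonneg _))).1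
    have hbd : ∀ r (y : ℝ≥0∞), (f r : ℝ≥0∞) * expNeg y ≤ C := fun r y =>
      (mul_le_mul' (ENNReal.coe_le_coe.2 (hC r)) (expNeg_le_one y)).trans_eq (mul_one _)
    have hL : Tendsto (fun n => ∫⁻ ω, f (roundUp n (nearestDist fun i => X i ω)) *
        expNeg (farSum v (roundUp n (nearestDist fun i => X i ω)) fun i => X i ω) ∂P) atTop
        (𝓝 (∫⁻ ω, f (nearestDist fun i => X i ω) * expNeg (otherSum v fun i => X i ω) ∂P)) := by
      refine tendsto_lintegral_of_dominated_convergence (fun _ => C) (fun n => ?_)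
        (fun n => ae_of_all _ fun ω => hbd _ _) (by simp) ?_
      · refine (hfm.comp ((measurable_roundUp n).comp hR)).mul (measurable_expNeg.comp ?_)
        refine Measurable.tsum fun i => Measurable.ite ?_ ?_ measurable_const
        · exact measurableSet_le ((measurable_roundUp n).comp hR) (hX.measurable i).norm
        · exact hv.comp (((measurable_roundUp n).comp hR).prodMk (hX.measurable i).norm)
      · filter_upwards [hX.ae_isGoodConfig hlam, hX.ae_tsum_rpow_ne_top hlam hα] with ω h1 h2
        refine ENNReal.Tendsto.mul (hftend ω) (Or.inr (expNeg_ne_top _))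
          ((continuous_expNeg.tendsto _).comp
            (tendsto_farSum_roundUp h1 hβ (by linarith) h2 hvc hvle)) (Or.inr ENNReal.coe_ne_top)
    have hRt : Tendsto (fun n => ∫⁻ ω, f (roundUp n (nearestDist fun i => X i ω)) *
        farLaplace lam v (roundUp n (nearestDist fun i => X i ω)) ∂P) atTop
        (𝓝 (∫⁻ ω, f (nearestDist fun i => X i ω) *
          farLaplace lam v (nearestDist fun i => X i ω) ∂P)) := by
      refine tendsto_lintegral_of_dominated_convergence (fun _ => C) (fun n => ?_)
        (fun n => ae_of_all _ fun ω => hbd _ _) (by simp) ?_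
      · exact (hfm.comp ((measurable_roundUp n).comp hR)).mul
          (hφm.comp ((measurable_roundUp n).comp hR))
      · filter_upwards [hX.ae_isGoodConfig hlam] with ω h1
        exact ENNReal.Tendsto.mul (hftend ω) (Or.inr (expNeg_ne_top _))
          ((hφc _ h1.nearestDist_pos).comp (tendsto_roundUp h1.nearestDist_pos.le))
          (Or.inr ENNReal.coe_ne_top)
    exact tendsto_nhds_unique hL
      (hRt.congr fun n => (hX.lintegral_roundUp hlam hv (fun r => (f r : ℝ≥0∞)) n).symm)
  -- Both sides are integrals of `h` against finite measures that agree on continuous functions.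
  have hmul : ∀ {G : Ω → ℝ≥0∞}, Measurable G → ∀ {k : ℝ → ℝ≥0∞}, Measurable k →
      ∫⁻ r, k r ∂((P.withDensity G).map fun ω => nearestDist fun i => X i ω)
        = ∫⁻ ω, k (nearestDist fun i => X i ω) * G ω ∂P := by
    intro G hG k hk
    have hkR : Measurable fun ω => k (nearestDist fun i => X i ω) := hk.comp hR
    rw [lintegral_map hk hR, lintegral_withDensity_eq_lintegral_mul _ hG hkR]
    exact lintegral_congr fun ω => mul_comm _ _
  have hfin : ∀ {G : Ω → ℝ≥0∞}, (∀ ω, G ω ≤ 1) →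
      IsFiniteMeasure ((P.withDensity G).map fun ω => nearestDist fun i => X i ω) := by
    intro G hG
    have : IsFiniteMeasure (P.withDensity G) := isFiniteMeasure_withDensity
      ((lintegral_mono hG).trans_lt (by simp)).ne
    infer_instance
  have := hfin (G := fun ω => expNeg (otherSum v fun i => X i ω)) fun ω => expNeg_le_one _
  have := hfin (G := fun ω => farLaplace lam v (nearestDist fun i => X i ω)) fun ω => expNeg_le_one _
  have heq : (P.withDensity fun ω => expNeg (otherSum v fun i => X i ω)).map
        (fun ω => nearestDist fun i => X i ω)
      = (P.withDensity fun ω => farLaplace lam v (nearestDist fun i => X i ω)).map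
        (fun ω => nearestDist fun i => X i ω) := by
    refine ext_of_forall_lintegral_eq_of_IsFiniteMeasure fun f => ?_
    have hfm : Measurable fun r => (f r : ℝ≥0∞) := f.continuous.measurable.coe_nnreal_ennreal
    rw [hmul hF hfm, hmul hφ hfm]
    exact hcont f
  rw [← hmul hF hh, ← hmul hφ hh, heq]

end Poisson

/-! ### Independent marks -/

section Decoupling

variable {Ω A B : Type*} [MeasurableSpace Ω] [MeasurableSpace A] [MeasurableSpace B]
  {P : Measure Ω} [IsProbabilityMeasure P] {U : Ω → A} {V : Ω → B}

lemma lintegral_of_indepFun (hU : AEMeasurable U P) (hV : AEMeasurable V P) (h : IndepFun U V P)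
    {G : A × B → ℝ≥0∞} (hG : Measurable G) :
    ∫⁻ ω, G (U ω, V ω) ∂P = ∫⁻ ω, ∫⁻ ω', G (U ω, V ω') ∂P ∂P := by
  have h1 := (indepFun_iff_map_prod_eq_prod_map_map hU hV).1 h
  have := Measure.isProbabilityMeasure_map hU
  have := Measure.isProbabilityMeasure_map hV
  have h2 : ∫⁻ ω, G (U ω, V ω) ∂P = ∫⁻ q, G q ∂(P.map fun ω => (U ω, V ω)) :=
    (lintegral_map' hG.aemeasurable (hU.prodMk hV)).symm
  rw [h2, h1, lintegral_prod _ hG.aemeasurable,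
    lintegral_map' hG.lintegral_prod_right'.aemeasurable hU]
  exact lintegral_congr fun ω =>
    lintegral_map' (f := fun b => G (U ω, b)) (hG.comp measurable_prodMk_left).aemeasurable hV

lemma lintegral_of_indepFun' (hU : AEMeasurable U P) (hV : AEMeasurable V P) (h : IndepFun U V P)
    {G : A × B → ℝ≥0∞} (hG : Measurable G) :
    ∫⁻ ω, G (U ω, V ω) ∂P = ∫⁻ ω', ∫⁻ ω, G (U ω, V ω') ∂P ∂P :=
  lintegral_of_indepFun hV hU h.symm (hG.comp measurable_swap)

end Decoupling

section Marks

variable {M : Type*} [MeasurableSpace M] {ν : Measure M} [IsProbabilityMeasure ν]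

lemma lintegral_eval_infinitePi (i : ℕ) {f : M → ℝ≥0∞} (hf : Measurable f) :
    ∫⁻ z, f (z i) ∂(Measure.infinitePi fun _ : ℕ => ν) = ∫⁻ a, f a ∂ν :=
  (measurePreserving_eval_infinitePi (fun _ : ℕ => ν) i).lintegral_comp hf

/-- The Laplace transform of a sum over independent marks; `U i` is minus the logarithm of the
Laplace transform of the `i`-th term. -/
lemma lintegral_expNeg_tsum_infinitePi {F : ℕ → M → ℝ≥0∞} (hF : ∀ i, Measurable (F i))
    {U : ℕ → ℝ≥0∞} (hU : ∀ i, ∫⁻ a, expNeg (F i a) ∂ν = expNeg (U i)) :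
    ∫⁻ z, expNeg (∑' i, F i (z i)) ∂(Measure.infinitePi fun _ : ℕ => ν)
      = expNeg (∑' i, U i) := by
  have hm : ∀ i, Measurable fun z : ℕ → M => expNeg (F i (z i)) := fun i =>
    measurable_expNeg.comp ((hF i).comp (measurable_pi_apply i))
  have hind : iIndepFun (fun i (z : ℕ → M) => expNeg (F i (z i)))
      (Measure.infinitePi fun _ : ℕ => ν) :=
    iIndepFun_infinitePi (P := fun _ : ℕ => ν) (X := fun i a => expNeg (F i a))
      fun i => measurable_expNeg.comp (hF i)
  have h1 : Tendsto (fun n => ∫⁻ z, ∏ i ∈ Finset.range n, expNeg (F i (z i))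
      ∂(Measure.infinitePi fun _ : ℕ => ν)) atTop
      (𝓝 (∫⁻ z, expNeg (∑' i, F i (z i)) ∂(Measure.infinitePi fun _ : ℕ => ν))) := by
    refine tendsto_lintegral_of_dominated_convergence (fun _ => 1)
      (fun n => Finset.measurable_prod _ fun i _ => hm i) (fun n => ae_of_all _ fun z => ?_)
      (by simp) (ae_of_all _ fun z => tendsto_prod_expNeg _)
    exact Finset.prod_le_one' fun i _ => expNeg_le_one _
  refine tendsto_nhds_unique h1 ((tendsto_prod_expNeg U).congr fun n => ?_)
  rw [lintegral_prod_eq_prod_lintegral_of_indepFun _ _ hind hm]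
  refine Finset.prod_congr rfl fun i _ => ?_
  exact (hU i).symm.trans (lintegral_eval_infinitePi i (measurable_expNeg.comp (hF i))).symm

/-- One mark is independent of any sum over the other marks. -/
lemma lintegral_eval_tsum_ne_infinitePi (k : ℕ) {F : ℕ → M → ℝ≥0∞} (hF : ∀ i, Measurable (F i))
    {H : M × ℝ≥0∞ → ℝ≥0∞} (hH : Measurable H) :
    ∫⁻ z, H (z k, ∑' i, if i ≠ k then F i (z i) else 0) ∂(Measure.infinitePi fun _ : ℕ => ν)
      = ∫⁻ z, ∫⁻ a, H (a, ∑' i, if i ≠ k then F i (z i) else 0) ∂ν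
          ∂(Measure.infinitePi fun _ : ℕ => ν) := by
  set Q := Measure.infinitePi fun _ : ℕ => ν with hQ
  set m : ℕ → MeasurableSpace (ℕ → M) := fun i =>
    MeasurableSpace.comap (fun z : ℕ → M => z i) inferInstance with hm
  have hle : ∀ i, m i ≤ MeasurableSpace.pi := fun i => (measurable_pi_apply i).comap_le
  have hind : iIndep m Q :=
    (iIndepFun_infinitePi (P := fun _ : ℕ => ν) (X := fun _ a => a) fun _ => measurable_id).iIndep
  have hkc := indep_iSup_of_disjoint hle hind (S := {k}) (T := {k}ᶜ) disjoint_compl_right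
  have hGm : Measurable[⨆ i ∈ ({k}ᶜ : Set ℕ), m i]
      fun z : ℕ → M => ∑' i, if i ≠ k then F i (z i) else 0 := by
    have htsum : ∀ (m₀ : MeasurableSpace (ℕ → M)) (f : ℕ → (ℕ → M) → ℝ≥0∞),
        (∀ i, Measurable[m₀] (f i)) → Measurable[m₀] fun z => ∑' i, f i z :=
      fun _ _ hf => Measurable.tsum hf
    refine htsum _ _ fun i => ?_
    by_cases hi : i = k
    · simp only [hi, ne_eq, not_true_eq_false, if_false]
      exact measurable_const
    · simp only [hi, ne_eq, not_false_eq_true, if_true]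
      have h1 : Measurable[m i] fun z : ℕ → M => F i (z i) :=
        (hF i).comp (comap_measurable _)
      exact h1.mono (le_iSup₂_of_le i hi le_rfl) le_rfl
  have hG : Measurable fun z : ℕ → M => ∑' i, if i ≠ k then F i (z i) else 0 :=
    hGm.mono (iSup₂_le fun i _ => hle i) le_rfl
  have hIF : IndepFun (fun z : ℕ → M => z k)
      (fun z : ℕ → M => ∑' i, if i ≠ k then F i (z i) else 0) Q := by
    rw [IndepFun_iff_Indep]
    exact indep_of_indep_of_le hkc (le_iSup₂_of_le k rfl le_rfl) hGm.comap_le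
  rw [lintegral_of_indepFun' (measurable_pi_apply k).aemeasurable hG.aemeasurable hIF hH]
  refine lintegral_congr fun z => ?_
  exact lintegral_eval_infinitePi k (hH.comp measurable_prodMk_right)

end Marks

section MarkedPoisson

variable {M : Type*} [MeasurableSpace M] {ν : Measure M}
  {Ω : Type*} [MeasurableSpace Ω] {P : Measure Ω} {X : ℕ → Ω → Plane} {m : ℕ → Ω → M} {lam : ℝ}

lemma IsMarkedPoissonProcess.aemeasurable_marks (h : IsMarkedPoissonProcess P X m lam ν) :
    AEMeasurable (fun ω i => m i ω) P :=
  aemeasurable_pi_lambda _ fun i => (h.mark_law i).aemeasurable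

variable [IsProbabilityMeasure P]

/-- The marks can be integrated out first, with the locations fixed. -/
lemma IsMarkedPoissonProcess.lintegral_eq (h : IsMarkedPoissonProcess P X m lam ν)
    {G : (ℕ → Plane) × (ℕ → M) → ℝ≥0∞} (hG : Measurable G) :
    ∫⁻ ω, G (fun i => X i ω, fun i => m i ω) ∂P
      = ∫⁻ ω, ∫⁻ z, G (fun i => X i ω, z) ∂(Measure.infinitePi fun _ : ℕ => ν) ∂P := by
  rw [lintegral_of_indepFun h.poisson.measurable_pi.aemeasurable h.aemeasurable_marks
    h.mark_indep_location hG]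
  refine lintegral_congr fun ω => ?_
  have hl : HasLaw (fun ω i => m i ω) (Measure.infinitePi fun _ : ℕ => ν) P :=
    iIndepFun.hasLaw_infinitePi h.mark_law h.mark_indep h.aemeasurable_marks
  rw [← hl.map_eq]
  exact (lintegral_map' (f := fun z => G (fun i => X i ω, z))
    (hG.comp measurable_prodMk_left).aemeasurable hl.aemeasurable).symm

/-- The Laplace functional of a marked Poisson process. -/
lemma IsMarkedPoissonProcess.lintegral_expNeg_tsum (h : IsMarkedPoissonProcess P X m lam ν)
    [IsProbabilityMeasure ν] (hlam : 0 ≤ lam)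
    {F : Plane → M → ℝ≥0∞} (hF : Measurable (Function.uncurry F))
    {U : Plane → ℝ≥0∞} (hUm : Measurable U) (hU : ∀ x, ∫⁻ a, expNeg (F x a) ∂ν = expNeg (U x)) :
    ∫⁻ ω, expNeg (∑' i, F (X i ω) (m i ω)) ∂P
      = expNeg (ENNReal.ofReal lam * ∫⁻ x, (1 - expNeg (U x))) := by
  have hG : Measurable fun q : (ℕ → Plane) × (ℕ → M) => expNeg (∑' i, F (q.1 i) (q.2 i)) := by
    refine measurable_expNeg.comp (Measurable.tsum fun i => ?_)
    have hi : Measurable fun q : (ℕ → Plane) × (ℕ → M) => (q.1 i, q.2 i) :=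
      ((measurable_pi_apply i).comp measurable_fst).prodMk
        ((measurable_pi_apply i).comp measurable_snd)
    exact hF.comp hi
  have h1 := h.lintegral_eq hG
  simp only at h1
  rw [h1, ← h.poisson.lintegral_expNeg_tsum hlam hUm]
  exact lintegral_congr fun ω => lintegral_expNeg_tsum_infinitePi
    (fun i => hF.comp measurable_prodMk_left) fun i => hU _

end MarkedPoisson

/-! ### Exponentially distributed gains and random directions -/

lemma expMeasure_eq (μ : ℝ) : expMeasure μ = volume.withDensity (exponentialPDF μ) := by
  rfl

lemma measurable_exponentialPDF (μ : ℝ) : Measurable (exponentialPDF μ) :=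
  (measurable_exponentialPDFReal μ).ennreal_ofReal

lemma lintegral_expNeg_mul_expMeasure {μ t : ℝ} (hμ : 0 < μ) (ht : 0 ≤ t) :
    ∫⁻ g, expNeg (ENNReal.ofReal (g * t)) ∂(expMeasure μ) = ENNReal.ofReal (μ / (μ + t)) := by
  have hm : Measurable fun g : ℝ => expNeg (ENNReal.ofReal (g * t)) :=
    measurable_expNeg.comp (by fun_prop)
  rw [expMeasure_eq, lintegral_withDensity_eq_lintegral_mul _ (measurable_exponentialPDF μ) hm]
  have h : ∀ g, (exponentialPDF μ * fun g => expNeg (ENNReal.ofReal (g * t))) g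
      = ENNReal.ofReal (μ / (μ + t)) * exponentialPDF (μ + t) g := by
    intro g
    simp only [Pi.mul_apply]
    rcases lt_or_ge g 0 with hg | hg
    · rw [exponentialPDF_of_neg hg, exponentialPDF_of_neg hg, zero_mul, mul_zero]
    · rw [exponentialPDF_of_nonneg hg, exponentialPDF_of_nonneg hg,
        expNeg_ofReal (mul_nonneg hg ht), ← ENNReal.ofReal_mul (by positivity),
        ← ENNReal.ofReal_mul (by positivity)]
      congr 1
      rw [mul_assoc, ← Real.exp_add, ← mul_assoc, div_mul_cancel₀ _ (by positivity)]
      ring_nf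
  simp_rw [h]
  rw [lintegral_const_mul _ (measurable_exponentialPDF _),
    lintegral_exponentialPDF_eq_one (by positivity), mul_one]

lemma expMeasure_setOf_le {μ : ℝ} (hμ : 0 < μ) (c : ℝ≥0∞) :
    expMeasure μ {g | c ≤ ENNReal.ofReal g} = expNeg (ENNReal.ofReal μ * c) := by
  have := isProbabilityMeasure_expMeasure hμ
  rcases eq_or_ne c ⊤ with rfl | hc
  · simp [ENNReal.mul_top, hμ]
  lift c to ℝ≥0 using hc
  rcases eq_or_ne c 0 with rfl | hc0
  · simp
  have hcpos : 0 < (c : ℝ) := by exact_mod_cast pos_iff_ne_zero.2 hc0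
  have hset : {g : ℝ | (c : ℝ≥0∞) ≤ ENNReal.ofReal g} = (Iio (c : ℝ))ᶜ := by
    ext g
    simp only [mem_ofPred_eq, mem_compl_iff, mem_Iio, not_lt]
    rw [← ENNReal.ofReal_coe_nnreal, ENNReal.ofReal_le_ofReal_iff']
    exact ⟨fun h => h.resolve_right (by simpa using pos_iff_ne_zero.2 hc0), Or.inl⟩
  have hna : NullSingletonClass (expMeasure μ) := by
    rw [expMeasure_eq]
    exact ⟨fun x => withDensity_absolutelyContinuous _ _ (by simp)⟩
  have hcdf := cdf_expMeasure_eq hμ c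
  rw [if_pos hcpos.le, cdf_eq_real] at hcdf
  rw [hset, prob_compl_eq_one_sub measurableSet_Iio, measure_congr Iio_ae_eq_Iic,
    ← ofReal_measureReal, hcdf, ← ENNReal.ofReal_one, ← ENNReal.ofReal_sub _ (by
      simp; positivity), ← ENNReal.ofReal_coe_nnreal, ← ENNReal.ofReal_mul hμ.le,
    expNeg_ofReal (by positivity)]
  congr 1
  ring

lemma lintegral_ofReal_expMeasure_ne_top {μ : ℝ} (hμ : 0 < μ) :
    ∫⁻ g, ENNReal.ofReal g ∂(expMeasure μ) ≠ ⊤ := by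
  rw [expMeasure_eq, lintegral_withDensity_eq_lintegral_mul _ (measurable_exponentialPDF μ)
    ENNReal.measurable_ofReal]
  have h : ∀ g, (exponentialPDF μ * ENNReal.ofReal) g
      ≤ ENNReal.ofReal (4 / μ) * exponentialPDF (μ / 2) g := by
    intro g
    simp only [Pi.mul_apply]
    rcases lt_or_ge g 0 with hg | hg
    · simp [exponentialPDF_of_neg hg]
    · rw [exponentialPDF_of_nonneg hg, exponentialPDF_of_nonneg hg,
        ← ENNReal.ofReal_mul (by positivity), ← ENNReal.ofReal_mul (by positivity)]
      refine ENNReal.ofReal_le_ofReal ?_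
      have h1 : μ / 2 * g ≤ Real.exp (μ / 2 * g) := by
        linarith [Real.add_one_le_exp (μ / 2 * g)]
      have h2 : Real.exp (-(μ * g)) = Real.exp (-(μ / 2 * g)) * Real.exp (-(μ / 2 * g)) := by
        rw [← Real.exp_add]; ring_nf
      have h3 : Real.exp (μ / 2 * g) * Real.exp (-(μ / 2 * g)) = 1 := by
        rw [← Real.exp_add]; simp
      calc μ * Real.exp (-(μ * g)) * g
          = 2 * (μ / 2 * g) * Real.exp (-(μ / 2 * g)) * Real.exp (-(μ / 2 * g)) := by
            rw [h2]; ring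
        _ ≤ 2 * Real.exp (μ / 2 * g) * Real.exp (-(μ / 2 * g)) * Real.exp (-(μ / 2 * g)) := by
            gcongr
        _ = 4 / μ * (μ / 2 * Real.exp (-(μ / 2 * g))) := by
            rw [mul_assoc 2, h3]; field_simp; ring
  refine ne_top_of_le_ne_top ?_ (lintegral_mono h)
  rw [lintegral_const_mul _ (measurable_exponentialPDF _),
    lintegral_exponentialPDF_eq_one (by positivity), mul_one]
  exact ENNReal.ofReal_ne_top

/-! ### Radial integrals -/

lemma lintegral_fun_norm_plane {f : ℝ → ℝ} (hf0 : ∀ y, 0 ≤ y → 0 ≤ f y)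
    (hf : IntegrableOn (fun y => y * f y) (Ioi 0)) :
    ∫⁻ x : Plane, ENNReal.ofReal (f ‖x‖) = ENNReal.ofReal (2 * π * ∫ y in Ioi (0 : ℝ), y * f y) := by
  have hi : Integrable (fun x : Plane => f ‖x‖) := by
    rw [integrable_fun_norm_addHaar]
    simpa using hf
  rw [← ofReal_integral_eq_lintegral_ofReal hi (ae_of_all _ fun x => hf0 _ (norm_nonneg x)),
    integral_fun_norm_addHaar]
  congr 1
  have hv : (volume : Measure Plane).real (Metric.ball 0 1) = π := by
    rw [Measure.real, EuclideanSpace.volume_ball_fin_two]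
    simp [Real.pi_nonneg]
  rw [hv]
  simp
  ring

lemma div_one_add_nonneg {w : ℝ} (hw : 0 ≤ w) : 0 ≤ w / (1 + w) := by positivity

lemma div_one_add_le_one {w : ℝ} (hw : 0 ≤ w) : w / (1 + w) ≤ 1 := by
  rw [div_le_one (by positivity)]; linarith

lemma div_one_add_le {w : ℝ} (hw : 0 ≤ w) : w / (1 + w) ≤ w :=
  div_le_self hw (by linarith)

lemma integrandMS_eq (β α PB PM r : ℝ) :
    integrandMS β α PB PM r = integrandBS (β * (PM / PB)) α r := rfl

lemma integrandBS_nonneg {c α r x : ℝ} (hc : 0 ≤ c) (hr : 0 ≤ r) (hx : 0 ≤ x) :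
    0 ≤ integrandBS c α r x := by
  unfold integrandBS
  positivity

lemma measurable_integrandBS (c α r : ℝ) : Measurable (integrandBS c α r) := by
  unfold integrandBS
  fun_prop

lemma integrableOn_integrandBS {c α r : ℝ} (hc : 0 ≤ c) (hα : 2 < α) (hr : 0 ≤ r) :
    IntegrableOn (integrandBS c α r) (Ioi 0) := by
  have hm := (measurable_integrandBS c α r).aestronglyMeasurable (μ := volume)
  rw [← Ioc_union_Ioi_eq_Ioi (zero_le_one (α := ℝ))]
  refine IntegrableOn.union ?_ ?_
  · refine Measure.integrableOn_of_bounded (M := 1) (by simp) hm ?_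
    refine (ae_restrict_iff' measurableSet_Ioc).2 (ae_of_all _ fun y hy => ?_)
    rw [Real.norm_of_nonneg (integrandBS_nonneg hc hr hy.1.le)]
    have hp : 0 ≤ r / y := div_nonneg hr hy.1.le
    have hw : 0 ≤ c * (r / y) ^ α := by positivity
    exact mul_le_one₀ (div_one_add_le_one hw) hy.1.le hy.2
  · have hi : IntegrableOn (fun y : ℝ => c * r ^ α * y ^ (1 - α)) (Ioi 1) :=
      (integrableOn_Ioi_rpow_of_lt (by linarith) zero_lt_one).const_mul _
    refine Integrable.mono' hi hm.restrict ?_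
    refine (ae_restrict_iff' measurableSet_Ioi).2 (ae_of_all _ fun y (hy : 1 < y) => ?_)
    have hy0 : 0 < y := by linarith
    rw [Real.norm_of_nonneg (integrandBS_nonneg hc hr hy0.le)]
    have hw : 0 ≤ c * (r / y) ^ α := by positivity
    calc integrandBS c α r y ≤ c * (r / y) ^ α * y :=
          mul_le_mul_of_nonneg_right (div_one_add_le hw) hy0.le
      _ = c * r ^ α * y ^ (1 - α) := by
          rw [Real.div_rpow hr hy0.le, Real.rpow_sub hy0, Real.rpow_one]
          ring

/-- Scaling of the exponents: with `a = 1` for the base stations and `a = 0` for the mobile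
stations. -/
lemma integral_integrandBS_eq (c α : ℝ) {r : ℝ} (hr : 0 < r) (a : ℝ) :
    ∫ x in Ioi (r * a), integrandBS c α r x = (∫ x in Ioi a, integrandBS c α 1 x) * r ^ 2 := by
  have h := integral_comp_mul_left_Ioi (integrandBS c α r) a hr
  have h1 : ∀ t, integrandBS c α r (r * t) = r * integrandBS c α 1 t := by
    intro t
    unfold integrandBS
    have : r / (r * t) = 1 / t := by field_simp
    rw [this]
    ring
  simp_rw [h1] at h
  rw [integral_const_mul, smul_eq_mul] at h
  have h2 : ∫ x in Ioi (r * a), integrandBS c α r x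
      = r * (r⁻¹ * ∫ x in Ioi (r * a), integrandBS c α r x) := by
    field_simp
  rw [h2, ← h]
  ring

lemma laplaceBS_eq (lamD β α : ℝ) {r : ℝ} (hr : 0 < r) :
    laplaceBS lamD β α r
      = Real.exp (-(2 * π * lamD * ∫ x in Ioi (1 : ℝ), integrandBS β α 1 x) * r ^ 2) := by
  have h := integral_integrandBS_eq β α hr 1
  rw [mul_one] at h
  rw [laplaceBS, h]
  congr 1
  ring

lemma laplaceMS_eq (lamU β α PB PM : ℝ) {r : ℝ} (hr : 0 < r) :
    laplaceMS lamU β α PB PM r = Real.exp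
      (-(2 * π * lamU * ∫ x in Ioi (0 : ℝ), integrandBS (β * (PM / PB)) α 1 x) * r ^ 2) := by
  have h := integral_integrandBS_eq (β * (PM / PB)) α hr 0
  rw [mul_zero] at h
  rw [laplaceMS, integrandMS_eq, h]
  congr 1
  ring

lemma integral_integrandBS_nonneg {c α : ℝ} (hc : 0 ≤ c) {a : ℝ} (ha : 0 ≤ a) :
    0 ≤ ∫ x in Ioi a, integrandBS c α 1 x :=
  setIntegral_nonneg measurableSet_Ioi fun _ hx =>
    integrandBS_nonneg hc zero_le_one (ha.trans (le_of_lt hx))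

lemma integrableOn_successIntegrand {lamC lamU lamD μ α PB PM σ β : ℝ} (hlamC : 0 < lamC)
    (hlamU : 0 ≤ lamU) (hlamD : 0 ≤ lamD) (hμ : 0 ≤ μ) (hPB : 0 ≤ PB) (hPM : 0 ≤ PM)
    (hβ : 0 ≤ β) :
    IntegrableOn (successIntegrand lamC lamU lamD μ α PB PM σ β) (Ioi 0) := by
  set KB := 2 * π * lamD * ∫ x in Ioi (1 : ℝ), integrandBS β α 1 x with hKB
  set KM := 2 * π * lamU * ∫ x in Ioi (0 : ℝ), integrandBS (β * (PM / PB)) α 1 x with hKM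
  have hKB0 : 0 ≤ KB := mul_nonneg (by positivity) (integral_integrandBS_nonneg hβ zero_le_one)
  have hKM0 : 0 ≤ KM := mul_nonneg (by positivity)
    (integral_integrandBS_nonneg (by positivity) le_rfl)
  have heq : EqOn (fun r => r * Real.exp (-(π * lamC * r ^ 2) - laplaceArg μ β α PB r * σ ^ 2)
      * Real.exp (-KB * r ^ 2) * Real.exp (-KM * r ^ 2))
      (successIntegrand lamC lamU lamD μ α PB PM σ β) (Ioi 0) := by
    intro r (hr : 0 < r)
    rw [successIntegrand, laplaceBS_eq _ _ _ hr, laplaceMS_eq _ _ _ _ _ hr]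
  refine IntegrableOn.congr_fun ?_ heq measurableSet_Ioi
  have hi : Integrable fun r : ℝ => r * Real.exp (-(π * lamC) * r ^ 2) :=
    integrable_mul_exp_neg_mul_sq (by positivity)
  refine Integrable.mono' hi.integrableOn (Measurable.aestronglyMeasurable ?_) ?_
  · unfold laplaceArg
    fun_prop
  · refine (ae_restrict_iff' measurableSet_Ioi).2 (ae_of_all _ fun r (hr : 0 < r) => ?_)
    rw [Real.norm_of_nonneg (by positivity), mul_assoc, mul_assoc, ← Real.exp_add, ← Real.exp_add]
    have hs : 0 ≤ laplaceArg μ β α PB r := by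
      unfold laplaceArg
      positivity
    gcongr
    nlinarith [mul_nonneg hKB0 (sq_nonneg r), mul_nonneg hKM0 (sq_nonneg r),
      mul_nonneg hs (sq_nonneg σ)]

/-! ### The law of the nearest distance -/

section Poisson

variable {Ω : Type*} [MeasurableSpace Ω] {P : Measure Ω} [IsProbabilityMeasure P]
  {X : ℕ → Ω → Plane} {lam : ℝ}

lemma lintegral_Ioi_rayleigh {lam a : ℝ} (hlam : 0 < lam) (ha : 0 ≤ a) :
    ∫⁻ r in Ioi a, ENNReal.ofReal (2 * π * lam * r * Real.exp (-(π * lam * r ^ 2)))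
      = ENNReal.ofReal (Real.exp (-(π * lam * a ^ 2))) := by
  have hd : ∀ r ∈ Ici a, HasDerivAt (fun r => -Real.exp (-(π * lam * r ^ 2)))
      (2 * π * lam * r * Real.exp (-(π * lam * r ^ 2))) r := by
    intro r _
    have h1 : HasDerivAt (fun r : ℝ => -(π * lam * r ^ 2)) (-(π * lam * (2 * r))) r := by
      simpa using ((hasDerivAt_pow 2 r).const_mul (π * lam)).fun_neg
    refine h1.exp.neg.congr_deriv ?_
    ring
  have hlim : Tendsto (fun r : ℝ => -Real.exp (-(π * lam * r ^ 2))) atTop (𝓝 0) := by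
    have h1 : Tendsto (fun r : ℝ => π * lam * r ^ 2) atTop atTop :=
      (tendsto_pow_atTop two_ne_zero).const_mul_atTop (by positivity)
    simpa using (Real.tendsto_exp_neg_atTop_nhds_zero.comp h1).neg
  have hnn : ∀ r ∈ Ioi a, 0 ≤ 2 * π * lam * r * Real.exp (-(π * lam * r ^ 2)) := by
    intro r (hr : a < r)
    have : 0 < r := ha.trans_lt hr
    positivity
  have hi := integrableOn_Ioi_deriv_of_nonneg' hd hnn hlim
  rw [← ofReal_integral_eq_lintegral_ofReal hi ((ae_restrict_iff' measurableSet_Ioi).2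
    (ae_of_all _ hnn)), integral_Ioi_of_hasDerivAt_of_nonneg' hd hnn hlim]
  simp

/-- The nearest distance has the Rayleigh density `2 π lam r exp (-π lam r ^ 2)`. -/
theorem IsPoissonProcess.lintegral_nearestDist (hX : IsPoissonProcess P X lam) (hlam : 0 < lam)
    {h : ℝ → ℝ≥0∞} (hh : Measurable h) :
    ∫⁻ ω, h (nearestDist fun i => X i ω) ∂P = ∫⁻ r in Ioi (0 : ℝ),
      ENNReal.ofReal (2 * π * lam * r * Real.exp (-(π * lam * r ^ 2))) * h r := by
  set ρ : ℝ → ℝ≥0∞ :=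
    fun r => ENNReal.ofReal (2 * π * lam * r * Real.exp (-(π * lam * r ^ 2))) with hρ
  have hρm : Measurable ρ := by fun_prop
  have hR := hX.measurable_nearestDist
  have := Measure.isProbabilityMeasure_map (μ := P) hR.aemeasurable
  have hmap : P.map (fun ω => nearestDist fun i => X i ω)
      = (volume.restrict (Ioi 0)).withDensity ρ := by
    refine Measure.ext_of_Ici _ _ fun a => ?_
    rw [Measure.map_apply hR measurableSet_Ici, withDensity_apply _ measurableSet_Ici,
      Measure.restrict_restrict measurableSet_Ici]
    have h1 := hX.measure_le_nearestDist hlam.le a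
    change P {ω | a ≤ nearestDist fun i => X i ω} = _
    rw [h1, EuclideanSpace.volume_ball_fin_two]
    rcases le_or_gt a 0 with ha | ha
    · have h2 : Ici a ∩ Ioi (0 : ℝ) = Ioi 0 := inter_eq_right.2 fun x hx => ha.trans (le_of_lt hx)
      rw [h2, lintegral_Ioi_rayleigh hlam le_rfl, ENNReal.ofReal_of_nonpos ha]
      simp
    · have h2 : Ici a ∩ Ioi (0 : ℝ) = Ici a := inter_eq_left.2 fun x hx => ha.trans_le hx
      rw [h2, setLIntegral_congr Ioi_ae_eq_Ici.symm, lintegral_Ioi_rayleigh hlam ha.le,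
        ← expNeg_ofReal (by positivity), ← ENNReal.ofReal_pow ha.le]
      rw [← ENNReal.ofReal_mul (by positivity), ← ENNReal.ofReal_mul (by positivity)]
      congr 2
      ring
  rw [← lintegral_map hh hR, hmap, lintegral_withDensity_eq_lintegral_mul _ hρm hh]
  rfl

end Poisson

/-! ### The log-Laplace transform of a single interference term -/

/-- Minus the logarithm of the Laplace transform of an exponentially distributed gain that counts
with probability `p`, where `w` is the quotient of the argument by the rate. -/
noncomputable def logLoss (p w : ℝ) : ℝ := Real.log ((1 + w) / (1 + (1 - p) * w))

lemma one_add_one_sub_mul_pos {p w : ℝ} (hp : p ≤ 1) (hw : 0 ≤ w) : 0 < 1 + (1 - p) * w := by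
  have := mul_nonneg (sub_nonneg.2 hp) hw
  linarith

lemma logLoss_nonneg {p w : ℝ} (hp0 : 0 ≤ p) (hp : p ≤ 1) (hw : 0 ≤ w) : 0 ≤ logLoss p w := by
  refine Real.log_nonneg ?_
  rw [one_le_div (one_add_one_sub_mul_pos hp hw)]
  nlinarith [mul_nonneg hp0 hw]

lemma logLoss_le {p w : ℝ} (hp : p ≤ 1) (hw : 0 ≤ w) : logLoss p w ≤ w := by
  have hpos := one_add_one_sub_mul_pos hp hw
  have h1 : (1 + w) / (1 + (1 - p) * w) ≤ 1 + w := by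
    refine div_le_self (by linarith) ?_
    linarith [mul_nonneg (sub_nonneg.2 hp) hw]
  refine (Real.log_le_sub_one_of_pos (by positivity)).trans ?_
  linarith

lemma expNeg_logLoss {p w : ℝ} (hp0 : 0 ≤ p) (hp : p ≤ 1) (hw : 0 ≤ w) :
    expNeg (ENNReal.ofReal (logLoss p w)) = ENNReal.ofReal (1 - p * (w / (1 + w))) := by
  have hpos := one_add_one_sub_mul_pos hp hw
  rw [expNeg_ofReal (logLoss_nonneg hp0 hp hw), logLoss, Real.exp_neg,
    Real.exp_log (by positivity)]
  congr 1
  field_simp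
  ring

lemma one_sub_expNeg_logLoss {p w : ℝ} (hp0 : 0 ≤ p) (hp : p ≤ 1) (hw : 0 ≤ w) :
    1 - expNeg (ENNReal.ofReal (logLoss p w)) = ENNReal.ofReal (p * (w / (1 + w))) := by
  have h1 : p * (w / (1 + w)) ≤ 1 :=
    mul_le_one₀ hp (div_one_add_nonneg hw) (div_one_add_le_one hw)
  rw [expNeg_logLoss hp0 hp hw, ← ENNReal.ofReal_one, ← ENNReal.ofReal_sub _ (by linarith)]
  congr 1
  ring

/-- The exponent of the Laplace functional of the interference, in polar coordinates. The case
`a = 0` is that of the mobile stations, which interfere at every distance. -/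
lemma lintegral_one_sub_expNeg_logLoss {p c α r a : ℝ} (hp0 : 0 ≤ p) (hp : p ≤ 1) (hc : 0 ≤ c)
    (hα : 2 < α) (hr : 0 ≤ r) (ha : 0 ≤ a) :
    ∫⁻ x : Plane, (if a ≤ ‖x‖ then
        1 - expNeg (ENNReal.ofReal (logLoss p (c * (r / ‖x‖) ^ α))) else 0)
      = ENNReal.ofReal (2 * π * p * ∫ y in Ioi a, integrandBS c α r y) := by
  set f : ℝ → ℝ := (Ici a).indicator
    fun y => p * (c * (r / y) ^ α / (1 + c * (r / y) ^ α)) with hf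
  have hw : ∀ y, 0 ≤ y → 0 ≤ c * (r / y) ^ α := fun y hy => by positivity
  have h1 : ∀ x : Plane, (if a ≤ ‖x‖ then
        1 - expNeg (ENNReal.ofReal (logLoss p (c * (r / ‖x‖) ^ α))) else 0)
      = ENNReal.ofReal (f ‖x‖) := by
    intro x
    by_cases hx : a ≤ ‖x‖
    · rw [if_pos hx, one_sub_expNeg_logLoss hp0 hp (hw _ (norm_nonneg _)), hf,
        indicator_of_mem (mem_Ici.2 hx)]
    · rw [if_neg hx, hf, indicator_of_notMem (fun h => hx (mem_Ici.1 h)), ENNReal.ofReal_zero]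
  have hyf : (fun y => y * f y) = (Ici a).indicator fun y => p * integrandBS c α r y := by
    funext y
    by_cases hy : y ∈ Ici a
    · rw [hf, indicator_of_mem hy, indicator_of_mem hy, integrandBS]
      ring
    · rw [hf, indicator_of_notMem hy, indicator_of_notMem hy, mul_zero]
  have hint : IntegrableOn (fun y => y * f y) (Ioi 0) := by
    rw [hyf]
    exact ((integrableOn_integrandBS hc hα hr).const_mul p).indicator measurableSet_Ici
  have hf0 : ∀ y, 0 ≤ y → 0 ≤ f y := by
    intro y hy
    refine indicator_apply_nonneg fun _ => mul_nonneg hp0 (div_one_add_nonneg (hw y hy))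
  have hset : (Ioi (0 : ℝ) ∩ Ici a : Set ℝ) =ᵐ[volume] (Ioi a : Set ℝ) := by
    have h2 : Ioi (0 : ℝ) ∩ Ioi a = Ioi a := inter_eq_right.2 (Ioi_subset_Ioi ha)
    have h3 := (ae_eq_refl (Ioi (0 : ℝ))).inter (Ioi_ae_eq_Ici (μ := volume) (a := a)).symm
    rwa [h2] at h3
  simp_rw [h1]
  rw [lintegral_fun_norm_plane hf0 hint]
  congr 1
  rw [hyf, setIntegral_indicator measurableSet_Ici, setIntegral_congr_set hset, integral_const_mul]
  ring

/-! ### Marks consisting of a direction and a gain -/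

/-- The power received from a node of mark `q` by the interference in direction `d`, where `a` is
the transmission power times the path loss. -/
noncomputable def markTerm (d : Direction) (a : ℝ) (q : Direction × ℝ) : ℝ≥0∞ :=
  (Prod.fst ⁻¹' {d}).indicator (fun q => ENNReal.ofReal (q.2 * a)) q

lemma measurableSet_fst_preimage (d : Direction) :
    MeasurableSet (Prod.fst ⁻¹' {d} : Set (Direction × ℝ)) :=
  measurable_fst (MeasurableSpace.measurableSet_top (s := {d}))

lemma measurable_uncurry_markTerm (d : Direction) :
    Measurable (Function.uncurry (markTerm d)) := by
  have : Function.uncurry (markTerm d) = (Prod.snd ⁻¹' (Prod.fst ⁻¹' {d})).indicator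
      fun z : ℝ × Direction × ℝ => ENNReal.ofReal (z.2.2 * z.1) := by
    funext z
    rfl
  rw [this]
  refine Measurable.indicator ?_ (measurable_snd (measurableSet_fst_preimage d))
  fun_prop

lemma measurable_markTerm (d : Direction) (a : ℝ) : Measurable (markTerm d a) :=
  (measurable_uncurry_markTerm d).comp measurable_prodMk_left

section Direction

variable {δ : Measure Direction} [IsProbabilityMeasure δ] {d : Direction} {μ p : ℝ}

/-- Integral over a direction and a gain of a function that depends on the gain only in the
direction `d`. -/
lemma lintegral_indicator_fst {ρ : Measure ℝ} [IsProbabilityMeasure ρ] {f : ℝ → ℝ≥0∞}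
    (hf : Measurable f) :
    ∫⁻ q, (Prod.fst ⁻¹' {d}).indicator (fun q => f q.2) q ∂(δ.prod ρ) = δ {d} * ∫⁻ g, f g ∂ρ := by
  rw [lintegral_indicator (measurableSet_fst_preimage d), ← prod_univ, ← Measure.prod_restrict,
    lintegral_prod (fun q : Direction × ℝ => f q.2) (hf.comp measurable_snd).aemeasurable]
  simp [mul_comm]

/-- A gain of law `Exp(μ)` counts with probability `p` only, so that its Laplace transform is
`1 - p + p * μ / (μ + s * a)`. -/
lemma lintegral_expNeg_markTerm (hμ : 0 < μ) (hp0 : 0 ≤ p) (hp : p ≤ 1)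
    (hd : δ {d} = ENNReal.ofReal p) {s a : ℝ} (hs : 0 ≤ s) (ha : 0 ≤ a) :
    ∫⁻ q, expNeg (ENNReal.ofReal s * markTerm d a q) ∂(δ.prod (expMeasure μ))
      = expNeg (ENNReal.ofReal (logLoss p (s * a / μ))) := by
  have := isProbabilityMeasure_expMeasure hμ
  have hsplit : ∀ q : Direction × ℝ, expNeg (ENNReal.ofReal s * markTerm d a q)
      = (Prod.fst ⁻¹' {d}).indicator (fun q => expNeg (ENNReal.ofReal (q.2 * (s * a)))) q
        + (Prod.fst ⁻¹' {d})ᶜ.indicator (fun _ => 1) q := by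
    intro q
    by_cases hq : q ∈ (Prod.fst ⁻¹' {d} : Set (Direction × ℝ))
    · rw [markTerm, indicator_of_mem hq, indicator_of_mem hq,
        indicator_of_notMem (by simpa using hq), add_zero, ← ENNReal.ofReal_mul hs]
      congr 2
      ring
    · rw [markTerm, indicator_of_notMem hq, indicator_of_notMem hq, indicator_of_mem hq]
      simp
  have hm : Measurable fun g : ℝ => expNeg (ENNReal.ofReal (g * (s * a))) :=
    measurable_expNeg.comp (by fun_prop)
  have hmp : (δ.prod (expMeasure μ)) (Prod.fst ⁻¹' {d}) = ENNReal.ofReal p := by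
    rw [← prod_univ, Measure.prod_prod, measure_univ, mul_one, hd]
  have hmi : Measurable fun q : Direction × ℝ => (Prod.fst ⁻¹' {d}).indicator
      (fun q => expNeg (ENNReal.ofReal (q.2 * (s * a)))) q :=
    (hm.comp measurable_snd).indicator (measurableSet_fst_preimage d)
  simp_rw [hsplit]
  rw [lintegral_add_left hmi,
    lintegral_indicator_fst hm, lintegral_expNeg_mul_expMeasure hμ (by positivity), hd,
    lintegral_indicator_const (measurableSet_fst_preimage d).compl, one_mul,
    prob_compl_eq_one_sub (measurableSet_fst_preimage d), hmp,
    expNeg_logLoss hp0 hp (by positivity), ← ENNReal.ofReal_one, ← ENNReal.ofReal_sub _ hp0,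
    ← ENNReal.ofReal_mul hp0, ← ENNReal.ofReal_add (by positivity) (by linarith)]
  congr 1
  field_simp
  ring

lemma lintegral_ofReal_snd_ne_top (hμ : 0 < μ) :
    ∫⁻ q : Direction × ℝ, ENNReal.ofReal q.2 ∂(δ.prod (expMeasure μ)) ≠ ⊤ := by
  have := isProbabilityMeasure_expMeasure hμ
  rw [lintegral_prod _ (by fun_prop)]
  simpa using lintegral_ofReal_expMeasure_ne_top hμ

end Direction

lemma isProbabilityMeasure_directionLaw {lamU lamD : ℝ} (hU : 0 ≤ lamU) (hD : 0 < lamD) :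
    IsProbabilityMeasure (directionLaw lamU lamD) := by
  constructor
  simp only [directionLaw, Measure.coe_add, Measure.coe_smul, Pi.add_apply, Pi.smul_apply,
    measure_univ, smul_eq_mul, mul_one]
  rw [← ENNReal.ofReal_add (by positivity) (by positivity), ← add_div, div_self (by positivity),
    ENNReal.ofReal_one]

lemma directionLaw_downlink (lamU lamD : ℝ) :
    directionLaw lamU lamD {Direction.downlink} = ENNReal.ofReal (lamD / (lamU + lamD)) := by
  simp [directionLaw]

lemma directionLaw_uplink (lamU lamD : ℝ) :
    directionLaw lamU lamD {Direction.uplink} = ENNReal.ofReal (lamU / (lamU + lamD)) := by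
  simp [directionLaw]

/-! ### The interference for fixed locations -/

/-- Interference of the downlink base stations other than the nearest one, as a function of the
locations and marks. -/
noncomputable def bsInterference (α PB : ℝ) (x : ℕ → Plane) (z : ℕ → Direction × ℝ) : ℝ≥0∞ :=
  ∑' i, if i ≠ nearestIdx x then markTerm Direction.downlink (‖x i‖ ^ (-α) * PB) (z i) else 0

/-- Interference of the uplink mobile stations, as a function of the locations and marks. -/
noncomputable def msInterference (α PM : ℝ) (y : ℕ → Plane) (z : ℕ → Direction × ℝ) : ℝ≥0∞ :=
  ∑' j, markTerm Direction.uplink (‖y j‖ ^ (-α) * PM) (z j)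

lemma measurable_markTerm_norm (d : Direction) (α c : ℝ) (i : ℕ) :
    Measurable fun q : (ℕ → Plane) × (ℕ → Direction × ℝ) =>
      markTerm d (‖q.1 i‖ ^ (-α) * c) (q.2 i) := by
  have h : Measurable fun q : (ℕ → Plane) × (ℕ → Direction × ℝ) => (‖q.1 i‖ ^ (-α) * c, q.2 i) := by
    fun_prop
  exact (measurable_uncurry_markTerm d).comp h

lemma measurable_bsInterference (α PB : ℝ) :
    Measurable (Function.uncurry (bsInterference α PB)) := by
  refine Measurable.tsum fun i => Measurable.ite ?_ (measurable_markTerm_norm _ _ _ i)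
    measurable_const
  exact ((measurable_nearestIdx.comp measurable_fst) (measurableSet_singleton i).compl).congr
    (by ext; simp [eq_comm])

lemma measurable_msInterference (α PM : ℝ) :
    Measurable (Function.uncurry (msInterference α PM)) :=
  Measurable.tsum fun i => measurable_markTerm_norm _ _ _ i

/-- Minus the logarithm of the Laplace transform of the interference of a base station at distance
`ρ`, which is a downlink one with probability `p`, when the serving distance is `r`. -/
noncomputable def bsLoss (β α p r ρ : ℝ) : ℝ≥0∞ := ENNReal.ofReal (logLoss p (β * (r / ρ) ^ α))

lemma measurable_uncurry_bsLoss (β α p : ℝ) : Measurable (Function.uncurry (bsLoss β α p)) := by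
  unfold bsLoss logLoss Function.uncurry
  fun_prop

lemma tendsto_bsLoss {β α p r ρ : ℝ} (hβ : 0 ≤ β) (hp : p ≤ 1) (hr : 0 < r) (hρ : 0 < ρ) :
    Tendsto (fun b => bsLoss β α p b ρ) (𝓝[>] r) (𝓝 (bsLoss β α p r ρ)) := by
  have hw : ContinuousAt (fun b : ℝ => β * (b / ρ) ^ α) r :=
    ((continuousAt_id.div_const ρ).rpow_const (Or.inl (by positivity))).const_mul β
  have hw0 : 0 ≤ β * (r / ρ) ^ α := by positivity
  have hpos := one_add_one_sub_mul_pos hp hw0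
  have h : ContinuousAt (fun b => logLoss p (β * (b / ρ) ^ α)) r := by
    unfold logLoss
    refine ContinuousAt.log ?_ (by positivity)
    exact (continuousAt_const.add hw).div (continuousAt_const.add (continuousAt_const.mul hw))
      hpos.ne'
  exact (ENNReal.tendsto_ofReal h.tendsto).mono_left nhdsWithin_le_nhds

lemma bsLoss_le {β α p r ρ : ℝ} (hβ : 0 ≤ β) (hp : p ≤ 1) (hr : 0 < r) (hρ : 0 < ρ) :
    bsLoss β α p r ρ ≤ ENNReal.ofReal (β * (r / ρ) ^ α) :=
  ENNReal.ofReal_le_ofReal (logLoss_le hp (by positivity))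

lemma laplaceArg_nonneg {μ β α PB r : ℝ} (hμ : 0 ≤ μ) (hβ : 0 ≤ β) (hPB : 0 ≤ PB) (hr : 0 ≤ r) :
    0 ≤ laplaceArg μ β α PB r := by
  unfold laplaceArg
  positivity

lemma laplaceArg_mul_div {μ β α PB PM r ρ : ℝ} (hμ : 0 < μ) (hPB : 0 < PB) (hr : 0 ≤ r)
    (hρ : 0 ≤ ρ) : laplaceArg μ β α PB r * (ρ ^ (-α) * PM) / μ = β * (PM / PB) * (r / ρ) ^ α := by
  rw [laplaceArg, Real.rpow_neg hρ, Real.div_rpow hr hρ]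
  field_simp

section FixedLocations

variable {δ : Measure Direction} [IsProbabilityMeasure δ] {μ p β α PB : ℝ}

/-- Integrating out the marks: the mark of the serving base station is independent of the
interference of the other ones. -/
lemma lintegral_eval_bsInterference (x : ℕ → Plane) [IsProbabilityMeasure (expMeasure μ)]
    {H : (Direction × ℝ) × ℝ≥0∞ → ℝ≥0∞} (hH : Measurable H) :
    ∫⁻ z, H (z (nearestIdx x), bsInterference α PB x z)
        ∂(Measure.infinitePi fun _ : ℕ => δ.prod (expMeasure μ))
      = ∫⁻ z, ∫⁻ q, H (q, bsInterference α PB x z) ∂(δ.prod (expMeasure μ))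
        ∂(Measure.infinitePi fun _ : ℕ => δ.prod (expMeasure μ)) :=
  lintegral_eval_tsum_ne_infinitePi (nearestIdx x)
    (F := fun i => markTerm Direction.downlink (‖x i‖ ^ (-α) * PB))
    (fun _ => measurable_markTerm _ _) hH

/-- With the locations fixed, the interference of the base stations is a sum of independent terms,
and its Laplace transform is the product of their Laplace transforms. -/
lemma lintegral_expNeg_bsInterference (x : ℕ → Plane) (hμ : 0 < μ) (hp0 : 0 ≤ p) (hp : p ≤ 1)
    (hd : δ {Direction.downlink} = ENNReal.ofReal p) (hβ : 0 ≤ β) (hPB : 0 < PB) :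
    ∫⁻ z, expNeg (ENNReal.ofReal (laplaceArg μ β α PB (nearestDist x)) * bsInterference α PB x z)
        ∂(Measure.infinitePi fun _ : ℕ => δ.prod (expMeasure μ))
      = expNeg (otherSum (bsLoss β α p) x) := by
  have := isProbabilityMeasure_expMeasure hμ
  have hR : 0 ≤ nearestDist x := norm_nonneg _
  have hs := laplaceArg_nonneg (α := α) hμ.le hβ hPB.le hR
  simp only [bsInterference, ← ENNReal.tsum_mul_left, otherSum]
  refine lintegral_expNeg_tsum_infinitePi (F := fun i q =>
    ENNReal.ofReal (laplaceArg μ β α PB (nearestDist x)) *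
      if i ≠ nearestIdx x then markTerm Direction.downlink (‖x i‖ ^ (-α) * PB) q else 0)
    (fun i => ?_) (fun i => ?_)
  · refine Measurable.const_mul ?_ _
    split_ifs
    · exact measurable_markTerm _ _
    · exact measurable_const
  · split_ifs with hi
    · rw [lintegral_expNeg_markTerm hμ hp0 hp hd hs (by positivity),
        laplaceArg_mul_div hμ hPB hR (norm_nonneg _), div_self hPB.ne', mul_one, bsLoss]
    · simp

/-- The serving base station is a downlink one and its signal exceeds `β` times the interference
plus `c`: integrating out its exponential gain gives an exponential function of the interference,
hence its Laplace transform. -/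
lemma measure_success_of_locations (x : ℕ → Plane) (hx : 0 < nearestDist x) (hμ : 0 < μ)
    (hp0 : 0 ≤ p) (hp : p ≤ 1) (hd : δ {Direction.downlink} = ENNReal.ofReal p) (hβ : 0 ≤ β)
    (hPB : 0 < PB) (c : ℝ≥0∞) :
    ∫⁻ z, {q : (Direction × ℝ) × ℝ≥0∞ | q.1.1 = Direction.downlink ∧
        ENNReal.ofReal β * (q.2 + c) ≤ ENNReal.ofReal (q.1.2 * nearestDist x ^ (-α) * PB)}.indicator
          1 (z (nearestIdx x), bsInterference α PB x z)
        ∂(Measure.infinitePi fun _ : ℕ => δ.prod (expMeasure μ))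
      = ENNReal.ofReal p * (expNeg (ENNReal.ofReal (laplaceArg μ β α PB (nearestDist x)) * c) *
          expNeg (otherSum (bsLoss β α p) x)) := by
  have := isProbabilityMeasure_expMeasure hμ
  set R := nearestDist x with hRdef
  set t : ℝ := R ^ (-α) * PB with ht
  have htpos : 0 < t := by positivity
  have hst : laplaceArg μ β α PB R = μ * (β / t) := by
    rw [laplaceArg, ht, Real.rpow_neg hx.le]
    field_simp
  have hmS : MeasurableSet {q : (Direction × ℝ) × ℝ≥0∞ | q.1.1 = Direction.downlink ∧
        ENNReal.ofReal β * (q.2 + c) ≤ ENNReal.ofReal (q.1.2 * R ^ (-α) * PB)} := by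
    refine MeasurableSet.inter (measurable_fst (measurableSet_fst_preimage Direction.downlink)) ?_
    have h1 : Measurable fun q : (Direction × ℝ) × ℝ≥0∞ => ENNReal.ofReal β * (q.2 + c) := by
      fun_prop
    have h2 : Measurable fun q : (Direction × ℝ) × ℝ≥0∞ =>
        ENNReal.ofReal (q.1.2 * R ^ (-α) * PB) := by fun_prop
    exact measurableSet_le h1 h2
  have hinner : ∀ y : ℝ≥0∞, ∫⁻ q, {q : (Direction × ℝ) × ℝ≥0∞ | q.1.1 = Direction.downlink ∧
        ENNReal.ofReal β * (q.2 + c) ≤ ENNReal.ofReal (q.1.2 * R ^ (-α) * PB)}.indicator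
          1 (q, y) ∂(δ.prod (expMeasure μ))
      = ENNReal.ofReal p * (expNeg (ENNReal.ofReal (laplaceArg μ β α PB R) * c) *
          expNeg (ENNReal.ofReal (laplaceArg μ β α PB R) * y)) := by
    intro y
    have hm : MeasurableSet {g : ℝ | ENNReal.ofReal (β / t) * (y + c) ≤ ENNReal.ofReal g} :=
      measurableSet_le measurable_const ENNReal.measurable_ofReal
    have hiff : ∀ g : ℝ, ENNReal.ofReal β * (y + c) ≤ ENNReal.ofReal (g * R ^ (-α) * PB)
        ↔ ENNReal.ofReal (β / t) * (y + c) ≤ ENNReal.ofReal g := by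
      intro g
      rw [mul_assoc, ← ht, ENNReal.ofReal_mul' htpos.le, ENNReal.ofReal_div_of_pos htpos,
        ENNReal.div_eq_inv_mul, mul_assoc, ← ENNReal.div_eq_inv_mul,
        ENNReal.div_le_iff (by simpa using htpos) ENNReal.ofReal_ne_top]
    have h1 : ∀ q : Direction × ℝ, {q : (Direction × ℝ) × ℝ≥0∞ | q.1.1 = Direction.downlink ∧
        ENNReal.ofReal β * (q.2 + c) ≤ ENNReal.ofReal (q.1.2 * R ^ (-α) * PB)}.indicator
          (1 : (Direction × ℝ) × ℝ≥0∞ → ℝ≥0∞) (q, y)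
        = (Prod.fst ⁻¹' {Direction.downlink}).indicator (fun q : Direction × ℝ =>
          {g : ℝ | ENNReal.ofReal (β / t) * (y + c) ≤ ENNReal.ofReal g}.indicator 1 q.2) q := by
      intro q
      by_cases h1 : q.1 = Direction.downlink <;>
      by_cases h2 : ENNReal.ofReal (β / t) * (y + c) ≤ ENNReal.ofReal q.2 <;>
      simp [indicator_apply, h1, h2, hiff]
    simp_rw [h1]
    rw [lintegral_indicator_fst (measurable_one.indicator hm), lintegral_indicator_one hm, hd,
      expMeasure_setOf_le hμ, ← mul_assoc, ← ENNReal.ofReal_mul hμ.le, ← hst, mul_add, expNeg_add,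
      mul_comm (expNeg _) (expNeg _)]
  rw [lintegral_eval_bsInterference x (measurable_one.indicator hmS)]
  simp_rw [hinner]
  have hme : Measurable fun z => expNeg (ENNReal.ofReal (laplaceArg μ β α PB R) *
      bsInterference α PB x z) :=
    measurable_expNeg.comp
      (((measurable_bsInterference α PB).comp measurable_prodMk_left).const_mul _)
  rw [lintegral_const_mul _ (hme.const_mul _), lintegral_const_mul _ hme,
    lintegral_expNeg_bsInterference x hμ hp0 hp hd hβ hPB]

end FixedLocations

/-! ### Finiteness of the interference -/

section Finiteness

variable {Ω : Type*} [MeasurableSpace Ω] {P : Measure Ω}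
  {X : ℕ → Ω → Plane} {m : ℕ → Ω → Direction × ℝ} {lam μ : ℝ} {δ : Measure Direction}

lemma IsMarkedPoissonProcess.ae_tsum_gain_ne_top [IsProbabilityMeasure P] [IsProbabilityMeasure δ]
    (hμ : 0 < μ)
    (h : IsMarkedPoissonProcess P X m lam (δ.prod (expMeasure μ))) (hlam : 0 ≤ lam) {α : ℝ}
    (hα : 2 < α) {c : ℝ} (hc : 0 ≤ c) :
    ∀ᵐ ω ∂P, ∑' i, ENNReal.ofReal ((m i ω).2 * (‖X i ω‖ ^ (-α) * c)) ≠ ⊤ := by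
  have := isProbabilityMeasure_expMeasure hμ
  set F : (ℕ → Plane) × (ℕ → Direction × ℝ) → ℝ≥0∞ := fun q =>
    ∑' i, ENNReal.ofReal ((q.2 i).2 * (‖q.1 i‖ ^ (-α) * c)) with hF
  have hFm : Measurable F := by
    refine Measurable.tsum fun i => ?_
    fun_prop
  have hset : MeasurableSet {q | F q = ⊤} := hFm (measurableSet_singleton _)
  have hae : AEMeasurable (fun ω => ((fun i => X i ω), fun i => m i ω)) P :=
    h.poisson.measurable_pi.aemeasurable.prodMk h.aemeasurable_marks
  have h0 : ∫⁻ ω, {q | F q = ⊤}.indicator 1 (fun i => X i ω, fun i => m i ω) ∂P = 0 := by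
    rw [h.lintegral_eq (measurable_one.indicator hset)]
    refine (lintegral_congr_ae ?_).trans lintegral_zero
    filter_upwards [h.poisson.ae_tsum_rpow_ne_top hlam hα] with ω hω
    have hm : ∀ i, Measurable fun z : ℕ → Direction × ℝ =>
        ENNReal.ofReal ((z i).2 * (‖X i ω‖ ^ (-α) * c)) := fun i => by fun_prop
    have hfin : ∫⁻ z, F (fun i => X i ω, z)
        ∂(Measure.infinitePi fun _ : ℕ => δ.prod (expMeasure μ)) ≠ ⊤ := by
      simp only [hF]
      rw [lintegral_tsum fun i => (hm i).aemeasurable]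
      have hi : ∀ i, ∫⁻ z, ENNReal.ofReal ((z i).2 * (‖X i ω‖ ^ (-α) * c))
          ∂(Measure.infinitePi fun _ : ℕ => δ.prod (expMeasure μ))
          = ENNReal.ofReal (‖X i ω‖ ^ (-α)) * (ENNReal.ofReal c *
            ∫⁻ q : Direction × ℝ, ENNReal.ofReal q.2 ∂(δ.prod (expMeasure μ))) := by
        intro i
        rw [lintegral_eval_infinitePi i (f := fun q : Direction × ℝ =>
          ENNReal.ofReal (q.2 * (‖X i ω‖ ^ (-α) * c))) (by fun_prop), ← mul_assoc,
          ← ENNReal.ofReal_mul (by positivity), ← lintegral_const_mul _ (by fun_prop)]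
        refine lintegral_congr fun q => ?_
        rw [ENNReal.ofReal_mul' (by positivity), mul_comm]
      simp_rw [hi]
      rw [ENNReal.tsum_mul_right]
      exact ENNReal.mul_ne_top hω
        (ENNReal.mul_ne_top ENNReal.ofReal_ne_top (lintegral_ofReal_snd_ne_top hμ))
    have hFω : Measurable fun z => F (fun i => X i ω, z) := hFm.comp measurable_prodMk_left
    refine (lintegral_congr_ae ?_).trans lintegral_zero
    filter_upwards [ae_lt_top hFω hfin] with z hz
    exact indicator_of_notMem (s := {q | F q = ⊤}) (fun h => hz.ne h) 1
  have hind : AEMeasurable (fun ω => {q | F q = ⊤}.indicator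
      (1 : (ℕ → Plane) × (ℕ → Direction × ℝ) → ℝ≥0∞) (fun i => X i ω, fun i => m i ω)) P :=
    (measurable_one.indicator hset).comp_aemeasurable hae
  rw [lintegral_eq_zero_iff' hind] at h0
  filter_upwards [h0] with ω hω htop
  rw [Pi.zero_apply, indicator_of_mem (show _ ∈ {q | F q = ⊤} from htop)] at hω
  exact one_ne_zero hω

lemma IsMarkedPoissonProcess.ae_gain_pos [IsProbabilityMeasure δ] (hμ : 0 < μ)
    (h : IsMarkedPoissonProcess P X m lam (δ.prod (expMeasure μ))) :
    ∀ᵐ ω ∂P, ∀ i, 0 < (m i ω).2 := by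
  have := isProbabilityMeasure_expMeasure hμ
  refine ae_all_iff.2 fun i => ?_
  have h0 : expMeasure μ (Iic 0) = 0 := by
    have hcdf := cdf_expMeasure_eq hμ 0
    rw [cdf_eq_real] at hcdf
    simpa [Measure.real, ENNReal.toReal_eq_zero_iff] using hcdf
  have h1 : ∀ᵐ q ∂(δ.prod (expMeasure μ)), 0 < q.2 := by
    rw [ae_iff]
    have : {q : Direction × ℝ | ¬ 0 < q.2} = univ ×ˢ Iic 0 := by ext; simp
    rw [this, Measure.prod_prod, h0, mul_zero]
  rw [← (h.mark_law i).map_eq] at h1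
  exact ae_of_ae_map (h.mark_law i).aemeasurable h1

end Finiteness

/-! ### Conditional expectations given a real variable -/

/-- A conditional Laplace transform is identified by integrating it over the events that the
conditioning variable lies in a Borel set. -/
lemma condExp_exp_neg_mul_eq {Ω : Type*} [MeasurableSpace Ω] {D : Measure Ω}
    [IsProbabilityMeasure D] {R : Ω → ℝ} (hR : Measurable R) {J : Ω → ℝ≥0∞}
    (hJ : AEMeasurable J D) (hJt : ∀ᵐ ω ∂D, J ω < ⊤) {s : ℝ → ℝ} (hs : Measurable s)
    (hs0 : ∀ ω, 0 ≤ s (R ω)) {L : ℝ → ℝ} (hL : Measurable L) (hL0 : ∀ ω, 0 ≤ L (R ω))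
    (hL1 : ∀ ω, L (R ω) ≤ 1)
    (h : ∀ B : Set ℝ, MeasurableSet B →
      ∫⁻ ω, B.indicator 1 (R ω) * expNeg (ENNReal.ofReal (s (R ω)) * J ω) ∂D
        = ∫⁻ ω, B.indicator 1 (R ω) * ENNReal.ofReal (L (R ω)) ∂D) :
    D[fun ω => Real.exp (-(s (R ω) * (J ω).toReal)) | MeasurableSpace.comap R inferInstance]
      =ᵐ[D] fun ω => L (R ω) := by
  have hfm : AEStronglyMeasurable (fun ω => Real.exp (-(s (R ω) * (J ω).toReal))) D :=
    (Real.measurable_exp.comp_aemeasurable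
      ((hs.comp hR).aemeasurable.mul hJ.ennreal_toReal).neg).aestronglyMeasurable
  have hgm : Measurable fun ω => L (R ω) := hL.comp hR
  have hfi : Integrable (fun ω => Real.exp (-(s (R ω) * (J ω).toReal))) D := by
    refine Integrable.of_bound hfm 1 (ae_of_all _ fun ω => ?_)
    rw [Real.norm_of_nonneg (Real.exp_pos _).le, Real.exp_le_one_iff, neg_nonpos]
    exact mul_nonneg (hs0 ω) ENNReal.toReal_nonneg
  have hgi : Integrable (fun ω => L (R ω)) D := by
    refine Integrable.of_bound hgm.aestronglyMeasurable 1 (ae_of_all _ fun ω => ?_)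
    rw [Real.norm_of_nonneg (hL0 _)]
    exact hL1 _
  refine (ae_eq_condExp_of_forall_setIntegral_eq hR.comap_le hfi (fun _ _ _ => hgi.integrableOn)
    (fun A hA _ => ?_) ?_).symm
  · obtain ⟨B, hB, rfl⟩ := hA
    have hAm : MeasurableSet (R ⁻¹' B) := hR hB
    rw [integral_eq_lintegral_of_nonneg_ae (ae_of_all _ fun ω => hL0 _)
      hgm.aestronglyMeasurable.restrict, integral_eq_lintegral_of_nonneg_ae
      (ae_of_all _ fun ω => (Real.exp_pos _).le) hfm.restrict]
    congr 1
    have hB1 : ∀ f : Ω → ℝ≥0∞, ∫⁻ ω in R ⁻¹' B, f ω ∂D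
        = ∫⁻ ω, B.indicator 1 (R ω) * f ω ∂D := by
      intro f
      rw [← lintegral_indicator hAm]
      refine lintegral_congr fun ω => ?_
      by_cases hω : R ω ∈ B <;> simp [hω]
    rw [hB1, ← h B hB, hB1]
    refine lintegral_congr_ae ?_
    filter_upwards [hJt] with ω hω
    rw [expNeg_of_ne_top (ENNReal.mul_ne_top ENNReal.ofReal_ne_top hω.ne), ENNReal.toReal_mul,
      ENNReal.toReal_ofReal (hs0 ω)]
  · have : Measurable[MeasurableSpace.comap R inferInstance] fun ω => L (R ω) :=
      hL.comp (comap_measurable R)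
    exact this.stronglyMeasurable.aestronglyMeasurable

/-! ### The network -/

namespace Network

section Deterministic

variable {Ω : Type*} (N : Network Ω)

/-- Locations and marks of the base stations. -/
def bsConfig (ω : Ω) : (ℕ → Plane) × (ℕ → Direction × ℝ) :=
  (fun i => N.bsPos i ω, fun i => N.bsMark i ω)

/-- Locations and marks of the mobile stations. -/
def msConfig (ω : Ω) : (ℕ → Plane) × (ℕ → Direction × ℝ) :=
  (fun j => N.msPos j ω, fun j => N.msMark j ω)

lemma serving_eq (ω : Ω) : N.serving ω = nearestIdx fun i => N.bsPos i ω := by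
  simp [serving, voronoi, nearestIdx]

lemma servingDist_eq (ω : Ω) : N.servingDist ω = nearestDist fun i => N.bsPos i ω := by
  rw [servingDist, serving_eq, nearestDist]

lemma interferenceBS_eq (α PB : ℝ) (ω : Ω) :
    N.interferenceBS α PB ω = Function.uncurry (bsInterference α PB) (N.bsConfig ω) := by
  refine tsum_congr fun i => ?_
  rw [serving_eq]
  by_cases h1 : i = nearestIdx fun i => N.bsPos i ω <;>
  by_cases h2 : N.bsDir i ω = Direction.downlink <;>
  simp_all [bsConfig, markTerm, bsDir, bsGain, mul_assoc]

lemma interferenceMS_eq (α PM : ℝ) (ω : Ω) :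
    N.interferenceMS α PM ω = Function.uncurry (msInterference α PM) (N.msConfig ω) := by
  refine tsum_congr fun i => ?_
  by_cases h2 : N.msDir i ω = Direction.uplink <;>
  simp_all [msConfig, markTerm, msDir, msGain, mul_assoc]

/-- The configurations of base stations whose nearest member is a downlink base station. -/
def downlinkConfigs : Set ((ℕ → Plane) × (ℕ → Direction × ℝ)) :=
  {b | b.2 (nearestIdx b.1) ∈ Prod.fst ⁻¹' {Direction.downlink}}

lemma measurableSet_downlinkConfigs : MeasurableSet downlinkConfigs :=
  measurable_eval_nearestIdx (measurableSet_fst_preimage _)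

lemma isDownlink_eq : N.isDownlink = N.bsConfig ⁻¹' downlinkConfigs := by
  ext ω
  simp only [isDownlink, bsDir, serving_eq]
  rfl

end Deterministic

section Random

variable {Ω : Type*} [MeasurableSpace Ω] {P : Measure Ω} {N : Network Ω} {lamU lamD μ : ℝ}

lemma IsIndependentPPP.aemeasurable_bsConfig (hN : N.IsIndependentPPP P lamU lamD μ) :
    AEMeasurable N.bsConfig P :=
  hN.bs.poisson.measurable_pi.aemeasurable.prodMk hN.bs.aemeasurable_marks

lemma IsIndependentPPP.aemeasurable_msConfig (hN : N.IsIndependentPPP P lamU lamD μ) :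
    AEMeasurable N.msConfig P :=
  hN.ms.poisson.measurable_pi.aemeasurable.prodMk hN.ms.aemeasurable_marks

lemma IsIndependentPPP.indepFun_config (hN : N.IsIndependentPPP P lamU lamD μ) :
    IndepFun N.bsConfig N.msConfig P := by
  have hm : Measurable fun f : ℕ → Plane × Direction × ℝ =>
      ((fun i => (f i).1), fun i => (f i).2) := by
    fun_prop
  exact hN.bs_indep_ms.comp hm hm

lemma IsIndependentPPP.measurable_servingDist (hN : N.IsIndependentPPP P lamU lamD μ) :
    Measurable N.servingDist := by
  have : N.servingDist = fun ω => nearestDist fun i => N.bsPos i ω := funext N.servingDist_eq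
  rw [this]
  exact hN.bs.poisson.measurable_nearestDist

lemma IsIndependentPPP.nullMeasurableSet_isDownlink (hN : N.IsIndependentPPP P lamU lamD μ) :
    NullMeasurableSet N.isDownlink P := by
  rw [isDownlink_eq]
  exact hN.aemeasurable_bsConfig.nullMeasurableSet_preimage measurableSet_downlinkConfigs

lemma IsIndependentPPP.setLIntegral_isDownlink (hN : N.IsIndependentPPP P lamU lamD μ)
    (f : Ω → ℝ≥0∞) : ∫⁻ ω in N.isDownlink, f ω ∂P
      = ∫⁻ ω, downlinkConfigs.indicator 1 (N.bsConfig ω) * f ω ∂P := by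
  rw [← lintegral_indicator₀ hN.nullMeasurableSet_isDownlink]
  refine lintegral_congr fun ω => ?_
  rw [isDownlink_eq]
  by_cases hω : N.bsConfig ω ∈ downlinkConfigs <;> simp [hω]

variable [IsProbabilityMeasure P]

lemma IsIndependentPPP.ae_servingDist_pos (hN : N.IsIndependentPPP P lamU lamD μ)
    (hlam : 0 ≤ lamU + lamD) : ∀ᵐ ω ∂P, 0 < N.servingDist ω := by
  filter_upwards [hN.bs.poisson.ae_isGoodConfig hlam] with ω hω
  rw [servingDist_eq]
  exact hω.nearestDist_pos

lemma IsIndependentPPP.ae_interference_lt_top (hN : N.IsIndependentPPP P lamU lamD μ)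
    (hU : 0 ≤ lamU) (hD : 0 < lamD) (hμ : 0 < μ) {α PB PM : ℝ} (hα : 2 < α) (hPB : 0 ≤ PB)
    (hPM : 0 ≤ PM) :
    ∀ᵐ ω ∂P, N.interferenceBS α PB ω < ⊤ ∧ N.interferenceMS α PM ω < ⊤ := by
  have := isProbabilityMeasure_directionLaw hU hD
  have hle : ∀ (d : Direction) (a : ℝ) (q : Direction × ℝ),
      markTerm d a q ≤ ENNReal.ofReal (q.2 * a) := fun d a q =>
    indicator_le_self _ (fun q : Direction × ℝ => ENNReal.ofReal (q.2 * a)) q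
  filter_upwards [hN.bs.ae_tsum_gain_ne_top hμ (by positivity) hα hPB,
    hN.ms.ae_tsum_gain_ne_top hμ (by positivity) hα hPM] with ω h1 h2
  rw [interferenceBS_eq, interferenceMS_eq]
  refine ⟨lt_of_le_of_lt (ENNReal.tsum_le_tsum fun i => ?_) h1.lt_top,
    lt_of_le_of_lt (ENNReal.tsum_le_tsum fun i => hle _ _ _) h2.lt_top⟩
  split_ifs
  · exact hle _ _ _
  · exact bot_le

/-- The Laplace transform of the interference from the mobile stations at a fixed argument. -/
lemma IsIndependentPPP.lintegral_expNeg_msInterference (hN : N.IsIndependentPPP P lamU lamD μ)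
    (hU : 0 ≤ lamU) (hD : 0 < lamD) (hμ : 0 < μ) {α β PB PM : ℝ} (hα : 2 < α) (hβ : 0 < β)
    (hPB : 0 < PB) (hPM : 0 < PM) {r : ℝ} (hr : 0 ≤ r) :
    ∫⁻ ω, expNeg (ENNReal.ofReal (laplaceArg μ β α PB r) *
        Function.uncurry (msInterference α PM) (N.msConfig ω)) ∂P
      = ENNReal.ofReal (laplaceMS lamU β α PB PM r) := by
  have := isProbabilityMeasure_directionLaw hU hD
  have := isProbabilityMeasure_expMeasure hμ
  have hs := laplaceArg_nonneg (α := α) hμ.le hβ.le hPB.le hr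
  set p := lamU / (lamU + lamD) with hp
  have hp0 : 0 ≤ p := by positivity
  have hp1 : p ≤ 1 := by rw [hp, div_le_one (by positivity)]; linarith
  have hlp : (lamU + lamD) * p = lamU := by rw [hp]; field_simp
  have hm1 : Measurable fun x : Plane => ENNReal.ofReal (logLoss p
      (β * (PM / PB) * (r / ‖x‖) ^ α)) := by
    unfold logLoss
    fun_prop
  have hF : Measurable (Function.uncurry fun (x : Plane) (q : Direction × ℝ) =>
      ENNReal.ofReal (laplaceArg μ β α PB r) *
        markTerm Direction.uplink (‖x‖ ^ (-α) * PM) q) := by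
    have h : Measurable fun z : Plane × Direction × ℝ => (‖z.1‖ ^ (-α) * PM, z.2) := by fun_prop
    exact ((measurable_uncurry_markTerm Direction.uplink).comp h).const_mul _
  have h1 := hN.ms.lintegral_expNeg_tsum (by positivity) hF hm1 fun x => by
    rw [lintegral_expNeg_markTerm hμ hp0 hp1 (directionLaw_uplink _ _) hs (by positivity),
      laplaceArg_mul_div hμ hPB hr (norm_nonneg _)]
  simp_rw [ENNReal.tsum_mul_left] at h1
  have h2 := lintegral_one_sub_expNeg_logLoss (c := β * (PM / PB)) hp0 hp1 (by positivity) hα hr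
    le_rfl
  simp only [norm_nonneg, if_true] at h2
  have hI : 0 ≤ ∫ y in Ioi (0 : ℝ), integrandBS (β * (PM / PB)) α r y :=
    setIntegral_nonneg measurableSet_Ioi fun y hy =>
      integrandBS_nonneg (by positivity) hr (le_of_lt hy)
  refine h1.trans ?_
  rw [h2, ← ENNReal.ofReal_mul (by positivity), expNeg_ofReal (by positivity), laplaceMS,
    integrandMS_eq]
  congr 2
  linear_combination
    (-(2 * π * ∫ y in Ioi (0 : ℝ), integrandBS (β * (PM / PB)) α r y)) * hlp

/-- The Laplace functional of the base stations beyond `r` is the closed form of the Laplace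
transform of their interference. -/
lemma farLaplace_bsLoss (hU : 0 ≤ lamU) (hD : 0 < lamD) {α β : ℝ} (hα : 2 < α) (hβ : 0 ≤ β)
    {r : ℝ} (hr : 0 ≤ r) :
    farLaplace (lamU + lamD) (bsLoss β α (lamD / (lamU + lamD))) r
      = ENNReal.ofReal (laplaceBS lamD β α r) := by
  set p := lamD / (lamU + lamD) with hp
  have hp0 : 0 ≤ p := by positivity
  have hp1 : p ≤ 1 := by rw [hp, div_le_one (by positivity)]; linarith
  have hlp : (lamU + lamD) * p = lamD := by rw [hp]; field_simp
  have hI : 0 ≤ ∫ y in Ioi r, integrandBS β α r y :=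
    setIntegral_nonneg measurableSet_Ioi fun y hy =>
      integrandBS_nonneg hβ hr (hr.trans (le_of_lt hy))
  simp only [farLaplace, bsLoss]
  rw [lintegral_one_sub_expNeg_logLoss hp0 hp1 hβ hα hr hr, ← ENNReal.ofReal_mul (by positivity),
    expNeg_ofReal (by positivity), laplaceBS]
  congr 2
  linear_combination (-(2 * π * ∫ y in Ioi r, integrandBS β α r y)) * hlp

end Random

end Network

/-! ### The closed forms as functions of the serving distance -/

lemma measurable_laplaceMS (lamU β α PB PM : ℝ) : Measurable (laplaceMS lamU β α PB PM) := by
  have h : Measurable fun q : ℝ × ℝ => integrandMS β α PB PM q.1 q.2 := by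
    unfold integrandMS
    fun_prop
  have h1 : Measurable fun r => ∫ y in Ioi (0 : ℝ), integrandMS β α PB PM r y :=
    h.stronglyMeasurable.integral_prod_right'.measurable
  exact Real.measurable_exp.comp (h1.const_mul _)

lemma measurable_laplaceBS (lamD β α : ℝ) : Measurable (laplaceBS lamD β α) := by
  have h : Measurable fun q : ℝ × ℝ => (Ioi q.1).indicator (integrandBS β α q.1) q.2 := by
    have h0 : Measurable fun q : ℝ × ℝ => integrandBS β α q.1 q.2 := by
      unfold integrandBS
      fun_prop
    exact h0.indicator (measurableSet_lt measurable_fst measurable_snd)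
  have h1 : Measurable fun r => ∫ x in Ioi r, integrandBS β α r x := by
    have : ∀ r, ∫ x in Ioi r, integrandBS β α r x
        = ∫ x, (Ioi r).indicator (integrandBS β α r) x := fun r =>
      (integral_indicator measurableSet_Ioi).symm
    simp_rw [this]
    exact h.stronglyMeasurable.integral_prod_right'.measurable
  exact Real.measurable_exp.comp (h1.const_mul _)

lemma measurable_laplaceArg (μ β α PB : ℝ) : Measurable (laplaceArg μ β α PB) := by
  unfold laplaceArg
  fun_prop

lemma laplaceBS_le_one {lamD β α r : ℝ} (hD : 0 ≤ lamD) (hβ : 0 ≤ β) (hr : 0 ≤ r) :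
    laplaceBS lamD β α r ≤ 1 := by
  rw [laplaceBS, Real.exp_le_one_iff, neg_mul, neg_nonpos]
  exact mul_nonneg (by positivity) (setIntegral_nonneg measurableSet_Ioi fun y hy =>
    integrandBS_nonneg hβ hr (hr.trans (le_of_lt hy)))

lemma laplaceMS_le_one {lamU β α PB PM r : ℝ} (hU : 0 ≤ lamU) (hβ : 0 ≤ β * (PM / PB))
    (hr : 0 ≤ r) : laplaceMS lamU β α PB PM r ≤ 1 := by
  rw [laplaceMS, integrandMS_eq, Real.exp_le_one_iff, neg_mul, neg_nonpos]
  exact mul_nonneg (by positivity) (setIntegral_nonneg measurableSet_Ioi fun y hy =>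
    integrandBS_nonneg hβ hr (le_of_lt hy))

namespace Network

section Random

variable {Ω : Type*} [MeasurableSpace Ω] {P : Measure Ω} [IsProbabilityMeasure P]
  {N : Network Ω} {lamU lamD μ : ℝ}

/-- Given the serving distance, the marks being integrated out, the other base stations contribute
the closed form of the Laplace transform. -/
lemma IsIndependentPPP.lintegral_mul_expNeg_otherSum (hN : N.IsIndependentPPP P lamU lamD μ)
    (hU : 0 ≤ lamU) (hD : 0 < lamD) {α β : ℝ} (hα : 2 < α) (hβ : 0 ≤ β) {h : ℝ → ℝ≥0∞}
    (hh : Measurable h) :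
    ∫⁻ ω, h (N.servingDist ω) *
        expNeg (otherSum (bsLoss β α (lamD / (lamU + lamD))) fun i => N.bsPos i ω) ∂P
      = ∫⁻ ω, h (N.servingDist ω) * ENNReal.ofReal (laplaceBS lamD β α (N.servingDist ω)) ∂P := by
  have hp1 : lamD / (lamU + lamD) ≤ 1 := by rw [div_le_one (by positivity)]; linarith
  simp_rw [servingDist_eq]
  rw [hN.bs.poisson.lintegral_mul_expNeg_otherSum (by positivity) hβ hα
    (measurable_uncurry_bsLoss β α _) (fun r ρ hr hρ => tendsto_bsLoss hβ hp1 hr hρ)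
    (fun r ρ hr hρ => bsLoss_le hβ hp1 hr hρ) ?_ hh]
  · refine lintegral_congr fun ω => ?_
    rw [farLaplace_bsLoss hU hD hα hβ (r := nearestDist _) (norm_nonneg _)]
  · intro r hr
    have hcont : Continuous fun r : ℝ => ENNReal.ofReal (Real.exp
        (-(2 * π * lamD * ∫ x in Ioi (1 : ℝ), integrandBS β α 1 x) * r ^ 2)) :=
      ENNReal.continuous_ofReal.comp (by fun_prop)
    have heq : ∀ b, 0 < b → farLaplace (lamU + lamD) (bsLoss β α (lamD / (lamU + lamD))) b
        = ENNReal.ofReal (Real.exp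
          (-(2 * π * lamD * ∫ x in Ioi (1 : ℝ), integrandBS β α 1 x) * b ^ 2)) := fun b hb => by
      rw [farLaplace_bsLoss hU hD hα hβ hb.le, laplaceBS_eq _ _ _ hb]
    rw [heq r hr]
    refine ((hcont.tendsto r).mono_left nhdsWithin_le_nhds).congr' ?_
    filter_upwards [self_mem_nhdsWithin] with b hb
    exact (heq b (hr.trans hb)).symm

lemma lintegral_indicator_downlink_mul (hU : 0 ≤ lamU) (hD : 0 < lamD) (hμ : 0 < μ) (c : ℝ≥0∞) :
    ∫⁻ q : Direction × ℝ, (Prod.fst ⁻¹' {Direction.downlink}).indicator 1 q * c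
        ∂((directionLaw lamU lamD).prod (expMeasure μ))
      = ENNReal.ofReal (lamD / (lamU + lamD)) * c := by
  have := isProbabilityMeasure_directionLaw hU hD
  have := isProbabilityMeasure_expMeasure hμ
  rw [lintegral_mul_const _ (measurable_one.indicator (measurableSet_fst_preimage _)),
    lintegral_indicator_one (measurableSet_fst_preimage _), ← prod_univ, Measure.prod_prod,
    measure_univ, mul_one, directionLaw_downlink]

/-- With the locations fixed, the direction of the serving base station is independent of the
interference of the other ones. -/
lemma lintegral_downlinkConfigs_mul (hU : 0 ≤ lamU) (hD : 0 < lamD) (hμ : 0 < μ) (α PB : ℝ)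
    (x : ℕ → Plane) {g : ℝ × ℝ≥0∞ → ℝ≥0∞} (hg : Measurable g) :
    ∫⁻ z, downlinkConfigs.indicator 1 (x, z) * g (nearestDist x, bsInterference α PB x z)
        ∂(Measure.infinitePi fun _ : ℕ => (directionLaw lamU lamD).prod (expMeasure μ))
      = ENNReal.ofReal (lamD / (lamU + lamD)) * ∫⁻ z, g (nearestDist x, bsInterference α PB x z)
        ∂(Measure.infinitePi fun _ : ℕ => (directionLaw lamU lamD).prod (expMeasure μ)) := by
  have := isProbabilityMeasure_directionLaw hU hD
  have := isProbabilityMeasure_expMeasure hμ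
  have hgx : Measurable fun y => g (nearestDist x, y) := hg.comp measurable_prodMk_left
  have hH : Measurable fun q : (Direction × ℝ) × ℝ≥0∞ =>
      (Prod.fst ⁻¹' {Direction.downlink}).indicator 1 q.1 * g (nearestDist x, q.2) :=
    ((measurable_one.indicator (measurableSet_fst_preimage _)).comp measurable_fst).mul
      (hgx.comp measurable_snd)
  have hgz : Measurable fun z => g (nearestDist x, bsInterference α PB x z) :=
    hgx.comp (measurable_bsInterference α PB).of_uncurry_left
  have h1 := lintegral_eval_bsInterference (δ := directionLaw lamU lamD) (μ := μ) (α := α)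
    (PB := PB) x hH
  rw [← lintegral_const_mul _ hgz]
  refine Eq.trans ?_ (h1.trans (lintegral_congr fun z =>
    lintegral_indicator_downlink_mul hU hD hμ (g (nearestDist x, bsInterference α PB x z))))
  rfl

/-- The direction of the serving base station is independent of the locations and of the
interference of the other base stations. -/
lemma IsIndependentPPP.setLIntegral_isDownlink_bs (hN : N.IsIndependentPPP P lamU lamD μ)
    (hU : 0 ≤ lamU) (hD : 0 < lamD) (hμ : 0 < μ) (α PB : ℝ) {g : ℝ × ℝ≥0∞ → ℝ≥0∞}
    (hg : Measurable g) :
    ∫⁻ ω in N.isDownlink, g (N.servingDist ω, N.interferenceBS α PB ω) ∂P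
      = ENNReal.ofReal (lamD / (lamU + lamD)) *
        ∫⁻ ω, ∫⁻ z, g (N.servingDist ω, bsInterference α PB (fun i => N.bsPos i ω) z)
          ∂(Measure.infinitePi fun _ : ℕ => (directionLaw lamU lamD).prod (expMeasure μ)) ∂P := by
  have := isProbabilityMeasure_directionLaw hU hD
  have := isProbabilityMeasure_expMeasure hμ
  simp_rw [hN.setLIntegral_isDownlink, interferenceBS_eq, servingDist_eq]
  set G : (ℕ → Plane) × (ℕ → Direction × ℝ) → ℝ≥0∞ := fun b =>
    downlinkConfigs.indicator 1 b * g (nearestDist b.1, Function.uncurry (bsInterference α PB) b)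
    with hG
  have hgm : Measurable fun b : (ℕ → Plane) × (ℕ → Direction × ℝ) =>
      g (nearestDist b.1, Function.uncurry (bsInterference α PB) b) :=
    hg.comp ((measurable_nearestDist.comp measurable_fst).prodMk (measurable_bsInterference α PB))
  have hGm : Measurable G := (measurable_one.indicator measurableSet_downlinkConfigs).mul hgm
  have hgI : Measurable fun ω => ∫⁻ z, g (nearestDist fun i => N.bsPos i ω,
      bsInterference α PB (fun i => N.bsPos i ω) z)
      ∂(Measure.infinitePi fun _ : ℕ => (directionLaw lamU lamD).prod (expMeasure μ)) :=
    hgm.lintegral_prod_right'.comp hN.bs.poisson.measurable_pi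
  have h1 := hN.bs.lintegral_eq hGm
  simp only [hG] at h1
  refine h1.trans ?_
  rw [← lintegral_const_mul _ hgI]
  exact lintegral_congr fun ω =>
    lintegral_downlinkConfigs_mul hU hD hμ α PB (fun i => N.bsPos i ω) hg

/-- Being a downlink mobile station is independent of the serving distance. -/
lemma IsIndependentPPP.setLIntegral_servingDist (hN : N.IsIndependentPPP P lamU lamD μ)
    (hU : 0 ≤ lamU) (hD : 0 < lamD) (hμ : 0 < μ) {h : ℝ → ℝ≥0∞} (hh : Measurable h) :
    ∫⁻ ω in N.isDownlink, h (N.servingDist ω) ∂P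
      = ENNReal.ofReal (lamD / (lamU + lamD)) * ∫⁻ ω, h (N.servingDist ω) ∂P := by
  have := isProbabilityMeasure_directionLaw hU hD
  have := isProbabilityMeasure_expMeasure hμ
  have h1 := hN.setLIntegral_isDownlink_bs hU hD hμ 0 0 (hh.comp measurable_fst)
  simpa using h1

lemma IsIndependentPPP.measure_isDownlink (hN : N.IsIndependentPPP P lamU lamD μ)
    (hU : 0 ≤ lamU) (hD : 0 < lamD) (hμ : 0 < μ) :
    P N.isDownlink = ENNReal.ofReal (lamD / (lamU + lamD)) := by
  have h1 := hN.setLIntegral_servingDist hU hD hμ (h := fun _ => 1) measurable_const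
  simpa using h1

lemma IsIndependentPPP.lintegral_downlinkLaw (hN : N.IsIndependentPPP P lamU lamD μ)
    (hU : 0 ≤ lamU) (hD : 0 < lamD) (hμ : 0 < μ) (f : Ω → ℝ≥0∞) {c : ℝ≥0∞}
    (h : ∫⁻ ω in N.isDownlink, f ω ∂P = ENNReal.ofReal (lamD / (lamU + lamD)) * c) :
    ∫⁻ ω, f ω ∂(N.downlinkLaw P) = c := by
  have hp : 0 < lamD / (lamU + lamD) := by positivity
  rw [downlinkLaw, ProbabilityTheory.cond, lintegral_smul_measure, h, hN.measure_isDownlink hU hD hμ,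
    smul_eq_mul, ← mul_assoc, ENNReal.inv_mul_cancel (by simpa using hp) ENNReal.ofReal_ne_top,
    one_mul]

lemma IsIndependentPPP.isProbabilityMeasure_downlinkLaw (hN : N.IsIndependentPPP P lamU lamD μ)
    (hU : 0 ≤ lamU) (hD : 0 < lamD) (hμ : 0 < μ) : IsProbabilityMeasure (N.downlinkLaw P) := by
  have hp : 0 < lamD / (lamU + lamD) := by positivity
  refine cond_isProbabilityMeasure ?_
  rw [hN.measure_isDownlink hU hD hμ]
  simpa using hp

lemma IsIndependentPPP.setLIntegral_mul_expNeg_interferenceBS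
    (hN : N.IsIndependentPPP P lamU lamD μ)
    (hU : 0 ≤ lamU) (hD : 0 < lamD) (hμ : 0 < μ) {α β PB : ℝ} (hα : 2 < α) (hβ : 0 < β)
    (hPB : 0 < PB) {h : ℝ → ℝ≥0∞} (hh : Measurable h) :
    ∫⁻ ω in N.isDownlink, h (N.servingDist ω) *
        expNeg (ENNReal.ofReal (laplaceArg μ β α PB (N.servingDist ω)) *
          N.interferenceBS α PB ω) ∂P
      = ENNReal.ofReal (lamD / (lamU + lamD)) *
        ∫⁻ ω, h (N.servingDist ω) * ENNReal.ofReal (laplaceBS lamD β α (N.servingDist ω)) ∂P := by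
  have := isProbabilityMeasure_directionLaw hU hD
  have := isProbabilityMeasure_expMeasure hμ
  have hp1 : lamD / (lamU + lamD) ≤ 1 := by rw [div_le_one (by positivity)]; linarith
  have hg : Measurable fun q : ℝ × ℝ≥0∞ => h q.1 *
      expNeg (ENNReal.ofReal (laplaceArg μ β α PB q.1) * q.2) :=
    (hh.comp measurable_fst).mul (measurable_expNeg.comp
      (((measurable_laplaceArg μ β α PB).comp measurable_fst).ennreal_ofReal.mul measurable_snd))
  rw [hN.setLIntegral_isDownlink_bs hU hD hμ α PB hg,
    ← hN.lintegral_mul_expNeg_otherSum hU hD hα hβ.le hh]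
  congr 1
  refine lintegral_congr fun ω => ?_
  have hm : Measurable fun z => expNeg (ENNReal.ofReal (laplaceArg μ β α PB (N.servingDist ω)) *
      bsInterference α PB (fun i => N.bsPos i ω) z) :=
    measurable_expNeg.comp
      (((measurable_bsInterference α PB).comp measurable_prodMk_left).const_mul _)
  simp only
  rw [lintegral_const_mul _ hm, servingDist_eq, lintegral_expNeg_bsInterference _ hμ
    (by positivity) hp1 (directionLaw_downlink _ _) hβ.le hPB]

lemma IsIndependentPPP.setLIntegral_mul_expNeg_interferenceMS
    (hN : N.IsIndependentPPP P lamU lamD μ)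
    (hU : 0 ≤ lamU) (hD : 0 < lamD) (hμ : 0 < μ) {α β PB PM : ℝ} (hα : 2 < α) (hβ : 0 < β)
    (hPB : 0 < PB) (hPM : 0 < PM) {h : ℝ → ℝ≥0∞} (hh : Measurable h) :
    ∫⁻ ω in N.isDownlink, h (N.servingDist ω) *
        expNeg (ENNReal.ofReal (laplaceArg μ β α PB (N.servingDist ω)) *
          N.interferenceMS α PM ω) ∂P
      = ENNReal.ofReal (lamD / (lamU + lamD)) *
        ∫⁻ ω, h (N.servingDist ω) *
          ENNReal.ofReal (laplaceMS lamU β α PB PM (N.servingDist ω)) ∂P := by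
  have h0 := hN.setLIntegral_servingDist hU hD hμ
    (h := fun r => h r * ENNReal.ofReal (laplaceMS lamU β α PB PM r))
    (hh.mul (measurable_laplaceMS lamU β α PB PM).ennreal_ofReal)
  rw [← h0]
  simp_rw [hN.setLIntegral_isDownlink, interferenceMS_eq, servingDist_eq]
  have hE : Measurable fun q : ((ℕ → Plane) × (ℕ → Direction × ℝ)) ×
      ((ℕ → Plane) × (ℕ → Direction × ℝ)) =>
      expNeg (ENNReal.ofReal (laplaceArg μ β α PB (nearestDist q.1.1)) *
        Function.uncurry (msInterference α PM) q.2) :=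
    measurable_expNeg.comp (((measurable_laplaceArg μ β α PB).comp
      (measurable_nearestDist.comp (measurable_fst.comp measurable_fst))).ennreal_ofReal.mul
      ((measurable_msInterference α PM).comp measurable_snd))
  have hG : Measurable fun q : ((ℕ → Plane) × (ℕ → Direction × ℝ)) ×
      ((ℕ → Plane) × (ℕ → Direction × ℝ)) =>
      downlinkConfigs.indicator 1 q.1 * (h (nearestDist q.1.1) *
        expNeg (ENNReal.ofReal (laplaceArg μ β α PB (nearestDist q.1.1)) *
        Function.uncurry (msInterference α PM) q.2)) :=
    ((measurable_one.indicator measurableSet_downlinkConfigs).comp measurable_fst).mul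
      ((hh.comp (measurable_nearestDist.comp (measurable_fst.comp measurable_fst))).mul hE)
  refine (lintegral_of_indepFun hN.aemeasurable_bsConfig hN.aemeasurable_msConfig
    hN.indepFun_config hG).trans (lintegral_congr fun ω => ?_)
  have hm : AEMeasurable (fun ω' => expNeg (ENNReal.ofReal (laplaceArg μ β α PB
      (nearestDist (N.bsConfig ω).1)) *
      Function.uncurry (msInterference α PM) (N.msConfig ω'))) P :=
    (hE.comp measurable_prodMk_left).comp_aemeasurable hN.aemeasurable_msConfig
  simp only
  rw [lintegral_const_mul'' _ (hm.const_mul _), lintegral_const_mul'' _ hm,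
    hN.lintegral_expNeg_msInterference hU hD hμ hα hβ hPB hPM
      (r := nearestDist (N.bsConfig ω).1) (norm_nonneg _)]
  rfl

/-- The configurations of base and mobile stations for which the serving base station is a downlink
one and its signal is at least `β` times the sum of interference and noise. -/
def successConfigs (α PB PM σ β : ℝ) :
    Set (((ℕ → Plane) × (ℕ → Direction × ℝ)) × ((ℕ → Plane) × (ℕ → Direction × ℝ))) :=
  {q | q.1.2 (nearestIdx q.1.1) ∈ Prod.fst ⁻¹' {Direction.downlink} ∧
    ENNReal.ofReal β * (Function.uncurry (bsInterference α PB) q.1 +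
      (Function.uncurry (msInterference α PM) q.2 + ENNReal.ofReal (σ ^ 2)))
      ≤ ENNReal.ofReal ((q.1.2 (nearestIdx q.1.1)).2 * nearestDist q.1.1 ^ (-α) * PB)}

lemma measurableSet_successConfigs (α PB PM σ β : ℝ) :
    MeasurableSet (successConfigs α PB PM σ β) := by
  refine MeasurableSet.inter (measurable_fst measurableSet_downlinkConfigs) ?_
  have h1 : Measurable fun q : ((ℕ → Plane) × (ℕ → Direction × ℝ)) ×
      ((ℕ → Plane) × (ℕ → Direction × ℝ)) => ENNReal.ofReal β *
      (Function.uncurry (bsInterference α PB) q.1 +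
      (Function.uncurry (msInterference α PM) q.2 + ENNReal.ofReal (σ ^ 2))) :=
    (((measurable_bsInterference α PB).comp measurable_fst).add
      (((measurable_msInterference α PM).comp measurable_snd).add_const _)).const_mul _
  have h2 : Measurable fun q : ((ℕ → Plane) × (ℕ → Direction × ℝ)) ×
      ((ℕ → Plane) × (ℕ → Direction × ℝ)) =>
      (q.1.2 (nearestIdx q.1.1)).2 * nearestDist q.1.1 ^ (-α) * PB :=
    (((measurable_eval_nearestIdx.comp measurable_fst).snd).mul
      ((measurable_nearestDist.comp (measurable_fst.comp measurable_fst)).pow_const _)).mul_const _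
  exact measurableSet_le h1 h2.ennreal_ofReal

/-- The SINR condition can be cleared of its denominator, because the signal is almost surely
positive; hence the convention for `0 / 0` is immaterial. -/
lemma IsIndependentPPP.measure_sinr_inter (hN : N.IsIndependentPPP P lamU lamD μ)
    (hU : 0 ≤ lamU) (hD : 0 < lamD) (hμ : 0 < μ) {α PB : ℝ} (hPB : 0 < PB) (PM σ β : ℝ) :
    P ({ω | ENNReal.ofReal β ≤ N.sinr α PB PM σ ω} ∩ N.isDownlink)
      = ∫⁻ ω, (successConfigs α PB PM σ β).indicator 1 (N.bsConfig ω, N.msConfig ω) ∂P := by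
  have := isProbabilityMeasure_directionLaw hU hD
  have hnull : NullMeasurableSet
      ((fun ω => (N.bsConfig ω, N.msConfig ω)) ⁻¹' successConfigs α PB PM σ β) P :=
    (hN.aemeasurable_bsConfig.prodMk hN.aemeasurable_msConfig).nullMeasurableSet_preimage
      (measurableSet_successConfigs α PB PM σ β)
  have h1 : ∫⁻ ω, (successConfigs α PB PM σ β).indicator 1 (N.bsConfig ω, N.msConfig ω) ∂P
      = P ((fun ω => (N.bsConfig ω, N.msConfig ω)) ⁻¹' successConfigs α PB PM σ β) := by
    rw [← lintegral_indicator_one₀ hnull]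
    rfl
  rw [h1]
  refine measure_congr ?_
  filter_upwards [hN.bs.ae_gain_pos hμ, hN.ae_servingDist_pos (by positivity)] with ω hg hR
  refine propext ?_
  have hS : 0 < N.bsGain (N.serving ω) ω * N.servingDist ω ^ (-α) * PB := by
    have : 0 < N.bsGain (N.serving ω) ω := hg _
    positivity
  have hS0 : ENNReal.ofReal (N.bsGain (N.serving ω) ω * N.servingDist ω ^ (-α) * PB) ≠ 0 := by
    simpa using hS
  have hiff : ENNReal.ofReal β ≤ N.sinr α PB PM σ ω ↔
      ENNReal.ofReal β * (N.interferenceBS α PB ω + (N.interferenceMS α PM ω +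
        ENNReal.ofReal (σ ^ 2)))
        ≤ ENNReal.ofReal (N.bsGain (N.serving ω) ω * N.servingDist ω ^ (-α) * PB) := by
    rw [sinr, ENNReal.le_div_iff_mul_le (Or.inr hS0) (Or.inr ENNReal.ofReal_ne_top), add_assoc]
  change (ENNReal.ofReal β ≤ N.sinr α PB PM σ ω ∧ ω ∈ N.isDownlink) ↔ _
  rw [hiff, interferenceBS_eq, interferenceMS_eq, isDownlink_eq, bsGain, servingDist_eq, serving_eq,
    and_comm]
  rfl

/-- The marks of the base stations are integrated out first, then the mobile stations, and last the
base stations other than the serving one. -/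
lemma IsIndependentPPP.measure_sinr_inter_eq (hN : N.IsIndependentPPP P lamU lamD μ)
    (hU : 0 ≤ lamU) (hD : 0 < lamD) (hμ : 0 < μ) {α β PB PM : ℝ} (hα : 2 < α) (hβ : 0 < β)
    (hPB : 0 < PB) (hPM : 0 < PM) (σ : ℝ) :
    P ({ω | ENNReal.ofReal β ≤ N.sinr α PB PM σ ω} ∩ N.isDownlink)
      = ENNReal.ofReal (lamD / (lamU + lamD)) * ∫⁻ ω,
        ENNReal.ofReal (Real.exp (-(laplaceArg μ β α PB (N.servingDist ω) * σ ^ 2)))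
          * ENNReal.ofReal (laplaceMS lamU β α PB PM (N.servingDist ω))
          * ENNReal.ofReal (laplaceBS lamD β α (N.servingDist ω)) ∂P := by
  have := isProbabilityMeasure_directionLaw hU hD
  have := isProbabilityMeasure_expMeasure hμ
  set p := lamD / (lamU + lamD) with hp
  have hp0 : 0 ≤ p := by positivity
  have hp1 : p ≤ 1 := by rw [hp, div_le_one (by positivity)]; linarith
  set K : (ℕ → Plane) × ((ℕ → Plane) × (ℕ → Direction × ℝ)) → ℝ≥0∞ := fun q =>
    ENNReal.ofReal p * (expNeg (ENNReal.ofReal (laplaceArg μ β α PB (nearestDist q.1)) *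
      (Function.uncurry (msInterference α PM) q.2 + ENNReal.ofReal (σ ^ 2))) *
      expNeg (otherSum (bsLoss β α p) q.1)) with hK
  have hsm : Measurable fun x : ℕ → Plane =>
      ENNReal.ofReal (laplaceArg μ β α PB (nearestDist x)) :=
    ((measurable_laplaceArg μ β α PB).comp measurable_nearestDist).ennreal_ofReal
  have hKm : Measurable K :=
    ((measurable_expNeg.comp ((hsm.comp measurable_fst).mul
      (((measurable_msInterference α PM).comp measurable_snd).add_const _))).mul
      (measurable_expNeg.comp ((measurable_otherSum (measurable_uncurry_bsLoss β α p)).comp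
        measurable_fst))).const_mul _
  have hmarks : ∀ c, ∫⁻ ω, (successConfigs α PB PM σ β).indicator 1 (N.bsConfig ω, c) ∂P
      = ∫⁻ ω, K (fun i => N.bsPos i ω, c) ∂P := by
    intro c
    have hm : Measurable fun b => (successConfigs α PB PM σ β).indicator
        (1 : ((ℕ → Plane) × (ℕ → Direction × ℝ)) ×
          ((ℕ → Plane) × (ℕ → Direction × ℝ)) → ℝ≥0∞) (b, c) :=
      (measurable_one.indicator (measurableSet_successConfigs α PB PM σ β)).comp
        measurable_prodMk_right
    refine (hN.bs.lintegral_eq hm).trans (lintegral_congr_ae ?_)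
    filter_upwards [hN.bs.poisson.ae_isGoodConfig (by positivity)] with ω hω
    exact measure_success_of_locations (fun i => N.bsPos i ω) hω.nearestDist_pos hμ hp0 hp1
      (directionLaw_downlink _ _) hβ.le hPB
      (Function.uncurry (msInterference α PM) c + ENNReal.ofReal (σ ^ 2))
  have hind : IndepFun (fun ω i => N.bsPos i ω) N.msConfig P :=
    hN.indepFun_config.comp measurable_fst measurable_id
  have hXm := hN.bs.poisson.measurable_pi.aemeasurable (μ := P)
  rw [hN.measure_sinr_inter hU hD hμ hPB, lintegral_of_indepFun' hN.aemeasurable_bsConfig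
    hN.aemeasurable_msConfig hN.indepFun_config
    (measurable_one.indicator (measurableSet_successConfigs α PB PM σ β))]
  simp_rw [hmarks]
  rw [← lintegral_of_indepFun' hXm hN.aemeasurable_msConfig hind hKm,
    lintegral_of_indepFun hXm hN.aemeasurable_msConfig hind hKm]
  have hh : Measurable fun r => ENNReal.ofReal (Real.exp (-(laplaceArg μ β α PB r * σ ^ 2)))
      * ENNReal.ofReal (laplaceMS lamU β α PB PM r) := by
    have := measurable_laplaceArg μ β α PB
    exact (Real.measurable_exp.comp (this.mul_const _).neg).ennreal_ofReal.mul
      (measurable_laplaceMS lamU β α PB PM).ennreal_ofReal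
  have hOm : Measurable fun ω => expNeg (otherSum (bsLoss β α p) fun i => N.bsPos i ω) :=
    measurable_expNeg.comp ((measurable_otherSum (measurable_uncurry_bsLoss β α p)).comp
      hN.bs.poisson.measurable_pi)
  have hprod : Measurable fun ω =>
      (ENNReal.ofReal (Real.exp (-(laplaceArg μ β α PB (N.servingDist ω) * σ ^ 2)))
      * ENNReal.ofReal (laplaceMS lamU β α PB PM (N.servingDist ω)))
      * expNeg (otherSum (bsLoss β α p) fun i => N.bsPos i ω) :=
    (hh.comp hN.measurable_servingDist).mul hOm
  rw [← hN.lintegral_mul_expNeg_otherSum hU hD hα hβ.le hh, ← lintegral_const_mul _ hprod]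
  refine lintegral_congr fun ω => ?_
  have hR : 0 ≤ nearestDist fun i => N.bsPos i ω := norm_nonneg _
  have hs := laplaceArg_nonneg (α := α) hμ.le hβ.le hPB.le hR
  have hmE : AEMeasurable (fun ω' => expNeg (ENNReal.ofReal (laplaceArg μ β α PB
      (nearestDist fun i => N.bsPos i ω)) *
      Function.uncurry (msInterference α PM) (N.msConfig ω'))) P :=
    (measurable_expNeg.comp ((measurable_msInterference α PM).const_mul _)).comp_aemeasurable
      hN.aemeasurable_msConfig
  have hsplit : ∀ ω', K (fun i => N.bsPos i ω, N.msConfig ω')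
      = ENNReal.ofReal p * (ENNReal.ofReal (Real.exp (-(laplaceArg μ β α PB (N.servingDist ω)
          * σ ^ 2))) * expNeg (otherSum (bsLoss β α p) fun i => N.bsPos i ω)) *
        expNeg (ENNReal.ofReal (laplaceArg μ β α PB (nearestDist fun i => N.bsPos i ω)) *
          Function.uncurry (msInterference α PM) (N.msConfig ω')) := by
    intro ω'
    simp only [hK]
    rw [mul_add, expNeg_add, ← ENNReal.ofReal_mul hs, expNeg_ofReal (by positivity),
      servingDist_eq]
    ring
  simp_rw [hsplit]
  rw [lintegral_const_mul'' _ hmE, hN.lintegral_expNeg_msInterference hU hD hμ hα hβ hPB hPM hR,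
    servingDist_eq]
  ring

/-- The success probability as an integral over the Rayleigh law of the serving distance. -/
lemma IsIndependentPPP.successProb_eq (hN : N.IsIndependentPPP P lamU lamD μ)
    (hU : 0 ≤ lamU) (hD : 0 < lamD) (hμ : 0 < μ) {α β PB PM : ℝ} (hα : 2 < α) (hβ : 0 < β)
    (hPB : 0 < PB) (hPM : 0 < PM) (σ : ℝ) :
    N.successProb P α PB PM σ β = 2 * π * (lamU + lamD) * ∫ r in Ioi (0 : ℝ),
      successIntegrand (lamU + lamD) lamU lamD μ α PB PM σ β r := by
  have hp : 0 < lamD / (lamU + lamD) := by positivity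
  have hh : Measurable fun r => ENNReal.ofReal (Real.exp (-(laplaceArg μ β α PB r * σ ^ 2)))
      * ENNReal.ofReal (laplaceMS lamU β α PB PM r) * ENNReal.ofReal (laplaceBS lamD β α r) := by
    have := measurable_laplaceArg μ β α PB
    exact ((Real.measurable_exp.comp (this.mul_const _).neg).ennreal_ofReal.mul
      (measurable_laplaceMS lamU β α PB PM).ennreal_ofReal).mul
      (measurable_laplaceBS lamD β α).ennreal_ofReal
  have hnn : ∀ r ∈ Ioi (0 : ℝ),
      0 ≤ successIntegrand (lamU + lamD) lamU lamD μ α PB PM σ β r := by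
    intro r (hr : 0 < r)
    unfold successIntegrand laplaceBS laplaceMS
    positivity
  have hint := integrableOn_successIntegrand (α := α) (σ := σ) (by positivity : 0 < lamU + lamD)
    hU hD.le hμ.le hPB.le hPM.le hβ.le
  have hI : 0 ≤ ∫ r in Ioi (0 : ℝ),
      successIntegrand (lamU + lamD) lamU lamD μ α PB PM σ β r :=
    setIntegral_nonneg measurableSet_Ioi hnn
  have hval : N.downlinkLaw P {ω | ENNReal.ofReal β ≤ N.sinr α PB PM σ ω}
      = ENNReal.ofReal (2 * π * (lamU + lamD) * ∫ r in Ioi (0 : ℝ),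
        successIntegrand (lamU + lamD) lamU lamD μ α PB PM σ β r) := by
    rw [downlinkLaw, ProbabilityTheory.cond, Measure.smul_apply,
      Measure.restrict_apply₀' hN.nullMeasurableSet_isDownlink,
      hN.measure_sinr_inter_eq hU hD hμ hα hβ hPB hPM, hN.measure_isDownlink hU hD hμ, smul_eq_mul,
      ← mul_assoc, ENNReal.inv_mul_cancel (by simpa using hp) ENNReal.ofReal_ne_top, one_mul]
    simp_rw [servingDist_eq]
    rw [hN.bs.poisson.lintegral_nearestDist (by positivity) hh, ← integral_const_mul,
      ofReal_integral_eq_lintegral_ofReal (hint.const_mul _)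
        ((ae_restrict_iff' measurableSet_Ioi).2 (ae_of_all _ fun r hr =>
          mul_nonneg (by positivity) (hnn r hr)))]
    refine setLIntegral_congr_fun measurableSet_Ioi fun r (hr : 0 < r) => ?_
    have h1 : 0 ≤ laplaceMS lamU β α PB PM r := (Real.exp_pos _).le
    rw [← ENNReal.ofReal_mul (by positivity), ← ENNReal.ofReal_mul (by positivity),
      ← ENNReal.ofReal_mul (by positivity), successIntegrand, sub_eq_add_neg, Real.exp_add]
    congr 1
    ring
  rw [successProb, Measure.real, hval, ENNReal.toReal_ofReal (by positivity)]

end Random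

end Network

end CoMPflex

theorem theorem2 {Ω : Type*} [MeasurableSpace Ω] (P : Measure Ω) [IsProbabilityMeasure P]
    (N : CoMPflex.Network Ω) (lamC lamU lamD μ α PB PM σ β : ℝ)
    (hlamU : 0 ≤ lamU) (hlamD : 0 < lamD) (hlamC : lamC = lamU + lamD)
    (hμ : 0 < μ) (hα : 2 < α) (hPB : 0 < PB) (hPM : 0 < PM) (hβ : 0 < β)
    (hN : N.IsIndependentPPP P lamU lamD μ) :
    -- success probability; all integrals in the formula converge
    (∀ r : ℝ, 0 < r → IntegrableOn (CoMPflex.integrandBS β α r) (Set.Ioi r) volume ∧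
        IntegrableOn (CoMPflex.integrandMS β α PB PM r) (Set.Ioi 0) volume) ∧
    IntegrableOn (CoMPflex.successIntegrand lamC lamU lamD μ α PB PM σ β) (Set.Ioi 0) volume ∧
    N.successProb P α PB PM σ β
      = 2 * Real.pi * lamC *
          ∫ r in Set.Ioi (0 : ℝ),
            CoMPflex.successIntegrand lamC lamU lamD μ α PB PM σ β r ∧
    -- the interference is finite, and the two factors in the formula are its Laplace transforms
    -- at `s = μ β r ^ α / PB`, given that the serving distance is `r`
    (∀ᵐ ω ∂(N.downlinkLaw P), N.interferenceBS α PB ω < ⊤ ∧ N.interferenceMS α PM ω < ⊤) ∧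
    (N.downlinkLaw P)[fun ω => Real.exp (-(CoMPflex.laplaceArg μ β α PB (N.servingDist ω)
          * (N.interferenceBS α PB ω).toReal)) | MeasurableSpace.comap N.servingDist inferInstance]
      =ᵐ[N.downlinkLaw P] (fun ω => CoMPflex.laplaceBS lamD β α (N.servingDist ω)) ∧
    (N.downlinkLaw P)[fun ω => Real.exp (-(CoMPflex.laplaceArg μ β α PB (N.servingDist ω)
          * (N.interferenceMS α PM ω).toReal)) | MeasurableSpace.comap N.servingDist inferInstance]
      =ᵐ[N.downlinkLaw P] (fun ω => CoMPflex.laplaceMS lamU β α PB PM (N.servingDist ω)) := by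
  subst hlamC
  have := hN.isProbabilityMeasure_downlinkLaw hlamU hlamD hμ
  have hac : N.downlinkLaw P ≪ P := cond_absolutelyContinuous
  have hfin : ∀ᵐ ω ∂(N.downlinkLaw P),
      N.interferenceBS α PB ω < ⊤ ∧ N.interferenceMS α PM ω < ⊤ :=
    hac.ae_le (hN.ae_interference_lt_top hlamU hlamD hμ hα hPB.le hPM.le)
  have hβ' : 0 ≤ β * (PM / PB) := by positivity
  have hR0 : ∀ ω, 0 ≤ N.servingDist ω := fun ω => norm_nonneg _
  have hs0 : ∀ ω, 0 ≤ CoMPflex.laplaceArg μ β α PB (N.servingDist ω) := fun ω =>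
    CoMPflex.laplaceArg_nonneg hμ.le hβ.le hPB.le (hR0 ω)
  have hBS : AEMeasurable (N.interferenceBS α PB) (N.downlinkLaw P) := by
    have h1 : N.interferenceBS α PB = fun ω =>
        Function.uncurry (CoMPflex.bsInterference α PB) (N.bsConfig ω) :=
      funext (N.interferenceBS_eq α PB)
    rw [h1]
    exact ((CoMPflex.measurable_bsInterference α PB).comp_aemeasurable
      hN.aemeasurable_bsConfig).mono_ac hac
  have hMS : AEMeasurable (N.interferenceMS α PM) (N.downlinkLaw P) := by
    have h1 : N.interferenceMS α PM = fun ω =>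
        Function.uncurry (CoMPflex.msInterference α PM) (N.msConfig ω) :=
      funext (N.interferenceMS_eq α PM)
    rw [h1]
    exact ((CoMPflex.measurable_msInterference α PM).comp_aemeasurable
      hN.aemeasurable_msConfig).mono_ac hac
  refine ⟨fun r hr => ⟨(CoMPflex.integrableOn_integrandBS hβ.le hα hr.le).mono_set
      (Ioi_subset_Ioi hr.le),
    CoMPflex.integrableOn_integrandBS hβ' hα hr.le⟩,
    CoMPflex.integrableOn_successIntegrand (by positivity) hlamU hlamD.le hμ.le hPB.le hPM.le hβ.le,
    hN.successProb_eq hlamU hlamD hμ hα hβ hPB hPM σ, hfin, ?_, ?_⟩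
  · refine CoMPflex.condExp_exp_neg_mul_eq hN.measurable_servingDist hBS (hfin.mono fun ω h => h.1)
      (CoMPflex.measurable_laplaceArg μ β α PB) hs0 (CoMPflex.measurable_laplaceBS lamD β α)
      (fun ω => (Real.exp_pos _).le) (fun ω => CoMPflex.laplaceBS_le_one hlamD.le hβ.le (hR0 ω))
      fun B hB => ?_
    have hB1 : Measurable (B.indicator (1 : ℝ → ℝ≥0∞)) := measurable_one.indicator hB
    rw [hN.lintegral_downlinkLaw hlamU hlamD hμ _
      (hN.setLIntegral_mul_expNeg_interferenceBS hlamU hlamD hμ hα hβ hPB hB1)]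
    exact (hN.lintegral_downlinkLaw hlamU hlamD hμ _ (hN.setLIntegral_servingDist hlamU hlamD hμ
      (hB1.mul (CoMPflex.measurable_laplaceBS lamD β α).ennreal_ofReal))).symm
  · refine CoMPflex.condExp_exp_neg_mul_eq hN.measurable_servingDist hMS (hfin.mono fun ω h => h.2)
      (CoMPflex.measurable_laplaceArg μ β α PB) hs0 (CoMPflex.measurable_laplaceMS lamU β α PB PM)
      (fun ω => (Real.exp_pos _).le) (fun ω => CoMPflex.laplaceMS_le_one hlamU hβ' (hR0 ω))
      fun B hB => ?_
    have hB1 : Measurable (B.indicator (1 : ℝ → ℝ≥0∞)) := measurable_one.indicator hB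
    rw [hN.lintegral_downlinkLaw hlamU hlamD hμ _
      (hN.setLIntegral_mul_expNeg_interferenceMS hlamU hlamD hμ hα hβ hPB hPM hB1)]
    exact (hN.lintegral_downlinkLaw hlamU hlamD hμ _ (hN.setLIntegral_servingDist hlamU hlamD hμ
      (hB1.mul (CoMPflex.measurable_laplaceMS lamU β α PB PM).ennreal_ofReal))).symm
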